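/- Let $p$ be a prime number and let $A$ be a complete discrete valuation ring whose residue field $A/\mathfrak m_A$ has characteristic $p$ (and may be imperfect). Let $K$ be the fraction field of $A$. For an $A$-algebra $B$ put $\mathfrak p_B=\mathfrak m_A B$ and $\overline B=B/\mathfrak p_B$. Let $\mathbf{CRP}_A$ be the full subcategory of the category of $A$-algebras whose objects are the $A$-algebras $B$ that are flat over $A$, complete (and separated) for the $\mathfrak p_B$-adic topology, and such that $x\mapsto x^p$ is bijective on $\overline B$. Let $A^{\mathrm u}$ be the initial object of $\mathbf{CRP}_A$ (the universal residual perfection of $A$), and let $A^{\mathrm g}$ (the generic residual perfection of $A$) be the object of $\mathbf{CRP}_A$ for which $\overline{A^{\mathrm g}}$, as an $\overline{A^{\mathrm u}}$-algebra via the unique map $A^{\mathrm u}\to A^{\mathrm g}$ of $A$-algebras, is the fraction field of $\overline{A^{\mathrm u}}$. Both are unique up to unique isomorphism, and $A^{\mathrm g}$ is a complete discrete valuation ring. Let $K^{\mathrm g}$ be the fraction field of $A^{\mathrm g}$. Fix a separable closure $L$ of $K^{\mathrm g}$ and let $K^{\mathrm s}$ be the separable closure of $K$ in $L$; put $G_{K^{\mathrm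 g}}=\mathrm{Gal}(L/K^{\mathrm g})$ and $G_K=\mathrm{Gal}(K^{\mathrm s}/K)$. For $(R,F,E)=(A,K,K^{\mathrm s})$ or $(A^{\mathrm g},K^{\mathrm g},L)$, let $\mathcal O_E$ be the integral closure of $R$ in $E$, a local ring, with maximal ideal $\mathfrak m_E$. The inertia subgroup of $\mathrm{Gal}(E/F)$ is the set of $\sigma$ with $\sigma(x)-x\in\mathfrak m_E$ for all $x\in\mathcal O_E$, and the wild inertia subgroup is the set of $\sigma$ with $\sigma(x)/x\in 1+\mathfrak m_E$ for all $x\in E^{*}$ (it is the unique pro-$p$-Sylow subgroup of the inertia subgroup). Theorem. The restriction map $G_{K^{\mathrm g}}\to G_K$ is surjective. Moreover, it maps the inertia subgroup of $G_{K^{\mathrm g}}$ onto the inertia subgroup of $G_K$, and the wild inertia subgroup of $G_{K^{\mathrm g}}$ onto the wild inertia subgroup of $G_K$. -/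

import Mathlib

open IsLocalRing

universe u

/-- The ideal `𝔭_B = 𝔪_A B` of an algebra `B` over a local ring `A`. -/
def extendedIdeal (A B : Type*) [CommRing A] [IsLocalRing A] [CommRing B] [Algebra A B] :
    Ideal B :=
  (maximalIdeal A).map (algebraMap A B)

/-- The reduction `B ⧸ 𝔭_B`. -/
abbrev Reduction (A B : Type*) [CommRing A] [IsLocalRing A] [CommRing B] [Algebra A B] : Type _ :=
  B ⧸ extendedIdeal A B

theorem extendedIdeal_le_comap {A B C : Type*} [CommRing A] [IsLocalRing A]
    [CommRing B] [Algebra A B] [CommRing C] [Algebra A C] (f : B →ₐ[A] C) :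
    extendedIdeal A B ≤ (extendedIdeal A C).comap (f : B →+* C) := by
  unfold extendedIdeal
  rw [← Ideal.map_le_iff_le_comap, Ideal.map_map, AlgHom.comp_algebraMap]

/-- The reduction `B ⧸ 𝔭_B → C ⧸ 𝔭_C` of a homomorphism `B → C` of `A`-algebras. -/
def reductionMap {A B C : Type*} [CommRing A] [IsLocalRing A]
    [CommRing B] [Algebra A B] [CommRing C] [Algebra A C] (f : B →ₐ[A] C) :
    Reduction A B →+* Reduction A C :=
  Ideal.quotientMap (extendedIdeal A C) (f : B →+* C) (extendedIdeal_le_comap f)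

/-- `B` is a complete residual perfection of `A`, where the residue field of `A` has
characteristic `p`: `B` is flat over `A`, complete (and separated) for the `𝔭_B`-adic topology,
and the `𝔽_p`-algebra `B ⧸ 𝔭_B` is perfect. -/
structure IsCompleteResidualPerfection (p : ℕ) (A B : Type*) [CommRing A] [IsLocalRing A]
    [CommRing B] [Algebra A B] : Prop where
  flat : Module.Flat A B
  complete : IsAdicComplete (extendedIdeal A B) B
  perfect : Function.Bijective fun x : Reduction A B => x ^ p

/-- `B` is the universal residual perfection `A^u` of `A`: the initial object of the category of
complete residual perfections of `A`, a full subcategory of the category of `A`-algebras. -/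
structure IsUniversalResidualPerfection (p : ℕ) (A B : Type u) [CommRing A] [IsLocalRing A]
    [CommRing B] [Algebra A B] : Prop where
  isCompleteResidualPerfection : IsCompleteResidualPerfection p A B
  existsUnique_algHom : ∀ (C : Type u) [CommRing C] [Algebra A C],
    IsCompleteResidualPerfection p A C → ∃! _f : B →ₐ[A] C, True

/-- `B` is the generic residual perfection `A^g` of `A`: the complete residual perfection of `A`
whose reduction, as an algebra over the reduction of `A^u` through the reduction of the (unique)
map `A^u → B` of `A`-algebras, is the fraction field of the reduction of `A^u`. -/
def IsGenericResidualPerfection (p : ℕ) (A B : Type u) [CommRing A] [IsLocalRing A]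
    [CommRing B] [Algebra A B] : Prop :=
  IsCompleteResidualPerfection p A B ∧
    ∃ (U : Type u) (_ : CommRing U) (_ : Algebra A U),
      IsUniversalResidualPerfection p A U ∧
        ∃ f : U →ₐ[A] B,
          letI : Algebra (Reduction A U) (Reduction A B) := (reductionMap f).toAlgebra
          IsFractionRing (Reduction A U) (Reduction A B)

section Galois

/-- The maximal ideal of the integral closure `O_L` of `A` in `L`, written as the Jacobson radical
of `O_L`. (When `A` is a complete discrete valuation ring and `L` is an algebraic extension of its
fraction field, `O_L` is a local ring.) -/
def integralMaximalIdeal (A L : Type*) [CommRing A] [Field L] [Algebra A L] :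
    Ideal (integralClosure A L) :=
  Ideal.jacobson ⊥

theorem smul_mem_integralMaximalIdeal (A K L : Type*) [CommRing A] [Field K] [Field L]
    [Algebra A K] [Algebra A L] [Algebra K L] [IsScalarTower A K L] (σ : L ≃ₐ[K] L)
    {y : integralClosure A L} (hy : y ∈ integralMaximalIdeal A L) :
    σ • y ∈ integralMaximalIdeal A L := by
  unfold integralMaximalIdeal at *
  rw [Ideal.mem_jacobson_bot] at *
  intro z
  have h := (hy (σ⁻¹ • z)).map (MulSemiringAction.toRingHom (L ≃ₐ[K] L) (integralClosure A L) σ)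
  simpa [smul_mul'] using h

/-- The inertia subgroup of `Gal(L/K)` (with respect to `A`): the automorphisms which act
trivially on the residue field of `O_L`. -/
def inertiaGroup (A K L : Type*) [CommRing A] [Field K] [Field L]
    [Algebra A K] [Algebra A L] [Algebra K L] [IsScalarTower A K L] : Subgroup (L ≃ₐ[K] L) :=
  (integralMaximalIdeal A L).inertia (L ≃ₐ[K] L)

/-- The wild inertia subgroup of `Gal(L/K)` (with respect to `A`): the automorphisms `σ` such that
`σ x / x ∈ 1 + 𝔪_L` for every nonzero `x` in `L`, where `𝔪_L` is the maximal ideal of `O_L`. -/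
def wildInertiaGroup (A K L : Type*) [CommRing A] [Field K] [Field L]
    [Algebra A K] [Algebra A L] [Algebra K L] [IsScalarTower A K L] : Subgroup (L ≃ₐ[K] L) where
  carrier := {σ | ∀ x : L, x ≠ 0 → ∃ y ∈ integralMaximalIdeal A L, σ x / x = 1 + (y : L)}
  one_mem' := fun x hx => ⟨0, zero_mem _, by simp [hx]⟩
  mul_mem' := by
    intro σ τ hσ hτ x hx
    obtain ⟨y, hy, h⟩ := hτ x hx
    obtain ⟨z, hz, h'⟩ := hσ (τ x) (by simpa using hx)
    have hτx : τ x ≠ 0 := by simpa using hx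
    refine ⟨z + y + z * y, add_mem (add_mem hz hy) (Ideal.mul_mem_right _ _ hz), ?_⟩
    rw [AlgEquiv.mul_apply, ← div_mul_div_cancel₀ hτx, h, h']
    push_cast
    ring
  inv_mem' := by
    intro σ hσ x hx
    have hx' : σ⁻¹ x ≠ 0 := by simpa using hx
    obtain ⟨y, hy, h⟩ := hσ (σ⁻¹ x) hx'
    have hσx : σ (σ⁻¹ x) = x := by rw [← AlgEquiv.mul_apply, mul_inv_cancel, AlgEquiv.one_apply]
    rw [hσx] at h
    have hu : IsUnit (1 + y) := by
      have := (Ideal.mem_jacobson_bot.1 hy) 1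
      rwa [mul_one, add_comm] at this
    obtain ⟨v, hv⟩ := hu.exists_right_inv
    have hv' : (1 + (y : L)) * (v : L) = 1 := by exact_mod_cast congrArg Subtype.val hv
    refine ⟨-(y * v), neg_mem (Ideal.mul_mem_right _ _ hy), ?_⟩
    have h1 : σ⁻¹ x / x = (v : L) := by
      rw [← inv_div, h, inv_eq_of_mul_eq_one_right hv']
    rw [h1]
    push_cast
    linear_combination hv'

/-- For an extension `K'/K` of fields and a separable closure `L` of `K'`, the restriction
homomorphism from `G_{K'} = Gal(L/K')` to `G_K = Gal(K^s/K)`, where `K^s` is the separable closure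
of `K` in `L`. -/
noncomputable def absoluteGaloisRestrict (K K' L : Type*) [Field K] [Field K'] [Field L]
    [Algebra K K'] [Algebra K' L] [Algebra K L] [IsScalarTower K K' L] [IsSepClosure K' L] :
    (L ≃ₐ[K'] L) →* (separableClosure K L ≃ₐ[K] separableClosure K L) :=
  haveI : IsSepClosed L := IsSepClosure.sep_closed K'
  (AlgEquiv.restrictNormalHom (F := K) (K₁ := L) (separableClosure K L)).comp
    (AlgEquiv.restrictScalarsHom K)

end Galois

/-! Let k be the residue field of A and π a uniformizer of A; π is also a uniformizer of A^g, whose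
residue field is perfect. The theorem rests on two properties of that residue field. Its elements
algebraic over k are purely inseparable over k (`IsGenericResidualPerfection.exists_pow_eq`). If a
in A is not a p-th power modulo π and a = b₀^p + πc in A^g, then c is transcendental over k modulo π
(`IsGenericResidualPerfection.aeval_ne_zero`). Both are read off an explicit residual perfection C
that maps to every other one (`exists_model`). For each element b_i of a lifted p-basis, C contains
generic Teichmüller digits of a series ζ_i and all p-power roots of b_i - πζ_i. By initiality A^u is
a retract of C, so its reduction embeds in that of C, a ring of polynomials with exponents in ℕ[1/p]
over the perfect closure of k.

These properties prevent inseparable residue extensions (`exists_isSmall_sub_of_pow`). Let b in K^s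
be integral and fixed by the inertia group of K^g, with b^p ≡ a modulo the maximal ideal. Since the
residue field of A^g is perfect, inertia-fixed elements of the maximal ideal are divisible by π
(`isIntegral_div_of_fixed`). Hence b ≡ b₀ modulo π and b^p ≡ b₀^p modulo π². If a were not a p-th
power modulo π, the element (a - b^p)/π, integral over A, would be congruent to the transcendental
c.

Removing one π-adic digit at a time, one gets K^g ∩ K^s = K, and surjectivity follows by Galois
theory. For inertia, let M be the fixed field in K^s of the image of the inertia group of K^g. Its
residue extension is separable and its small integral elements are divisible by π. So its integral
elements have π-adic expansions whose digits are fixed by the inertia group of K, which therefore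
fixes M; as the image is closed, it contains that group. A wild element lifts to an inertia element,
and a limit of powers of this lift removes its tame part without changing the restriction. -/

/-! ### Exponents with `p`-power denominators -/

/-- The nonnegative rational numbers whose denominator is a power of `p`. -/
def pRat (p : ℕ) : AddSubmonoid ℚ≥0 where
  carrier := {q | ∃ m a : ℕ, q * (p : ℚ≥0) ^ m = a}
  zero_mem' := ⟨0, 0, by simp⟩
  add_mem' := by
    rintro q r ⟨m, a, h⟩ ⟨n, b, h'⟩
    refine ⟨m + n, a * p ^ n + b * p ^ m, ?_⟩
    push_cast
    rw [← h, ← h']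
    ring

theorem natCast_mem_pRat (p n : ℕ) : (n : ℚ≥0) ∈ pRat p := ⟨0, n, by simp⟩

instance (p : ℕ) : One (pRat p) := ⟨⟨1, by simpa using natCast_mem_pRat p 1⟩⟩

theorem pRat.coe_one (p : ℕ) : ((1 : pRat p) : ℚ≥0) = 1 := rfl

section rootPow

variable {p : ℕ} {M : Type*} [CommMonoid M]

theorem bijective_pow_pow (hM : Function.Bijective fun x : M => x ^ p) (m : ℕ) :
    Function.Bijective fun x : M => x ^ p ^ m := by
  induction m with
  | zero => 
    simp only [pow_zero, pow_one]
    exact Function.bijective_id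
  | succ m ih =>
    have : (fun x : M => x ^ p ^ (m + 1)) = (fun x : M => x ^ p) ∘ fun x : M => x ^ p ^ m := by
      funext x
      simp [pow_succ, pow_mul]
    rw [this]
    exact hM.comp ih

/-- Two presentations a/p^m and b/p^n of q satisfy a p^n = b p^m. Uniqueness of p-power roots then
gives both the same value. -/
theorem exists_rootPow (hM : Function.Bijective fun x : M => x ^ p) (x : M) (q : pRat p) :
    ∃ y : M, ∀ m a : ℕ, (q : ℚ≥0) * (p : ℚ≥0) ^ m = a → y ^ p ^ m = x ^ a := by
  obtain ⟨m, a, h⟩ := q.2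
  obtain ⟨y, hy⟩ := (bijective_pow_pow hM m).2 (x ^ a)
  refine ⟨y, fun n b h' => (bijective_pow_pow hM m).1 ?_⟩
  have hab : a * p ^ n = b * p ^ m := by
    have : (a : ℚ≥0) * p ^ n = b * p ^ m := by rw [← h, ← h']; ring
    exact_mod_cast this
  simp only at hy ⊢
  rw [← pow_mul, mul_comm, pow_mul, hy, ← pow_mul, ← pow_mul, hab]

/-- The power `x ^ q` for `q ∈ ℕ[1/p]` in a commutative monoid with bijective `p`-th power map. -/
noncomputable def rootPow (hM : Function.Bijective fun x : M => x ^ p) (x : M) (q : pRat p) : M :=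
  (exists_rootPow hM x q).choose

theorem rootPow_pow (hM : Function.Bijective fun x : M => x ^ p) (x : M) {q : pRat p} {m a : ℕ}
    (h : (q : ℚ≥0) * (p : ℚ≥0) ^ m = a) : rootPow hM x q ^ p ^ m = x ^ a :=
  (exists_rootPow hM x q).choose_spec m a h

theorem rootPow_one (hM : Function.Bijective fun x : M => x ^ p) (x : M) :
    rootPow hM x 1 = x := by
  simpa using rootPow_pow hM x (q := 1) (m := 0) (a := 1) (by simp [pRat.coe_one])

theorem rootPow_zero (hM : Function.Bijective fun x : M => x ^ p) (x : M) :
    rootPow hM x 0 = 1 := by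
  simpa using rootPow_pow hM x (q := 0) (m := 0) (a := 0) (by simp)

theorem rootPow_add (hM : Function.Bijective fun x : M => x ^ p) (x : M) (q r : pRat p) :
    rootPow hM x (q + r) = rootPow hM x q * rootPow hM x r := by
  obtain ⟨m, a, h⟩ := q.2
  obtain ⟨n, b, h'⟩ := r.2
  apply (bijective_pow_pow hM (m + n)).1
  have h1 : ((q + r : pRat p) : ℚ≥0) * (p : ℚ≥0) ^ (m + n) = (a * p ^ n + b * p ^ m : ℕ) := by
    push_cast
    rw [← h, ← h']
    ring
  simp only
  rw [rootPow_pow hM x h1, mul_pow, pow_add p, pow_mul, rootPow_pow hM x h, mul_comm (p ^ m),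
    pow_mul, rootPow_pow hM x h', ← pow_mul, ← pow_mul, pow_add]

/-- The monomial `∏ b i ^ γ i` with exponents in `ℕ[1/p]`. -/
noncomputable def rootMonomial {I : Type*} (hM : Function.Bijective fun x : M => x ^ p)
    (b : I → M) : Multiplicative (I →₀ pRat p) →* M where
  toFun γ := γ.toAdd.prod fun i q => rootPow hM (b i) q
  map_one' := by simp
  map_mul' γ δ := by
    classical
    rw [toAdd_mul, Finsupp.prod_add_index']
    · exact fun i => rootPow_zero hM _
    · exact fun i q r => rootPow_add hM _ q r

theorem rootMonomial_apply {I : Type*} (hM : Function.Bijective fun x : M => x ^ p)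
    (b : I → M) (γ : I →₀ pRat p) :
    rootMonomial hM b (.ofAdd γ) = γ.prod fun i q => rootPow hM (b i) q := rfl

theorem rootMonomial_single {I : Type*} (hM : Function.Bijective fun x : M => x ^ p)
    (b : I → M) (i : I) (q : pRat p) :
    rootMonomial hM b (.ofAdd (.single i q)) = rootPow hM (b i) q := by
  exact Finsupp.prod_single_index (h := fun i q => rootPow hM (b i) q) (rootPow_zero hM _)

end rootPow

section floor

variable {p : ℕ} {I : Type*}

theorem sub_floor_mem_pRat (q : pRat p) : (q : ℚ≥0) - ⌊(q : ℚ≥0)⌋₊ ∈ pRat p := by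
  obtain ⟨m, a, h⟩ := q.2
  refine ⟨m, a - ⌊(q : ℚ≥0)⌋₊ * p ^ m, ?_⟩
  rw [tsub_mul, h]
  push_cast
  rfl

/-- The fractional part of an exponent. -/
def pRat.fract (q : pRat p) : pRat p := ⟨(q : ℚ≥0) - ⌊(q : ℚ≥0)⌋₊, sub_floor_mem_pRat q⟩

/-- A natural number as an exponent. -/
def pRat.ofNat (p : ℕ) : ℕ →+ pRat p where
  toFun n := ⟨n, natCast_mem_pRat p n⟩
  map_zero' := by ext; simp
  map_add' m n := by ext; simp

theorem pRat.ofNat_one : pRat.ofNat p 1 = 1 := by ext; simp [pRat.ofNat, pRat.coe_one]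

/-- The componentwise integral part. -/
noncomputable def expFloor (γ : I →₀ pRat p) : I →₀ ℕ :=
  γ.mapRange (fun q : pRat p => ⌊(q : ℚ≥0)⌋₊) (by simp)

/-- The componentwise fractional part. -/
noncomputable def expFract (γ : I →₀ pRat p) : I →₀ pRat p :=
  γ.mapRange pRat.fract (by ext; simp [pRat.fract])

/-- The embedding of the integral exponents. -/
noncomputable def expNat (p : ℕ) : (I →₀ ℕ) →+ (I →₀ pRat p) :=
  Finsupp.mapRange.addMonoidHom (pRat.ofNat p)

theorem expNat_single (i : I) (n : ℕ) :
    expNat p (.single i n) = .single i (pRat.ofNat p n) := by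
  simp [expNat]

theorem expNat_apply (g : I →₀ ℕ) (i : I) : ((expNat p g i : pRat p) : ℚ≥0) = g i := rfl

theorem expFloor_apply (γ : I →₀ pRat p) (i : I) : expFloor γ i = ⌊(γ i : ℚ≥0)⌋₊ := rfl

theorem expFract_apply (γ : I →₀ pRat p) (i : I) :
    ((expFract γ i : pRat p) : ℚ≥0) = (γ i : ℚ≥0) - ⌊(γ i : ℚ≥0)⌋₊ := rfl

theorem expNat_floor_add_fract (γ : I →₀ pRat p) :
    expNat p (expFloor γ) + expFract γ = γ := by
  ext i
  rw [Finsupp.add_apply, AddSubmonoid.coe_add, expNat_apply, expFract_apply, expFloor_apply,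
    add_tsub_cancel_of_le (Nat.floor_le zero_le)]

theorem expFloor_expNat_add (g : I →₀ ℕ) (γ : I →₀ pRat p) :
    expFloor (expNat p g + γ) = g + expFloor γ := by
  ext i
  rw [Finsupp.add_apply, expFloor_apply, expFloor_apply, Finsupp.add_apply, AddSubmonoid.coe_add,
    expNat_apply, add_comm, Nat.floor_add_natCast zero_le, add_comm]

theorem expFract_expNat_add (g : I →₀ ℕ) (γ : I →₀ pRat p) :
    expFract (expNat p g + γ) = expFract γ := by
  ext i
  rw [expFract_apply, expFract_apply, Finsupp.add_apply, AddSubmonoid.coe_add,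
    expNat_apply, add_comm, Nat.floor_add_natCast zero_le]
  push_cast
  rw [add_tsub_add_eq_tsub_right]

theorem expFloor_expFract (γ : I →₀ pRat p) : expFloor (expFract γ) = 0 := by
  have h := expFloor_expNat_add (expFloor γ) (expFract γ)
  rw [expNat_floor_add_fract] at h
  exact left_eq_add.1 h

end floor

/-- An exponent in `ℕ[1/p]` divided by `p`. -/
noncomputable def pRat.divP {p : ℕ} (hp : p ≠ 0) (q : pRat p) : pRat p :=
  ⟨(q : ℚ≥0) / p, by
    obtain ⟨m, a, h⟩ := q.2
    refine ⟨m + 1, a, ?_⟩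
    have : (p : ℚ≥0) ≠ 0 := by exact_mod_cast hp
    rw [← h, pow_succ]
    field_simp⟩

theorem pRat.nsmul_divP {p : ℕ} (hp : p ≠ 0) (q : pRat p) : p • pRat.divP hp q = q := by
  ext
  have : (p : ℚ≥0) ≠ 0 := by exact_mod_cast hp
  simp [pRat.divP, mul_div_cancel₀, this]

theorem exists_nsmul_eq_exp {p : ℕ} (hp : p ≠ 0) {I : Type*} (γ : I →₀ pRat p) :
    ∃ δ : I →₀ pRat p, p • δ = γ := by
  refine ⟨γ.mapRange (pRat.divP hp) (by ext; simp [pRat.divP]), ?_⟩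
  ext i
  rw [Finsupp.smul_apply, Finsupp.mapRange_apply, pRat.nsmul_divP]

/-! ### Adic completeness for principal ideals -/

theorem eq_zero_of_forall_pow_dvd {T : Type*} [CommRing T] {π : T}
    [IsHausdorff (Ideal.span {π}) T] {x : T} (h : ∀ n, π ^ n ∣ x) : x = 0 := by
  refine IsHausdorff.haus ‹IsHausdorff (Ideal.span {π}) T› x fun n => ?_
  rw [SModEq.zero, smul_eq_mul, Ideal.mul_top, Ideal.span_singleton_pow,
    Ideal.mem_span_singleton]
  exact h n

theorem exists_adic_limit {T : Type*} [CommRing T] {π : T}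
    [IsPrecomplete (Ideal.span {π}) T] (f : ℕ → T) (hf : ∀ n, π ^ n ∣ f (n + 1) - f n) :
    ∃ s, ∀ n, π ^ n ∣ s - f n := by
  have key : ∀ m k, π ^ m ∣ f (m + k) - f m := by
    intro m k
    induction k with
    | zero => simp
    | succ k ih =>
      have := dvd_add (dvd_trans (pow_dvd_pow π (Nat.le_add_right m k)) (hf (m + k))) ih
      simpa [add_assoc] using this
  obtain ⟨s, hs⟩ := IsPrecomplete.prec ‹IsPrecomplete (Ideal.span {π}) T› (f := f) (by
    intro m n hmn
    obtain ⟨k, rfl⟩ := Nat.exists_eq_add_of_le hmn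
    refine (SModEq.sub_mem.2 ?_).symm
    rw [smul_eq_mul, Ideal.mul_top, Ideal.span_singleton_pow, Ideal.mem_span_singleton]
    exact key m k)
  refine ⟨s, fun n => ?_⟩
  have := SModEq.sub_mem.1 (hs n).symm
  rwa [smul_eq_mul, Ideal.mul_top, Ideal.span_singleton_pow, Ideal.mem_span_singleton] at this

theorem factorPow_evalₐ {R : Type*} [CommRing R] (I : Ideal R) {m n : ℕ} (h : m ≤ n)
    (x : AdicCompletion I R) :
    Ideal.Quotient.factorPow I h (AdicCompletion.evalₐ I n x) = AdicCompletion.evalₐ I m x := by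
  obtain ⟨f, rfl⟩ := AdicCompletion.mk_surjective I R x
  rw [AdicCompletion.evalₐ_mk, AdicCompletion.evalₐ_mk]
  change Ideal.Quotient.mk (I ^ m) _ = _
  rw [Ideal.Quotient.eq, ← SModEq.sub_mem]
  have := f.2 h
  simpa using this.symm

/-- The completion of a ring with respect to a nonzerodivisor. -/
theorem exists_adicCompletion {R : Type u} [CommRing R] (π : R) (hπ : ∀ x, π * x = 0 → x = 0) :
    ∃ (S : Type u) (_ : CommRing S) (_ : Algebra R S),
      (∀ x : S, algebraMap R S π * x = 0 → x = 0) ∧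
      IsAdicComplete (Ideal.span {algebraMap R S π}) S ∧
      (∀ s : S, ∃ r, algebraMap R S π ∣ s - algebraMap R S r) ∧
      (∀ r, algebraMap R S π ∣ algebraMap R S r → π ∣ r) ∧
      ∀ (T : Type u) [CommRing T] (φ : R →+* T), IsAdicComplete (Ideal.span {φ π}) T →
        ∃ Φ : S →+* T, Φ.comp (algebraMap R S) = φ := by
  set I : Ideal R := Ideal.span {π} with hI
  have hfg : I.FG := ⟨{π}, by simp [hI]⟩
  have hmap : I.map (algebraMap R (AdicCompletion I R)) =
      Ideal.span {algebraMap R (AdicCompletion I R) π} := by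
    rw [hI, Ideal.map_span, Set.image_singleton]
  have hker : ∀ x, AdicCompletion.evalOneₐ I x = 0 ↔
      algebraMap R (AdicCompletion I R) π ∣ x := by
    intro x
    rw [← Ideal.mem_span_singleton, ← hmap, ← AdicCompletion.ker_evalOneₐ_eq_map I hfg]
    rfl
  refine ⟨AdicCompletion I R, inferInstance, inferInstance, ?_, ?_, ?_, ?_, ?_⟩
  · intro x hx
    refine AdicCompletion.ext_evalₐ fun n => ?_
    -- Looking one level higher compensates for the factor π: from πr in (π^(n+1)) one cancels the
    -- nonzerodivisor π and gets r in (π^n).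
    obtain ⟨r, hr⟩ := Ideal.Quotient.mk_surjective (AdicCompletion.evalₐ I (n + 1) x)
    have h1 : Ideal.Quotient.mk (I ^ (n + 1)) (π * r) = 0 := by
      have := congrArg (AdicCompletion.evalₐ I (n + 1)) hx
      rw [map_mul, map_zero, AdicCompletion.algebraMap_apply, Algebra.algebraMap_self_apply,
        AdicCompletion.evalₐ_of, ← hr] at this
      rwa [map_mul]
    rw [Ideal.Quotient.eq_zero_iff_mem, hI, Ideal.span_singleton_pow,
      Ideal.mem_span_singleton] at h1
    obtain ⟨t, ht⟩ := h1
    have h2 : r = π ^ n * t := by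
      have : π * (r - π ^ n * t) = 0 := by rw [mul_sub, ht]; ring
      exact sub_eq_zero.1 (hπ _ this)
    have h3 : AdicCompletion.evalₐ I n x =
        Ideal.Quotient.factorPow I (Nat.le_succ n) (AdicCompletion.evalₐ I (n + 1) x) :=
      (factorPow_evalₐ I (Nat.le_succ n) x).symm
    rw [h3, ← hr, map_zero]
    change Ideal.Quotient.mk (I ^ n) r = 0
    rw [Ideal.Quotient.eq_zero_iff_mem, hI, Ideal.span_singleton_pow, Ideal.mem_span_singleton, h2]
    exact dvd_mul_right _ _
  · rw [← hmap, IsAdicComplete.map_algebraMap_iff]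
    exact AdicCompletion.isAdicComplete hfg
  · intro s
    obtain ⟨r, hr⟩ := Ideal.Quotient.mk_surjective (AdicCompletion.evalOneₐ I s)
    refine ⟨r, (hker _).1 ?_⟩
    rw [map_sub, ← hr]
    exact sub_self _
  · intro r hr
    have := (hker _).2 hr
    have h : Ideal.Quotient.mk I r = 0 := this
    rwa [Ideal.Quotient.eq_zero_iff_mem, Ideal.mem_span_singleton] at h
  · intro T _ φ hT
    set J : Ideal T := Ideal.span {φ π} with hJ
    have hle : ∀ n, I ^ n ≤ (J ^ n).comap φ := by
      intro n
      rw [← Ideal.map_le_iff_le_comap, Ideal.map_pow, hI, Ideal.map_span, Set.image_singleton]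
    have hf : ∀ {m n : ℕ} (hmn : m ≤ n), (Ideal.Quotient.factorPow J hmn).comp
        ((Ideal.quotientMap (J ^ n) φ (hle n)).comp (AdicCompletion.evalₐ I n).toRingHom) =
        (Ideal.quotientMap (J ^ m) φ (hle m)).comp (AdicCompletion.evalₐ I m).toRingHom := by
      intro m n hmn
      refine RingHom.ext fun x => ?_
      have h := factorPow_evalₐ I hmn x
      obtain ⟨r, hr⟩ := Ideal.Quotient.mk_surjective (AdicCompletion.evalₐ I n x)
      rw [← hr] at h
      simp only [RingHom.comp_apply]
      change Ideal.Quotient.factorPow J hmn (Ideal.quotientMap (J ^ n) φ (hle n)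
        (AdicCompletion.evalₐ I n x)) = Ideal.quotientMap (J ^ m) φ (hle m)
        (AdicCompletion.evalₐ I m x)
      rw [← h, ← hr]
      rfl
    refine ⟨IsAdicComplete.liftRingHom J (fun n =>
      (Ideal.quotientMap (J ^ n) φ (hle n)).comp (AdicCompletion.evalₐ I n).toRingHom) hf, ?_⟩
    refine RingHom.ext fun r => ?_
    have : ∀ n, (φ π) ^ n ∣ (IsAdicComplete.liftRingHom J (fun n =>
      (Ideal.quotientMap (J ^ n) φ (hle n)).comp (AdicCompletion.evalₐ I n).toRingHom) hf)
        (algebraMap R _ r) - φ r := by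
      intro n
      rw [← Ideal.mem_span_singleton, ← Ideal.span_singleton_pow, ← hJ,
        ← Ideal.Quotient.eq_zero_iff_mem, map_sub, IsAdicComplete.mk_liftRingHom]
      exact sub_eq_zero.2 rfl
    exact sub_eq_zero.1 (eq_zero_of_forall_pow_dvd this)

/-- The Teichmüller section. -/
theorem exists_teichmuller {p : ℕ} [Fact p.Prime] {T : Type*} [CommRing T] (I : Ideal T)
    [IsAdicComplete I T] (hp : (p : T) ∈ I) (h : Function.Bijective fun x : T ⧸ I => x ^ p) :
    ∃ τ : T ⧸ I →* T, τ 0 = 0 ∧ ∀ x, Ideal.Quotient.mk I (τ x) = x := by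
  -- The zero ring does not have characteristic p, so it is set apart; there separatedness forces T
  -- = 0.
  rcases subsingleton_or_nontrivial (T ⧸ I) with hs | hn
  · rw [Ideal.Quotient.subsingleton_iff] at hs
    subst hs
    have : Subsingleton T := IsHausdorff.subsingleton (R := T) (M := T) inferInstance
    exact ⟨1, Subsingleton.elim _ _, fun x => Subsingleton.elim _ _⟩
  · have : CharP (T ⧸ I) p := (CharP.charP_iff_prime_eq_zero Fact.out).2 (by
      rw [← map_natCast (Ideal.Quotient.mk I), Ideal.Quotient.eq_zero_iff_mem]
      exact hp)
    have : PerfectRing (T ⧸ I) p := ⟨h⟩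
    let e := Perfection.lift p (T ⧸ I) (T ⧸ I) (RingHom.id _)
    refine ⟨(Perfection.teichmuller p I).comp (e : T ⧸ I →* Perfection (T ⧸ I) p), ?_, ?_⟩
    · simp
    · intro x
      simp only [MonoidHom.comp_apply]
      rw [Perfection.mk_teichmuller]
      rfl

/-! ### Adjoining `p`-power roots of a family of elements -/

/-- The homomorphism from a monoid algebra given by its values on coefficients and monomials. -/
noncomputable def AddMonoidAlgebra.evalHom {S T G : Type*} [CommRing S] [CommRing T] [AddMonoid G]
    (φ : S →+* T) (ψ : Multiplicative G →* T) : AddMonoidAlgebra S G →+* T :=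
  AddMonoidAlgebra.liftNCRingHom φ ψ fun _ _ => Commute.all _ _

theorem AddMonoidAlgebra.evalHom_single {S T G : Type*} [CommRing S] [CommRing T] [AddMonoid G]
    (φ : S →+* T) (ψ : Multiplicative G →* T) (γ : G) (s : S) :
    evalHom φ ψ (single γ s) = φ s * ψ (.ofAdd γ) :=
  liftNCRingHom_single _ _ _ _ _

section RootAdjunction

variable {p : ℕ} {S I : Type*} [CommRing S] (f : I → S)

/-- The monomial `∏ f i ^ g i`. -/
noncomputable def natMonomial (g : I →₀ ℕ) : S := g.prod fun i n => f i ^ n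

theorem natMonomial_zero : natMonomial f 0 = 1 := by simp [natMonomial]

theorem natMonomial_add (g h : I →₀ ℕ) :
    natMonomial f (g + h) = natMonomial f g * natMonomial f h := by
  classical
  rw [natMonomial, Finsupp.prod_add_index']
  · rfl
  · simp
  · exact fun i m n => pow_add _ _ _

theorem natMonomial_single (i : I) : natMonomial f (.single i 1) = f i := by
  simp [natMonomial]

theorem map_natMonomial {T : Type*} [CommRing T] (φ : S →+* T)
    (ψ : Multiplicative (I →₀ pRat p) →* T) (h : ∀ i, ψ (.ofAdd (.single i 1)) = φ (f i))
    (g : I →₀ ℕ) : ψ (.ofAdd (expNat p g)) = φ (natMonomial f g) := by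
  induction g using Finsupp.induction_linear with
  | zero => simp [natMonomial_zero]
  | add g h ihg ihh => rw [map_add, ofAdd_add, map_mul, ihg, ihh, natMonomial_add, map_mul]
  | single i n =>
    have : Finsupp.single i n = n • Finsupp.single i 1 := by simp
    rw [this, map_nsmul, ofAdd_nsmul, map_pow, expNat_single, pRat.ofNat_one, h, ← map_pow]
    congr 1
    simp [natMonomial]

/-- The reduction of polynomials with exponents in `ℕ[1/p]` modulo the relations saying that the
`i`-th variable equals `f i`. -/
noncomputable def rootReduce :
    AddMonoidAlgebra S (I →₀ pRat p) →+ AddMonoidAlgebra S (I →₀ pRat p) :=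
  (Finsupp.liftAddHom fun γ => (AddMonoidAlgebra.singleAddHom (expFract γ)).comp
    (AddMonoidHom.mulRight (natMonomial f (expFloor γ)))).comp
      AddMonoidAlgebra.coeffAddEquiv.toAddMonoidHom

theorem rootReduce_single (γ : I →₀ pRat p) (s : S) :
    rootReduce f (.single γ s) = .single (expFract γ) (s * natMonomial f (expFloor γ)) :=
  Finsupp.liftAddHom_apply_single _ _ _

/-- Shifting an exponent by an integral vector changes only its floor, so integral parts may be
extracted before or after multiplying. This is what makes the kernel of the additive map
`rootReduce` an ideal. -/
theorem rootReduce_mul_rootReduce (x y : AddMonoidAlgebra S (I →₀ pRat p)) :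
    rootReduce f (x * rootReduce f y) = rootReduce f (x * y) := by
  induction x using AddMonoidAlgebra.induction_linear with
  | zero => simp
  | add x x' hx hx' => rw [add_mul, add_mul, map_add, map_add, hx, hx']
  | single δ s =>
    induction y using AddMonoidAlgebra.induction_linear with
    | zero => simp
    | add y y' hy hy' => rw [map_add, mul_add, mul_add, map_add, map_add, hy, hy']
    | single γ t =>
      rw [rootReduce_single, AddMonoidAlgebra.single_mul_single,
        AddMonoidAlgebra.single_mul_single, rootReduce_single, rootReduce_single]
      have h : δ + γ = expNat p (expFloor γ) + (δ + expFract γ) := by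
        conv_lhs => rw [← expNat_floor_add_fract γ]
        abel
      rw [h, expFract_expNat_add, expFloor_expNat_add, natMonomial_add]
      congr 1
      ring

theorem rootReduce_rootReduce (x : AddMonoidAlgebra S (I →₀ pRat p)) :
    rootReduce f (rootReduce f x) = rootReduce f x := by
  simpa using rootReduce_mul_rootReduce f 1 x

theorem expFloor_eq_zero_of_mem_support_rootReduce (x : AddMonoidAlgebra S (I →₀ pRat p))
    (γ : I →₀ pRat p) (hγ : γ ∈ (rootReduce f x).coeff.support) : expFloor γ = 0 := by
  classical
  induction x using AddMonoidAlgebra.induction_linear with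
  | zero => simp at hγ
  | add x y hx hy =>
    rw [map_add, AddMonoidAlgebra.coeff_add] at hγ
    rcases Finset.mem_union.1 (Finsupp.support_add hγ) with h | h
    exacts [hx h, hy h]
  | single δ s =>
    rw [rootReduce_single, AddMonoidAlgebra.coeff_single] at hγ
    rw [Finset.mem_singleton.1 (Finsupp.support_single_subset hγ), expFloor_expFract]

theorem rootReduce_single_zero_mul (s : S) (x : AddMonoidAlgebra S (I →₀ pRat p)) :
    rootReduce f (.single 0 s * x) = .single 0 s * rootReduce f x := by
  induction x using AddMonoidAlgebra.induction_linear with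
  | zero => simp
  | add x y hx hy => rw [mul_add, map_add, map_add, mul_add, hx, hy]
  | single γ t =>
    simp only [AddMonoidAlgebra.single_mul_single, rootReduce_single, zero_add, mul_assoc]

/-- The ideal of relations saying that the `i`-th variable equals `f i`. -/
noncomputable def rootIdeal : Ideal (AddMonoidAlgebra S (I →₀ pRat p)) where
  carrier := {x | rootReduce f x = 0}
  zero_mem' := map_zero _
  add_mem' {x y} hx hy := by
    rw [Set.mem_ofPred_eq] at *
    rw [map_add, hx, hy, add_zero]
  smul_mem' x y hy := by
    rw [Set.mem_ofPred_eq] at *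
    rw [smul_eq_mul, ← rootReduce_mul_rootReduce, hy, mul_zero, map_zero]

theorem mem_rootIdeal {x : AddMonoidAlgebra S (I →₀ pRat p)} :
    x ∈ rootIdeal f ↔ rootReduce f x = 0 := Iff.rfl

theorem evalHom_rootReduce {T : Type*} [CommRing T] (φ : S →+* T)
    (ψ : Multiplicative (I →₀ pRat p) →* T) (h : ∀ i, ψ (.ofAdd (.single i 1)) = φ (f i))
    (x : AddMonoidAlgebra S (I →₀ pRat p)) :
    AddMonoidAlgebra.evalHom φ ψ (rootReduce f x) = AddMonoidAlgebra.evalHom φ ψ x := by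
  induction x using AddMonoidAlgebra.induction_linear with
  | zero => simp
  | add x y hx hy => rw [map_add, map_add, map_add, hx, hy]
  | single γ s =>
    rw [rootReduce_single, AddMonoidAlgebra.evalHom_single, AddMonoidAlgebra.evalHom_single]
    conv_rhs => rw [← expNat_floor_add_fract γ, ofAdd_add, map_mul, map_natMonomial f φ ψ h]
    rw [map_mul, mul_assoc]

end RootAdjunction

/-- The ring is S[X_i^(1/p^∞)]/(X_i - f_i). The map `rootReduce` is an S-linear projection onto the
combinations of monomials with exponents in [0, 1), and its kernel is the ideal of relations. The
quotient is thus free on these monomials, which gives the nonzerodivisor and normal form clauses. -/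
theorem exists_rootAdjunction (p : ℕ) {S I : Type u} [CommRing S] (f : I → S) :
    ∃ (P : Type u) (_ : CommRing P) (_ : Algebra S P) (θ : Multiplicative (I →₀ pRat p) →* P),
      (∀ i, θ (.ofAdd (.single i 1)) = algebraMap S P (f i)) ∧
      (∀ π : S, (∀ x, π * x = 0 → x = 0) → ∀ x : P, algebraMap S P π * x = 0 → x = 0) ∧
      (∀ x : P, ∃ h : (I →₀ pRat p) →₀ S, (∀ γ ∈ h.support, expFloor γ = 0) ∧
        x = h.sum fun γ s => algebraMap S P s * θ (.ofAdd γ)) ∧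
      ∀ (T : Type u) [CommRing T] (φ : S →+* T) (ψ : Multiplicative (I →₀ pRat p) →* T),
        (∀ i, ψ (.ofAdd (.single i 1)) = φ (f i)) →
          ∃ Φ : P →+* T, Φ.comp (algebraMap S P) = φ ∧ ∀ γ, Φ (θ γ) = ψ γ := by
  let J := rootIdeal (p := p) f
  have hmk : ∀ x, Ideal.Quotient.mk J (rootReduce f x) = Ideal.Quotient.mk J x := fun x =>
    Ideal.Quotient.eq.2 (by
      rw [mem_rootIdeal, map_sub, rootReduce_rootReduce, sub_self])
  let ι : S →+* AddMonoidAlgebra S (I →₀ pRat p) := AddMonoidAlgebra.singleZeroRingHom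
  refine ⟨AddMonoidAlgebra S (I →₀ pRat p) ⧸ J, inferInstance,
    ((Ideal.Quotient.mk J).comp ι).toAlgebra,
    ((Ideal.Quotient.mk J : _ →+* _) : _ →* _).comp (AddMonoidAlgebra.of S _), ?_, ?_, ?_, ?_⟩
  · intro i
    change Ideal.Quotient.mk J (.single (.single i 1) 1) = Ideal.Quotient.mk J (.single 0 (f i))
    rw [← hmk, rootReduce_single]
    have h := expNat_single (p := p) i 1
    rw [pRat.ofNat_one] at h
    rw [← h]
    have h1 := expFract_expNat_add (p := p) (Finsupp.single i 1) 0
    have h2 := expFloor_expNat_add (p := p) (Finsupp.single i 1) 0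
    have h3 : expFract (0 : I →₀ pRat p) = 0 := by ext; simp [expFract_apply]
    have h4 : expFloor (0 : I →₀ pRat p) = 0 := by ext; simp [expFloor_apply]
    rw [add_zero] at h1 h2
    rw [h1, h2, h3, h4, add_zero, natMonomial_single, one_mul]
  · intro π hπ x hx
    obtain ⟨x, rfl⟩ := Ideal.Quotient.mk_surjective x
    have hx' : AddMonoidAlgebra.single 0 π * x ∈ J := by
      rw [← Ideal.Quotient.eq_zero_iff_mem, map_mul]
      exact hx
    rw [mem_rootIdeal, rootReduce_single_zero_mul] at hx'
    rw [Ideal.Quotient.eq_zero_iff_mem, mem_rootIdeal]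
    ext γ
    refine hπ _ ?_
    have := congrArg (fun z => AddMonoidAlgebra.coeff z γ) hx'
    simpa [AddMonoidAlgebra.coeff_single_zero_mul] using this
  · intro x
    obtain ⟨x, rfl⟩ := Ideal.Quotient.mk_surjective x
    refine ⟨(rootReduce f x).coeff, expFloor_eq_zero_of_mem_support_rootReduce f x, ?_⟩
    conv_lhs => rw [← hmk, ← AddMonoidAlgebra.sum_coeff_single (rootReduce f x), map_finsuppSum]
    refine Finsupp.sum_congr fun γ _ => ?_
    change _ = Ideal.Quotient.mk J (.single 0 _) * Ideal.Quotient.mk J (.single γ 1)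
    rw [← map_mul, AddMonoidAlgebra.single_mul_single, zero_add, mul_one]
  · intro T _ φ ψ h
    refine ⟨Ideal.Quotient.lift J (AddMonoidAlgebra.evalHom φ ψ) fun x hx => ?_, ?_, ?_⟩
    · rw [← evalHom_rootReduce f φ ψ h, (mem_rootIdeal f).1 hx, map_zero]
    · ext s
      change AddMonoidAlgebra.evalHom φ ψ (.single 0 s) = φ s
      rw [AddMonoidAlgebra.evalHom_single, ofAdd_zero, map_one, mul_one]
    · intro γ
      change AddMonoidAlgebra.evalHom φ ψ (.single γ.toAdd 1) = ψ γ
      rw [AddMonoidAlgebra.evalHom_single, map_one, one_mul, ofAdd_toAdd]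

/-! ### `p`-bases -/

section PBasis

variable {p : ℕ} {k F : Type*} [Field k] [Field F] [Algebra k F]
  (hF : Function.Bijective fun x : F => x ^ p)

/-- Monomials, with exponents in `ℕ[1/p]`, in the elements of the base field. -/
noncomputable def fieldMonomial : Multiplicative (k →₀ pRat p) →* F :=
  rootMonomial hF (algebraMap k F)

/-- The reduced exponents supported in a subset of the field. -/
def reducedExponents (p : ℕ) {k : Type*} (B : Set k) : Set (k →₀ pRat p) :=
  {q | expFloor q = 0 ∧ ↑q.support ⊆ B}

/-- A subset `B` of a field `k` of characteristic `p` is `p`-independent if the monomials in `B`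
with exponents in `ℕ[1/p] ∩ [0, 1)` are linearly independent in the perfect closure `F` of `k`. -/
def PIndependent (B : Set k) : Prop :=
  LinearIndepOn k (fun q => fieldMonomial hF (.ofAdd q)) (reducedExponents p B)

/-- The submonoid of monomials in elements of `B`. -/
noncomputable def monomialSubmonoid (B : Set k) : Submonoid F where
  carrier := {x | ∃ q : k →₀ pRat p, ↑q.support ⊆ B ∧ fieldMonomial hF (.ofAdd q) = x}
  one_mem' := ⟨0, by simp, map_one _⟩
  mul_mem' := by
    classical
    rintro _ _ ⟨q, hq, rfl⟩ ⟨r, hr, rfl⟩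
    refine ⟨q + r, subset_trans (Finset.coe_subset.2 Finsupp.support_add) ?_, map_mul _ _ _⟩
    rw [Finset.coe_union]
    exact Set.union_subset hq hr

theorem fieldMonomial_expNat (g : k →₀ ℕ) :
    fieldMonomial hF (.ofAdd (expNat p g)) = algebraMap k F (natMonomial id g) :=
  map_natMonomial id (algebraMap k F) (fieldMonomial hF)
    (fun i => by rw [fieldMonomial, rootMonomial_single, rootPow_one]; rfl) g

/-- The integral part of an exponent contributes a scalar from k, so every monomial is a multiple of
a reduced one. -/
theorem toSubmodule_adjoin_monomialSubmonoid (B : Set k) :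
    Subalgebra.toSubmodule (Algebra.adjoin k (monomialSubmonoid hF B : Set F)) =
      Submodule.span k ((fun q => fieldMonomial hF (.ofAdd q)) '' reducedExponents p B) := by
  rw [Algebra.adjoin_eq_span, Submonoid.closure_eq]
  refine le_antisymm (Submodule.span_le.2 ?_) (Submodule.span_mono ?_)
  · rintro _ ⟨q, hq, rfl⟩
    have h : fieldMonomial hF (.ofAdd q) = natMonomial id (expFloor q) •
        fieldMonomial hF (.ofAdd (expFract q)) := by
      rw [Algebra.smul_def, ← fieldMonomial_expNat hF, ← map_mul, ← ofAdd_add,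
        expNat_floor_add_fract]
    rw [h]
    refine Submodule.smul_mem _ _ (Submodule.subset_span ⟨_, ⟨expFloor_expFract _, ?_⟩, rfl⟩)
    exact subset_trans (Finset.coe_subset.2 Finsupp.support_mapRange) hq
  · rintro _ ⟨q, hq, rfl⟩
    exact ⟨q, hq.2, rfl⟩

theorem pIndependent_empty : PIndependent hF (∅ : Set k) := by
  have : reducedExponents p (∅ : Set k) ⊆ {0} := by
    intro q hq
    have := Set.subset_empty_iff.1 hq.2
    simpa using this
  refine LinearIndepOn.mono ?_ this
  refine (linearIndepOn_singleton_iff k).2 ?_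
  rw [ofAdd_zero, map_one]
  exact one_ne_zero

/-- The subfield of the perfect closure generated by the monomials in `B`. -/
noncomputable def monomialField (B : Set k) : IntermediateField k F :=
  IntermediateField.adjoin k (monomialSubmonoid hF B : Set F)

theorem fieldMonomial_mem (B : Set k) {q : k →₀ pRat p} (hq : ↑q.support ⊆ B) :
    fieldMonomial hF (.ofAdd q) ∈ monomialField hF B :=
  IntermediateField.subset_adjoin _ _ ⟨q, hq, rfl⟩

variable [IsPurelyInseparable k F]

theorem mem_monomialField_iff (B : Set k) (x : F) : x ∈ monomialField hF B ↔
    x ∈ Submodule.span k ((fun q => fieldMonomial hF (.ofAdd q)) '' reducedExponents p B) := by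
  rw [← toSubmodule_adjoin_monomialSubmonoid, Subalgebra.mem_toSubmodule,
    ← IntermediateField.adjoin_toSubalgebra_of_isAlgebraic (fun x _ =>
      Algebra.IsAlgebraic.isAlgebraic x)]
  rfl

/-- The minimal polynomial has the form X^(p^n) - d, so y^(p^n) lies in M. As y^(p^m) does not, n >
m. -/
theorem natDegree_minpoly_of_pow_mem [ExpChar k p] [Fact p.Prime] (M : IntermediateField k F)
    {y c : F} (hc : c ∉ M) (m : ℕ) (hy : y ^ p ^ m = c) :
    p ^ (m + 1) ≤ (minpoly M y).natDegree := by
  have : IsPurelyInseparable M F := IsPurelyInseparable.tower_top (F := k) M F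
  have : ExpChar M p := expChar_of_injective_algebraMap (algebraMap k M).injective p
  obtain ⟨n, d, h⟩ := IsPurelyInseparable.minpoly_eq_X_pow_sub_C M p y
  have hyn : y ^ p ^ n = d := by
    have := minpoly.aeval M y
    rw [h] at this
    simpa [sub_eq_zero] using this
  have hmn : m < n := by
    by_contra hcon
    obtain ⟨j, rfl⟩ := Nat.exists_eq_add_of_le (not_lt.1 hcon)
    apply hc
    rw [← hy, pow_add, pow_mul, hyn]
    exact pow_mem d.2 _
  rw [h, Polynomial.natDegree_X_pow_sub_C]
  exact Nat.pow_le_pow_right (Fact.out : p.Prime).pos hmn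

/-- Finitely many exponents have a common denominator p^(m+1). The corresponding roots are distinct
powers of y = c^(1/p^(m+1)), of exponent below the degree of y over M: that degree is at least
p^(m+1) because y^(p^m) is the p-th root of c. -/
theorem linearIndependent_rootPow [ExpChar k p] [Fact p.Prime] (M : IntermediateField k F) (c : F)
    (hc : ∀ y, y ^ p = c → y ∉ M) :
    LinearIndependent M fun r : {r : pRat p // (r : ℚ≥0) < 1} => rootPow hF c r.1 := by
  rw [linearIndependent_iff_finset_linearIndependent]
  intro s
  have hm : ∃ m, ∀ r ∈ s, ∃ a : ℕ, (r.1 : ℚ≥0) * (p : ℚ≥0) ^ (m + 1) = a := by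
    induction s using Finset.induction_on with
    | empty => simp
    | insert r s _ ih =>
      obtain ⟨m, hm⟩ := ih
      obtain ⟨n, b, hb⟩ := r.1.2
      refine ⟨m + n, fun t ht => ?_⟩
      rcases Finset.mem_insert.1 ht with rfl | ht
      · refine ⟨b * p ^ (m + 1), ?_⟩
        push_cast
        rw [← hb]
        ring
      · obtain ⟨a, ha⟩ := hm t ht
        refine ⟨a * p ^ n, ?_⟩
        push_cast
        rw [← ha]
        ring
  obtain ⟨m, hm⟩ := hm
  choose! a ha using hm
  obtain ⟨y, hy⟩ := (bijective_pow_pow hF (m + 1)).2 c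
  have hp0 : (p : ℚ≥0) ≠ 0 := by exact_mod_cast (Fact.out : p.Prime).ne_zero
  have hdeg : p ^ (m + 1) ≤ (minpoly M y).natDegree :=
    natDegree_minpoly_of_pow_mem M (c := y ^ p ^ m) (hc _ (by rw [← pow_mul, ← pow_succ]; exact hy))
      m rfl
  have hlt : ∀ r : s, a r.1 < (minpoly M y).natDegree := by
    intro r
    refine lt_of_lt_of_le ?_ hdeg
    have h1 : ((a r.1 : ℕ) : ℚ≥0) < (p ^ (m + 1) : ℕ) := by
      rw [← ha r.1 r.2]
      push_cast
      exact mul_lt_of_lt_one_left (pow_pos (pos_of_ne_zero hp0) _) r.1.2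
    exact_mod_cast h1
  have h := (linearIndependent_pow (K := M) y).comp
    (fun r : s => (⟨a r.1, hlt r⟩ : Fin (minpoly M y).natDegree)) (by
      intro r t hrt
      have h1 : a r.1 = a t.1 := congrArg Fin.val hrt
      have h2 := ha r.1 r.2
      rw [h1, ← ha t.1 t.2] at h2
      exact Subtype.ext (Subtype.ext (Subtype.ext (mul_right_cancel₀ (pow_ne_zero _ hp0) h2))))
  convert! h using 1
  funext r
  apply (bijective_pow_pow hF (m + 1)).1
  simp only [Function.comp_apply]
  rw [rootPow_pow hF c (ha r.1 r.2), ← pow_mul, mul_comm, pow_mul]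
  congr 1
  exact hy.symm

/-- Splitting off the exponent of c writes each reduced monomial as a product. One factor is a
monomial in B, from a family independent over k; the other is a power of c, from a family
independent over the field generated by the first. Such products are independent over k. -/
theorem PIndependent.insert [ExpChar k p] [Fact p.Prime] {B : Set k} (hB : PIndependent hF B)
    {c : k} (hc : ∀ y : F, y ^ p = algebraMap k F c → y ∉ monomialField hF B) :
    PIndependent hF (insert c B) := by
  classical
  have hcB : c ∉ B := by
    intro h
    have hp := (Fact.out : p.Prime).ne_zero
    refine hc (fieldMonomial hF (.ofAdd (.single c (pRat.divP hp 1)))) ?_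
      (fieldMonomial_mem hF B ?_)
    · rw [← map_pow, ← ofAdd_nsmul, Finsupp.smul_single, pRat.nsmul_divP, fieldMonomial,
        rootMonomial_single, rootPow_one]
    · refine subset_trans (Finset.coe_subset.2 Finsupp.support_single_subset) ?_
      simpa using h
  let b : reducedExponents p B → monomialField hF B :=
    fun q => ⟨fieldMonomial hF (.ofAdd q.1), fieldMonomial_mem hF B q.2.2⟩
  have hb : LinearIndependent k b := by
    refine LinearIndependent.of_comp (monomialField hF B).val.toLinearMap ?_
    exact hB
  have key := linearIndependent_smul hb
    (linearIndependent_rootPow hF (monomialField hF B) (algebraMap k F c) hc)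
  have hred : ∀ q ∈ reducedExponents p (Insert.insert c B),
      q.erase c ∈ reducedExponents p B ∧ ((q c : pRat p) : ℚ≥0) < 1 := by
    intro q hq
    have hfl : ∀ i, ⌊((q i : pRat p) : ℚ≥0)⌋₊ = 0 := fun i => by
      rw [← expFloor_apply, hq.1, Finsupp.zero_apply]
    refine ⟨⟨?_, ?_⟩, Nat.floor_eq_zero.1 (hfl c)⟩
    · ext i
      rw [expFloor_apply, Finsupp.erase_apply]
      split_ifs
      · simp
      · simp [hfl i]
    · intro i hi
      rw [Finset.mem_coe, Finsupp.support_erase, Finset.mem_erase] at hi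
      exact (hq.2 hi.2).resolve_left hi.1
  have h := key.comp (fun q : reducedExponents p (Insert.insert c B) =>
    ((⟨q.1.erase c, (hred q.1 q.2).1⟩, ⟨q.1 c, (hred q.1 q.2).2⟩) :
      reducedExponents p B × {r : pRat p // (r : ℚ≥0) < 1})) (by
    intro q r hqr
    have h1 : q.1.erase c = r.1.erase c := congrArg (fun z => (z.1 : k →₀ pRat p)) hqr
    have h2 : q.1 c = r.1 c := congrArg (fun z => z.2.1) hqr
    apply Subtype.ext
    rw [← Finsupp.erase_add_single c q.1, h1, h2, Finsupp.erase_add_single])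
  unfold PIndependent LinearIndepOn
  convert! h using 1
  funext q
  simp only [Function.comp_apply, b]
  rw [IntermediateField.smul_def, smul_eq_mul]
  conv_lhs => rw [← Finsupp.erase_add_single c q.1, ofAdd_add, map_mul]
  congr 1
  rw [fieldMonomial, rootMonomial_single]

/-- Every `p`-independent set can be enlarged to a `p`-basis. -/
theorem PIndependent.exists_pBasis [ExpChar k p] [Fact p.Prime] {B₀ : Set k}
    (hB₀ : PIndependent hF B₀) : ∃ B, B₀ ⊆ B ∧ PIndependent hF B ∧
      Submodule.span k ((fun q => fieldMonomial hF (.ofAdd q)) '' reducedExponents p B) = ⊤ := by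
  obtain ⟨B, hB₀B, hB⟩ := zorn_subset_nonempty {B : Set k | PIndependent hF B} (by
    intro c hc hchain hne
    refine ⟨⋃₀ c, ?_, fun s hs => Set.subset_sUnion_of_mem hs⟩
    have : reducedExponents p (⋃₀ c) ⊆ ⋃ s : c, reducedExponents p s.1 := by
      intro q hq
      obtain ⟨s, hs, hqs⟩ := DirectedOn.exists_mem_subset_of_finset_subset_biUnion hne
        (f := id) hchain.directedOn (s := q.support) (by
          simpa [Set.sUnion_eq_biUnion] using hq.2)
      exact Set.mem_iUnion.2 ⟨⟨s, hs⟩, hq.1, hqs⟩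
    refine LinearIndepOn.mono (linearIndepOn_iUnion_of_directed ?_ fun s => hc s.2) this
    intro s t
    obtain ⟨w, hw, hsw, htw⟩ := hchain.directedOn s.1 s.2 t.1 t.2
    exact ⟨⟨w, hw⟩, fun q hq => ⟨hq.1, hq.2.trans hsw⟩, fun q hq => ⟨hq.1, hq.2.trans htw⟩⟩) B₀ hB₀
  refine ⟨B, hB₀B, hB.prop, ?_⟩
  -- Maximality of B: an element c whose p-th root is missing from the field could be inserted, so c
  -- lies in B, and then its p-th root is a monomial.
  have hroot : ∀ c : k, ∃ y : F, y ^ p = algebraMap k F c ∧ y ∈ monomialField hF B := by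
    intro c
    by_contra hcon
    push Not at hcon
    have hmem : c ∈ B := hB.le_of_ge (PIndependent.insert hF hB.prop hcon)
      (Set.subset_insert c B) (Set.mem_insert c B)
    have hp := (Fact.out : p.Prime).ne_zero
    refine hcon (fieldMonomial hF (.ofAdd (.single c (pRat.divP hp 1)))) ?_
      (fieldMonomial_mem hF B ?_)
    · rw [← map_pow, ← ofAdd_nsmul, Finsupp.smul_single, pRat.nsmul_divP, fieldMonomial,
        rootMonomial_single, rootPow_one]
    · refine subset_trans (Finset.coe_subset.2 Finsupp.support_single_subset) ?_
      simpa using hmem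
  -- The field is closed under p-th roots: roots of monomials are monomials, roots of scalars come
  -- from `hroot`, and Frobenius is additive. Since F is purely inseparable over k, the field is
  -- then all of F.
  have hpow : ∀ x : F, x ^ p ∈ monomialField hF B → x ∈ monomialField hF B := by
    intro x hx
    rw [mem_monomialField_iff] at hx
    have hp := (Fact.out : p.Prime).ne_zero
    have : ∃ y ∈ monomialField hF B, y ^ p = x ^ p := by
      generalize x ^ p = z at hx
      induction hx using Submodule.span_induction with
      | zero => exact ⟨0, zero_mem _, zero_pow hp⟩
      | mem z hz =>
        obtain ⟨q, hq, rfl⟩ := hz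
        obtain ⟨r, rfl⟩ := exists_nsmul_eq_exp hp q
        refine ⟨_, fieldMonomial_mem hF B (q := r) (subset_trans ?_ hq.2), ?_⟩
        · intro i hi
          rw [Finset.mem_coe, Finsupp.mem_support_iff] at hi ⊢
          rw [Finsupp.smul_apply]
          contrapose! hi
          ext
          simpa [hp] using congrArg (Subtype.val) hi
        · rw [← map_pow, ← ofAdd_nsmul]
      | add z w _ _ hz hw =>
        obtain ⟨y, hy, rfl⟩ := hz
        obtain ⟨y', hy', rfl⟩ := hw
        have : ExpChar F p := expChar_of_injective_algebraMap (algebraMap k F).injective p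
        exact ⟨y + y', add_mem hy hy', add_pow_expChar y y' p⟩
      | smul a z _ hz =>
        obtain ⟨y, hy, rfl⟩ := hz
        obtain ⟨w, hw, hwM⟩ := hroot a
        exact ⟨w * y, mul_mem hwM hy, by rw [mul_pow, hw, Algebra.smul_def]⟩
    obtain ⟨y, hy, hyx⟩ := this
    rwa [← hF.1 hyx]
  rw [eq_top_iff]
  intro x _
  rw [← mem_monomialField_iff]
  have : ExpChar F p := expChar_of_injective_algebraMap (algebraMap k F).injective p
  obtain ⟨n, d, hd⟩ := IsPurelyInseparable.pow_mem k p x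
  have hmem : x ^ p ^ n ∈ monomialField hF B := by
    rw [← hd]
    exact algebraMap_mem _ _
  clear hd
  induction n with
  | zero => simpa using hmem
  | succ n ih => exact ih (hpow _ (by rwa [← pow_mul, ← pow_succ]))

end PBasis

/-! ### An explicit complete residual perfection -/

section Basics

variable {A : Type*} [CommRing A] [IsDomain A] [IsDiscreteValuationRing A] {ϖ : A}

theorem extendedIdeal_eq_span (hϖ : Irreducible ϖ) (B : Type*) [CommRing B] [Algebra A B] :
    extendedIdeal A B = Ideal.span {algebraMap A B ϖ} := by
  rw [extendedIdeal, hϖ.maximalIdeal_eq, Ideal.map_span, Set.image_singleton]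

theorem mem_extendedIdeal_iff (hϖ : Irreducible ϖ) {B : Type*} [CommRing B] [Algebra A B] {x : B} :
    x ∈ extendedIdeal A B ↔ algebraMap A B ϖ ∣ x := by
  rw [extendedIdeal_eq_span hϖ, Ideal.mem_span_singleton]

theorem flat_of_uniformizer (hϖ : Irreducible ϖ) (B : Type*) [CommRing B] [Algebra A B]
    (h : ∀ x : B, algebraMap A B ϖ * x = 0 → x = 0) : Module.Flat A B := by
  rw [IsDedekindDomain.flat_iff_torsion_eq_bot, eq_bot_iff]
  rintro x ⟨⟨a, ha⟩, hx⟩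
  obtain ⟨n, u, rfl⟩ := IsDiscreteValuationRing.eq_unit_mul_pow_irreducible
    (nonZeroDivisors.ne_zero ha) hϖ
  have hx' : algebraMap A B ϖ ^ n * x = 0 := by
    have : algebraMap A B (↑u * ϖ ^ n) * x = 0 := by
      rw [← Algebra.smul_def]
      exact hx
    rw [map_mul, map_pow, mul_assoc] at this
    exact (IsUnit.mul_right_eq_zero (u.isUnit.map (algebraMap A B))).1 this
  clear hx ha
  induction n with
  | zero => simpa using hx'
  | succ n ih => exact ih (h _ (by rw [← mul_assoc, ← pow_succ', hx']))

omit [IsDiscreteValuationRing A] in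
theorem uniformizer_mul_eq_zero (hϖ : Irreducible ϖ) {B : Type*} [CommRing B] [Algebra A B]
    [Module.Flat A B] {x : B} (h : algebraMap A B ϖ * x = 0) : x = 0 := by
  have := Module.Flat.isTorsionFree (R := A) (M := B)
  rw [← Algebra.smul_def] at h
  exact (smul_eq_zero.1 h).resolve_left hϖ.ne_zero

theorem natCast_mem_extendedIdeal {p : ℕ} [CharP (ResidueField A) p] (B : Type*) [CommRing B]
    [Algebra A B] : (p : B) ∈ extendedIdeal A B := by
  have : (p : A) ∈ maximalIdeal A := by
    rw [← residue_eq_zero_iff, map_natCast, CharP.cast_eq_zero]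
  rw [← map_natCast (algebraMap A B)]
  exact Ideal.mem_map_of_mem (algebraMap A B) this

theorem exists_teichmuller_digits {T : Type*} [CommRing T] {π : T}
    (τ : T ⧸ Ideal.span {π} → T) (hτ : ∀ x, Ideal.Quotient.mk _ (τ x) = x) (z : T) :
    ∃ d : ℕ → T ⧸ Ideal.span {π}, ∀ N, π ^ N ∣ z - ∑ n ∈ Finset.range N, τ (d n) * π ^ n := by
  have hstep : ∀ y : T, ∃ y', y = τ (Ideal.Quotient.mk _ y) + π * y' := by
    intro y
    have : y - τ (Ideal.Quotient.mk _ y) ∈ Ideal.span {π} := by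
      rw [← Ideal.Quotient.eq_zero_iff_mem, map_sub, hτ, sub_self]
    obtain ⟨y', hy'⟩ := Ideal.mem_span_singleton.1 this
    exact ⟨y', by rw [← hy']; ring⟩
  choose next hnext using hstep
  refine ⟨fun n => Ideal.Quotient.mk _ (next^[n] z), fun N => ⟨next^[N] z, ?_⟩⟩
  induction N with
  | zero => simp
  | succ N ih =>
    rw [Finset.sum_range_succ, ← sub_sub, ih, Function.iterate_succ_apply']
    have := hnext (next^[N] z)
    linear_combination π ^ N * this

end Basics

theorem bijective_pow_addMonoidAlgebra {p : ℕ} [Fact p.Prime] {F J : Type*} [Field F] [CharP F p]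
    (hF : Function.Bijective fun x : F => x ^ p) :
    Function.Bijective fun x : AddMonoidAlgebra F (J →₀ pRat p) => x ^ p := by
  have hp := (Fact.out : p.Prime).ne_zero
  have : CharP (AddMonoidAlgebra F (J →₀ pRat p)) p :=
    charP_of_injective_algebraMap (algebraMap F (AddMonoidAlgebra F (J →₀ pRat p))).injective p
  refine ⟨fun x y hxy => ?_, fun x => ?_⟩
  · simp only at hxy
    have h : (x - y) ^ p = 0 := by rw [sub_pow_char, hxy, sub_self]
    exact sub_eq_zero.1 (eq_zero_of_pow_eq_zero h)
  · simp only
    induction x using AddMonoidAlgebra.induction_linear with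
    | zero => exact ⟨0, zero_pow hp⟩
    | add x y hx hy =>
      obtain ⟨x, rfl⟩ := hx
      obtain ⟨y, rfl⟩ := hy
      exact ⟨x + y, add_pow_char x y p⟩
    | single γ a =>
      obtain ⟨δ, rfl⟩ := exists_nsmul_eq_exp hp γ
      obtain ⟨c, rfl⟩ := hF.2 a
      exact ⟨.single δ c, AddMonoidAlgebra.single_pow _ _ _⟩

theorem rootMonomial_subtype {p : ℕ} {k F : Type*} [Field k] [Field F] [Algebra k F]
    (hF : Function.Bijective fun x : F => x ^ p) (B : Set k) (q : B →₀ pRat p) :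
    rootMonomial hF (fun i : B => algebraMap k F i) (.ofAdd q) =
      fieldMonomial hF (.ofAdd (q.embDomain (Function.Embedding.subtype (· ∈ B)))) := by
  rw [rootMonomial_apply, fieldMonomial, rootMonomial_apply, Finsupp.prod_embDomain]
  rfl

theorem PIndependent.linearIndependent {p : ℕ} {k F : Type*} [Field k] [Field F] [Algebra k F]
    {hF : Function.Bijective fun x : F => x ^ p} {B : Set k} (hB : PIndependent hF B) :
    LinearIndependent k fun q : {q : B →₀ pRat p // expFloor q = 0} =>
      rootMonomial hF (fun i : B => algebraMap k F i) (.ofAdd q.1) := by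
  have hred : ∀ q : {q : B →₀ pRat p // expFloor q = 0},
      q.1.embDomain (Function.Embedding.subtype (· ∈ B)) ∈ reducedExponents p B := by
    intro q
    refine ⟨?_, ?_⟩
    · rw [expFloor, ← Finsupp.embDomain_mapRange]
      change Finsupp.embDomain _ (expFloor q.1) = 0
      rw [q.2, Finsupp.embDomain_zero]
    · rw [Finsupp.support_embDomain, Finset.coe_map]
      rintro _ ⟨i, _, rfl⟩
      exact i.2
  have h := LinearIndependent.comp hB (fun q : {q : B →₀ pRat p // expFloor q = 0} =>
    (⟨_, hred q⟩ : reducedExponents p B)) fun q r hqr =>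
      Subtype.ext (Finsupp.embDomain_injective _ (congrArg Subtype.val hqr))
  convert! h using 1
  funext q
  exact rootMonomial_subtype hF B q.1

theorem span_range_rootMonomial {p : ℕ} {k F : Type*} [Field k] [Field F] [Algebra k F]
    {hF : Function.Bijective fun x : F => x ^ p} {B : Set k}
    (hB : Submodule.span k
      ((fun q => fieldMonomial hF (.ofAdd q)) '' reducedExponents p B) = ⊤) :
    Submodule.span k (Set.range fun q : B →₀ pRat p =>
      rootMonomial hF (fun i : B => algebraMap k F i) (.ofAdd q)) = ⊤ := by
  rw [eq_top_iff, ← hB]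
  refine Submodule.span_mono ?_
  rintro _ ⟨q, hq, rfl⟩
  refine ⟨Finsupp.comapDomain (Function.Embedding.subtype (· ∈ B)) q
    (Function.Embedding.injective _).injOn, ?_⟩
  simp only
  rw [rootMonomial_subtype, Finsupp.embDomain_comapDomain]
  simpa using hq.2

section Model

variable (p : ℕ) [Fact p.Prime] {A : Type u} [CommRing A] [IsDomain A] [IsDiscreteValuationRing A]
  [CharP (ResidueField A) p] {ϖ : A} (hϖ : Irreducible ϖ) {I F : Type u} [Field F]
  [Algebra (ResidueField A) F]

include hϖ in
/-- The first ring in the construction: a `ϖ`-adically complete `A`-algebra with independent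
elements `c (i, n)` having all `p`-power roots, and the elements `∑ c (i, n) ϖ ^ n`. -/
theorem exists_seriesRing :
    ∃ (S : Type u) (_ : CommRing S) (_ : Algebra A S) (ζ : I → S),
      (∀ x : S, algebraMap A S ϖ * x = 0 → x = 0) ∧
      (∃ ψ : S →+* AddMonoidAlgebra F (I × ℕ →₀ pRat p),
        (∀ x, ψ x = 0 ↔ algebraMap A S ϖ ∣ x) ∧
        (∀ a, ψ (algebraMap A S a) = .single 0 (algebraMap _ F (residue A a))) ∧
        (∀ x γ, (ψ x).coeff γ ∈ (algebraMap (ResidueField A) F).range) ∧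
        (∀ γ a, ∃ x, ψ x = .single γ (algebraMap (ResidueField A) F a)) ∧
        ∀ i, ψ (ζ i) = .single (.single (i, 0) 1) 1) ∧
      ∀ (D : Type u) [CommRing D] [Algebra A D], IsCompleteResidualPerfection p A D →
        ∀ z : I → D, ∃ φ : S →+* D, φ.comp (algebraMap A S) = algebraMap A D ∧
          ∀ i, φ (ζ i) = z i := by
  let S₀ := AddMonoidAlgebra A (I × ℕ →₀ pRat p)
  let π₀ : S₀ := .single 0 ϖ
  have hπ₀ : ∀ x, π₀ * x = 0 → x = 0 := by
    intro x hx
    ext γ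
    have := congrArg (fun z => AddMonoidAlgebra.coeff z γ) hx
    have h : (π₀ * x).coeff γ = ϖ * x.coeff γ := AddMonoidAlgebra.coeff_single_zero_mul _ _ _
    simp only [h] at this
    exact (mul_eq_zero.1 this).resolve_left hϖ.ne_zero
  obtain ⟨S, _, _, hS0, hSc, hSs, hSk, hSl⟩ := exists_adicCompletion π₀ hπ₀
  let ι : S₀ →+* S := algebraMap S₀ S
  let j : A →+* S := ι.comp AddMonoidAlgebra.singleZeroRingHom
  let v : I × ℕ → S₀ := fun x => .single (.single x 1) 1
  -- ζ i is the series ∑ v (i, n) π^n with indeterminate digits. Any z i in a residual perfection D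
  -- is its image once the v (i, n) are sent to the Teichmüller lifts of the digits of z i.
  have hζ : ∀ i, ∃ s : S, ∀ N, ι π₀ ^ N ∣ s - ∑ n ∈ Finset.range N, ι (v (i, n)) * ι π₀ ^ n :=
    fun i => exists_adic_limit (π := ι π₀)
      (fun N => ∑ n ∈ Finset.range N, ι (v (i, n)) * ι π₀ ^ n) fun N => by
        rw [Finset.sum_range_succ, add_sub_cancel_left]
        exact dvd_mul_left _ _
  choose ζ hζ using hζ
  refine ⟨S, inferInstance, j.toAlgebra, ζ, hS0, ?_, ?_⟩
  · let κ : A →+* F := (algebraMap (ResidueField A) F).comp (residue A)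
    let φ : S₀ →+* AddMonoidAlgebra F (I × ℕ →₀ pRat p) := AddMonoidAlgebra.evalHom
      (AddMonoidAlgebra.singleZeroRingHom.comp κ) (AddMonoidAlgebra.of F _)
    have hφs : ∀ γ a, φ (.single γ a) = .single γ (κ a) := by
      intro γ a
      rw [AddMonoidAlgebra.evalHom_single]
      change AddMonoidAlgebra.single 0 (κ a) * AddMonoidAlgebra.single γ 1 = _
      rw [AddMonoidAlgebra.single_mul_single, zero_add, mul_one]
    have hφc : ∀ x γ, (φ x).coeff γ = κ (x.coeff γ) := by
      intro x γ
      induction x using AddMonoidAlgebra.induction_linear with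
      | zero => simp
      | add x y hx hy => simp [hx, hy]
      | single δ a =>
        classical
        rw [hφs, AddMonoidAlgebra.coeff_single, AddMonoidAlgebra.coeff_single,
          Finsupp.single_apply, Finsupp.single_apply]
        split_ifs <;> simp
    have hκ : ∀ a, κ a = 0 ↔ ϖ ∣ a := by
      intro a
      rw [← Ideal.mem_span_singleton, ← hϖ.maximalIdeal_eq, ← residue_eq_zero_iff]
      exact map_eq_zero (algebraMap (ResidueField A) F)
    have hφπ : φ π₀ = 0 := by
      rw [hφs, (hκ ϖ).2 dvd_rfl, AddMonoidAlgebra.single_zero]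
    -- The uniformizer maps to 0, so the target only has to be complete for the zero ideal.
    obtain ⟨ψ, hψ⟩ := hSl _ φ (by
      rw [hφπ, Ideal.span_singleton_zero]
      infer_instance)
    have hψι : ∀ x, ψ (ι x) = φ x := fun x => RingHom.congr_fun hψ x
    have hφd : ∀ x, φ x = 0 → π₀ ∣ x := by
      intro x hx
      have : ∀ γ, ϖ ∣ x.coeff γ := fun γ => by
        rw [← hκ, ← hφc, hx]
        rfl
      rw [← AddMonoidAlgebra.sum_coeff_single x]
      refine Finset.dvd_sum fun γ _ => ?_
      obtain ⟨b, hb⟩ := this γ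
      refine ⟨.single γ b, ?_⟩
      rw [AddMonoidAlgebra.single_mul_single, zero_add, ← hb]
    refine ⟨ψ, ?_, ?_, ?_, ?_, ?_⟩
    · intro x
      change _ ↔ ι π₀ ∣ x
      constructor
      · intro hx
        obtain ⟨r, t, hrt⟩ := hSs x
        have hx' : x = ι r + ι π₀ * t := by rw [← hrt]; ring
        rw [hx', map_add, map_mul, hψι, hψι, hφπ, zero_mul, add_zero] at hx
        rw [hx']
        exact dvd_add (map_dvd ι (hφd r hx)) (dvd_mul_right _ _)
      · rintro ⟨t, rfl⟩
        rw [map_mul, hψι, hφπ, zero_mul]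
    · intro a
      exact (hψι _).trans (hφs 0 a)
    · intro x γ
      obtain ⟨r, t, hrt⟩ := hSs x
      have hx' : x = ι r + ι π₀ * t := by rw [← hrt]; ring
      rw [hx', map_add, map_mul, hψι, hψι, hφπ, zero_mul, add_zero, hφc]
      exact ⟨_, rfl⟩
    · intro γ a
      obtain ⟨a, rfl⟩ := residue_surjective a
      exact ⟨ι (.single γ a), (hψι _).trans (hφs γ a)⟩
    · intro i
      obtain ⟨t, ht⟩ := hζ i 1
      have hx' : ζ i = ι (v (i, 0)) + ι π₀ * t := by
        rw [Finset.sum_range_one, pow_zero, mul_one, pow_one] at ht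
        rw [← ht]
        ring
      rw [hx', map_add, map_mul, hψι, hψι, hφπ, zero_mul, add_zero, hφs, map_one]
  · intro D _ _ hD z
    have hc := hD.complete
    have hperf : Function.Bijective fun x : D ⧸ extendedIdeal A D => x ^ p := hD.perfect
    have hpD := natCast_mem_extendedIdeal (A := A) (p := p) D
    rw [extendedIdeal_eq_span hϖ] at hc hperf hpD
    obtain ⟨τ, hτ0, hτ⟩ := exists_teichmuller _ hpD hperf
    choose d hd using fun i => exists_teichmuller_digits τ hτ (z i)
    let φ₀ : S₀ →+* D := AddMonoidAlgebra.evalHom (algebraMap A D)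
      (τ.comp (rootMonomial hperf fun x : I × ℕ => d x.1 x.2))
    have hφa : ∀ a, φ₀ (.single 0 a) = algebraMap A D a := by
      intro a
      rw [AddMonoidAlgebra.evalHom_single, ofAdd_zero, map_one, mul_one]
    have hφv : ∀ i n, φ₀ (v (i, n)) = τ (d i n) := by
      intro i n
      rw [AddMonoidAlgebra.evalHom_single, map_one, one_mul, MonoidHom.comp_apply,
        rootMonomial_single, rootPow_one]
    obtain ⟨φ, hφ⟩ := hSl D φ₀ (by rwa [hφa])
    have hφι : ∀ x, φ (ι x) = φ₀ x := fun x => RingHom.congr_fun hφ x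
    refine ⟨φ, RingHom.ext fun a => (hφι _).trans (hφa a), fun i => ?_⟩
    refine sub_eq_zero.1 (eq_zero_of_forall_pow_dvd (π := algebraMap A D ϖ) fun N => ?_)
    have h1 := map_dvd φ (hζ i N)
    simp only [map_pow, map_sub, map_sum, map_mul, hφι, hφv] at h1
    rw [hφa] at h1
    have h2 := dvd_sub h1 (hd i N)
    rwa [sub_sub_sub_cancel_right] at h2

include hϖ in
/-- A complete residual perfection of `A` which maps to every other one, and whose reduction is a
ring of polynomials with exponents in `ℕ[1/p]` over a perfect closure `F` of the residue field. -/
theorem exists_model (hF : Function.Bijective fun x : F => x ^ p) (b : I → A)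
    (hli : LinearIndependent (ResidueField A) fun q : {q : I →₀ pRat p // expFloor q = 0} =>
      rootMonomial hF (fun i => algebraMap (ResidueField A) F (residue A (b i))) (.ofAdd q.1))
    (hspan : Submodule.span (ResidueField A) (Set.range fun q : I →₀ pRat p =>
      rootMonomial hF (fun i => algebraMap (ResidueField A) F (residue A (b i))) (.ofAdd q)) = ⊤) :
    ∃ (C : Type u) (_ : CommRing C) (_ : Algebra A C), IsCompleteResidualPerfection p A C ∧
      (∀ (D : Type u) [CommRing D] [Algebra A D], IsCompleteResidualPerfection p A D →
        Nonempty (C →ₐ[A] D)) ∧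
      ∃ ψ : C →+* AddMonoidAlgebra F (I × ℕ →₀ pRat p),
        (∀ x, ψ x = 0 ↔ algebraMap A C ϖ ∣ x) ∧
        (∀ a, ψ (algebraMap A C a) = .single 0 (algebraMap _ F (residue A a))) ∧
        ∀ i, ∃ t z, algebraMap A C (b i) = t ^ p + algebraMap A C ϖ * z ∧
          ψ z = .single (.single (i, 0) 1) 1 := by
  obtain ⟨S, _, _, ζ, hS0, ⟨ψS, hψSk, hψSa, hψSc, hψSs, hψSζ⟩, hSl⟩ :=
    exists_seriesRing p hϖ (I := I) (F := F)
  let β : I → F := fun i => algebraMap (ResidueField A) F (residue A (b i))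
  -- In a residual perfection D one has b i = τ + π z i with τ a Teichmüller element. Sending ζ i to
  -- z i sends f i to τ, which has all p-power roots; adjoining roots of f i therefore does not
  -- obstruct maps to D.
  let f : I → S := fun i => algebraMap A S (b i) - algebraMap A S ϖ * ζ i
  obtain ⟨P, _, _, θ, hθ, hP0, hPs, hPl⟩ := exists_rootAdjunction p f
  let πP : P := algebraMap S P (algebraMap A S ϖ)
  obtain ⟨C, _, _, hC0, hCc, hCs, hCk, hCl⟩ := exists_adicCompletion πP (hP0 _ hS0)
  let j : A →+* C := (algebraMap P C).comp ((algebraMap S P).comp (algebraMap A S))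
  let _ : Algebra A C := j.toAlgebra
  have hψSπ : ψS (algebraMap A S ϖ) = 0 := (hψSk _).2 dvd_rfl
  let σ : F →* AddMonoidAlgebra F (I × ℕ →₀ pRat p) :=
    (AddMonoidAlgebra.singleZeroRingHom : F →+* AddMonoidAlgebra F (I × ℕ →₀ pRat p))
  obtain ⟨ψP, hψPS, hψPθ⟩ := hPl _ ψS (σ.comp (rootMonomial hF β)) (by
      intro i
      rw [MonoidHom.comp_apply, rootMonomial_single, rootPow_one, map_sub, map_mul, hψSπ,
        zero_mul, sub_zero, hψSa]
      rfl)
  have hψPS' : ∀ s, ψP (algebraMap S P s) = ψS s := fun s => RingHom.congr_fun hψPS s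
  have hψPθ' : ∀ γ, ψP (θ γ) = .single 0 (rootMonomial hF β γ) := hψPθ
  -- In normal form, the coefficient of each monomial in the indeterminates is a k-linear relation
  -- between reduced monomials in the p-basis; by independence all its coefficients vanish.
  have hψPk : ∀ x, ψP x = 0 → πP ∣ x := by
    intro x hx
    obtain ⟨h, hsupp, rfl⟩ := hPs x
    rw [Finsupp.sum, map_sum] at hx
    choose a ha using hψSc
    have hz : ∀ γ ∈ h.support, ψS (h γ) = 0 := by
      intro γ hγ
      ext δ
      have h1 := congrArg (fun y => AddMonoidAlgebra.coeff y δ) hx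
      simp only [AddMonoidAlgebra.coeff_sum, Finsupp.finsetSum_apply] at h1
      have h2 : ∑ q ∈ h.support, a (h q) δ • rootMonomial hF β (.ofAdd q) = 0 := by
        refine Eq.trans (Finset.sum_congr rfl fun q _ => ?_) h1
        rw [map_mul, hψPS', hψPθ', AddMonoidAlgebra.coeff_mul_single_zero, Algebra.smul_def, ha]
      have hli' : LinearIndepOn (ResidueField A)
        (fun q => rootMonomial hF β (.ofAdd q)) {q : I →₀ pRat p | expFloor q = 0} := hli
      have h3 := linearIndepOn_iff'.1 hli' h.support (fun q => a (h q) δ)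
        (fun q hq => hsupp q hq) h2 γ hγ
      rw [← ha, h3, map_zero]
      rfl
    refine Finset.dvd_sum fun γ hγ => ?_
    exact dvd_mul_of_dvd_left (map_dvd (algebraMap S P) ((hψSk _).1 (hz γ hγ))) _
  have hψPs : Function.Surjective ψP := by
    intro x
    induction x using AddMonoidAlgebra.induction_linear with
    | zero => exact ⟨0, map_zero _⟩
    | add x y hx hy =>
      obtain ⟨x, rfl⟩ := hx
      obtain ⟨y, rfl⟩ := hy
      exact ⟨x + y, map_add _ _ _⟩
    | single γ y =>
      have hy : y ∈ Submodule.span (ResidueField A)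
        (Set.range fun q : I →₀ pRat p => rootMonomial hF β (.ofAdd q)) := by
        rw [hspan]
        trivial
      induction hy using Submodule.span_induction with
      | zero => exact ⟨0, by rw [map_zero, AddMonoidAlgebra.single_zero]⟩
      | mem y hy =>
        obtain ⟨q, rfl⟩ := hy
        obtain ⟨s, hs⟩ := hψSs γ 1
        refine ⟨algebraMap S P s * θ (.ofAdd q), ?_⟩
        rw [map_mul, hψPS', hψPθ', hs, map_one, AddMonoidAlgebra.single_mul_single, add_zero,
          one_mul]
      | add y z _ _ hy hz =>
        obtain ⟨y', hy'⟩ := hy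
        obtain ⟨z', hz'⟩ := hz
        exact ⟨y' + z', by rw [map_add, hy', hz', AddMonoidAlgebra.single_add]⟩
      | smul a y _ hy =>
        obtain ⟨y', hy'⟩ := hy
        obtain ⟨s, hs⟩ := hψSs 0 a
        refine ⟨algebraMap S P s * y', ?_⟩
        rw [map_mul, hψPS', hy', hs, AddMonoidAlgebra.single_mul_single, zero_add,
          Algebra.smul_def]
  obtain ⟨ψ, hψ⟩ := hCl _ ψP (by
    rw [hψPS', hψSπ, Ideal.span_singleton_zero]
    infer_instance)
  have hψP : ∀ x, ψ (algebraMap P C x) = ψP x := fun x => RingHom.congr_fun hψ x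
  have hψs : Function.Surjective ψ := fun y => by
    obtain ⟨x, rfl⟩ := hψPs y
    exact ⟨_, hψP x⟩
  have hψk : ∀ x, ψ x = 0 ↔ algebraMap A C ϖ ∣ x := by
    intro x
    change _ ↔ algebraMap P C πP ∣ x
    constructor
    · intro hx
      obtain ⟨r, t, hrt⟩ := hCs x
      have hx' : x = algebraMap P C r + algebraMap P C πP * t := by rw [← hrt]; ring
      rw [hx', map_add, map_mul, hψP, hψP, hψPS', hψSπ, zero_mul, add_zero] at hx
      rw [hx']
      exact dvd_add (map_dvd _ (hψPk r hx)) (dvd_mul_right _ _)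
    · rintro ⟨t, rfl⟩
      rw [map_mul, hψP, hψPS', hψSπ, zero_mul]
  refine ⟨C, inferInstance, inferInstance, ⟨flat_of_uniformizer hϖ C hC0, ?_, ?_⟩, ?_, ψ, hψk,
    ?_, ?_⟩
  · rw [extendedIdeal_eq_span hϖ]
    exact hCc
  · have : CharP F p := charP_of_injective_algebraMap (algebraMap (ResidueField A) F).injective p
    have hker : RingHom.ker ψ = extendedIdeal A C := by
      ext x
      rw [RingHom.mem_ker, hψk, mem_extendedIdeal_iff hϖ]
    let e : Reduction A C ≃+* AddMonoidAlgebra F (I × ℕ →₀ pRat p) :=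
      (Ideal.quotEquivOfEq hker.symm).trans (RingHom.quotientKerEquivOfSurjective hψs)
    have h := bijective_pow_addMonoidAlgebra (J := I × ℕ) hF
    have h2 : (fun x : Reduction A C => x ^ p) = e.symm ∘ (fun y => y ^ p) ∘ e := by
      funext x
      simp
    rw [h2]
    exact e.symm.bijective.comp (h.comp e.bijective)
  · intro D _ _ hD
    have hc := hD.complete
    have hperf : Function.Bijective fun x : D ⧸ extendedIdeal A D => x ^ p := hD.perfect
    have hpD := natCast_mem_extendedIdeal (A := A) (p := p) D
    rw [extendedIdeal_eq_span hϖ] at hc hperf hpD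
    obtain ⟨τ, hτ0, hτ⟩ := exists_teichmuller _ hpD hperf
    let bD : I → D ⧸ Ideal.span {algebraMap A D ϖ} := fun i =>
      Ideal.Quotient.mk _ (algebraMap A D (b i))
    have hz : ∀ i, ∃ z, algebraMap A D (b i) - τ (bD i) = algebraMap A D ϖ * z := by
      intro i
      rw [← dvd_def, ← Ideal.mem_span_singleton, ← Ideal.Quotient.eq_zero_iff_mem, map_sub, hτ,
        sub_self]
    choose z hz using hz
    obtain ⟨φS, hφSa, hφSζ⟩ := hSl D hD z
    have hφSa' : ∀ a, φS (algebraMap A S a) = algebraMap A D a := fun a => RingHom.congr_fun hφSa a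
    obtain ⟨φP, hφPS, hφPθ⟩ := hPl D φS (τ.comp (rootMonomial hperf bD)) (by
      intro i
      rw [MonoidHom.comp_apply, rootMonomial_single, rootPow_one, map_sub, map_mul, hφSa', hφSa',
        hφSζ, ← hz, sub_sub_cancel])
    have hφPS' : ∀ s, φP (algebraMap S P s) = φS s := fun s => RingHom.congr_fun hφPS s
    obtain ⟨φ, hφ⟩ := hCl D φP (by rwa [hφPS', hφSa'])
    have hφP : ∀ x, φ (algebraMap P C x) = φP x := fun x => RingHom.congr_fun hφ x
    exact ⟨{ φ with commutes' := fun a => (hφP _).trans ((hφPS' _).trans (hφSa' a)) }⟩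
  · intro a
    exact (hψP _).trans ((hψPS' _).trans (hψSa a))
  · intro i
    have hp := (Fact.out : p.Prime).ne_zero
    refine ⟨algebraMap P C (θ (.ofAdd (.single i (pRat.divP hp 1)))),
      algebraMap P C (algebraMap S P (ζ i)), ?_, ?_⟩
    · rw [← map_pow, ← map_pow, ← ofAdd_nsmul, Finsupp.smul_single, pRat.nsmul_divP, hθ]
      change algebraMap P C (algebraMap S P (algebraMap A S (b i))) = _ +
        algebraMap P C (algebraMap S P (algebraMap A S ϖ)) * _
      simp only [f, map_sub, map_mul]
      ring
    · rw [hψP, hψPS', hψSζ]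

end Model

/-! ### The residue field of the generic residual perfection. -/

section Generic

variable {p : ℕ} [Fact p.Prime] {A : Type u} [CommRing A] [IsDomain A] [IsDiscreteValuationRing A]
  [CharP (ResidueField A) p] {ϖ : A} (hϖ : Irreducible ϖ)

omit [Fact p.Prime] [CharP (ResidueField A) p] in
theorem dvd_sub_of_pow_sub {B : Type*} [CommRing B] [Algebra A B]
    (hϖ : Irreducible ϖ) (hB : Function.Bijective fun x : Reduction A B => x ^ p) {x y : B}
    (h : algebraMap A B ϖ ∣ x ^ p - y ^ p) : algebraMap A B ϖ ∣ x - y := by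
  rw [← mem_extendedIdeal_iff hϖ, ← Ideal.Quotient.mk_eq_mk_iff_sub_mem] at h ⊢
  exact hB.1 (by simpa using h)

omit [Fact p.Prime] in
-- In x^p - y^p = (x - y) ∑ x^i y^(p-1-i), the sum is congruent to p y^(p-1), hence to 0, modulo π.
theorem sq_dvd_pow_sub_pow {B : Type*} [CommRing B] {π x y : B} (hp : π ∣ (p : B))
    (h : π ∣ x - y) : π ^ 2 ∣ x ^ p - y ^ p := by
  obtain ⟨d, hd⟩ := h
  have hs : π ∣ ∑ i ∈ Finset.range p, x ^ i * y ^ (p - 1 - i) := by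
    rw [← Ideal.mem_span_singleton, ← Ideal.Quotient.eq_zero_iff_mem]
    have hxy : Ideal.Quotient.mk (Ideal.span {π}) x = Ideal.Quotient.mk (Ideal.span {π}) y := by
      rw [Ideal.Quotient.mk_eq_mk_iff_sub_mem, Ideal.mem_span_singleton, hd]
      exact dvd_mul_right _ _
    have hp' : Ideal.Quotient.mk (Ideal.span {π}) (p : B) = 0 :=
      Ideal.Quotient.eq_zero_iff_mem.2 (Ideal.mem_span_singleton.2 hp)
    simp only [map_sum, map_mul, map_pow, hxy]
    rw [Finset.sum_congr rfl fun i hi => by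
      rw [← pow_add, show i + (p - 1 - i) = p - 1 by have := Finset.mem_range.1 hi; omega]]
    rw [Finset.sum_const, Finset.card_range, nsmul_eq_mul, ← map_natCast (Ideal.Quotient.mk _), hp',
      zero_mul]
  rw [← Commute.geom_sum₂_mul (Commute.all x y), hd, sq]
  exact mul_dvd_mul hs (dvd_mul_right _ _)

omit [Fact p.Prime] in
/-- The second digit of a `p`-th power approximation is well defined. -/
theorem IsCompleteResidualPerfection.dvd_sub_of_pow_add {B : Type*} [CommRing B] [Algebra A B]
    (hϖ : Irreducible ϖ) (hB : IsCompleteResidualPerfection p A B) {x y c d : B}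
    (h : x ^ p + algebraMap A B ϖ * c = y ^ p + algebraMap A B ϖ * d) :
    algebraMap A B ϖ ∣ c - d := by
  have := hB.flat
  have h1 : algebraMap A B ϖ ∣ y - x :=
    dvd_sub_of_pow_sub hϖ hB.perfect ⟨c - d, by linear_combination -h⟩
  obtain ⟨e, he⟩ := sq_dvd_pow_sub_pow (p := p)
    ((mem_extendedIdeal_iff hϖ).1 (natCast_mem_extendedIdeal B)) h1
  refine ⟨e, ?_⟩
  rw [← sub_eq_zero]
  apply uniformizer_mul_eq_zero hϖ
  linear_combination h + he

include hϖ in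
-- The reduction of A^u embeds in a polynomial ring over F. Its fraction field therefore embeds in
-- the field Q of rational functions over k'. The last two clauses are computations with
-- polynomials: an element that becomes constant is already in F, and for a in B₀ the digit c of the
-- lift of a becomes an indeterminate.
theorem IsGenericResidualPerfection.exists_residue_embedding {Ag : Type u} [CommRing Ag]
    [Algebra A Ag] (hAg : IsGenericResidualPerfection p A Ag)
    {k' F : Type u} [Field k'] [Algebra (ResidueField A) k'] [Field F]
    [Algebra (ResidueField A) F] [IsPurelyInseparable (ResidueField A) F]
    [Algebra F k'] [IsScalarTower (ResidueField A) F k']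
    (hF : Function.Bijective fun x : F => x ^ p) {B₀ : Set (ResidueField A)}
    (hB₀ : PIndependent hF B₀) (s : ResidueField A → A) (hs : ∀ x, residue A (s x) = x) :
    IsField (Reduction A Ag) ∧ ∃ (Q : Type u) (_ : Field Q) (_ : Algebra k' Q)
      (H : Reduction A Ag →+* Q),
      (∀ a, H (algebraMap A (Reduction A Ag) a) =
        algebraMap k' Q (algebraMap _ k' (residue A a))) ∧
      (∀ β c, H β = algebraMap k' Q c → c ∈ (algebraMap F k').range) ∧
      ∀ a ∈ B₀, ∀ y c : Ag, algebraMap A Ag (s a) = y ^ p + algebraMap A Ag ϖ * c →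
        ∀ d, H (Ideal.Quotient.mk _ c) ≠ algebraMap k' Q d := by
  obtain ⟨hG, U, _, _, hU, f, hfrac⟩ := hAg
  let _ : Algebra (Reduction A U) (Reduction A Ag) := (reductionMap f).toAlgebra
  have hfrac' : IsFractionRing (Reduction A U) (Reduction A Ag) := hfrac
  have : ExpChar (ResidueField A) p := ExpChar.prime Fact.out
  obtain ⟨B, hB, hBi, hBs⟩ := PIndependent.exists_pBasis hF hB₀
  obtain ⟨C, _, _, hC, hCl, ψ, hψ0, hψa, hψz⟩ := exists_model p hϖ (I := B) hF (fun i => s i)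
    (by simpa only [hs] using hBi.linearIndependent)
    (by simpa only [hs] using span_range_rootMonomial hBs)
  -- Uniqueness of endomorphisms of the initial object makes the composite U → C → U the identity.
  -- So U → C stays injective modulo π.
  obtain ⟨φ, -, -⟩ := hU.existsUnique_algHom C hC
  obtain ⟨χ⟩ := hCl U hU.1
  have hχφ : ∀ x, χ (φ x) = x := by
    intro x
    have h := (hU.existsUnique_algHom U hU.1).unique (y₁ := χ.comp φ) (y₂ := AlgHom.id A U)
      trivial trivial
    exact DFunLike.congr_fun h x
  have hφd : ∀ x, algebraMap A C ϖ ∣ φ x → algebraMap A U ϖ ∣ x := by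
    rintro x ⟨y, hy⟩
    refine ⟨χ y, ?_⟩
    rw [← hχφ x, hy]
    simp
  let Γ := ↥B × ℕ →₀ pRat p
  let ψφ : U →+* AddMonoidAlgebra F Γ := ψ.comp (φ : U →+* C)
  have hψφ : ∀ x, ψφ x = 0 ↔ x ∈ extendedIdeal A U := by
    intro x
    rw [mem_extendedIdeal_iff hϖ]
    refine ⟨fun h => hφd x ((hψ0 _).1 h), fun h => (hψ0 _).2 ?_⟩
    obtain ⟨y, rfl⟩ := h
    exact ⟨φ y, by simp⟩
  let h₀ : Reduction A U →+* AddMonoidAlgebra F Γ :=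
    Ideal.Quotient.lift _ ψφ fun x hx => (hψφ x).2 hx
  have hh₀ : Function.Injective h₀ := by
    rw [injective_iff_map_eq_zero]
    intro x hx
    obtain ⟨x, rfl⟩ := Ideal.Quotient.mk_surjective x
    exact Ideal.Quotient.eq_zero_iff_mem.2 ((hψφ x).1 hx)
  have : IsDomain (AddMonoidAlgebra F Γ) := inferInstance
  have : IsDomain (Reduction A U) := hh₀.isDomain h₀
  let hfld : Field (Reduction A Ag) := IsFractionRing.toField (Reduction A U)
  let m : AddMonoidAlgebra F Γ →+* AddMonoidAlgebra k' Γ :=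
    AddMonoidAlgebra.mapRingHom Γ (algebraMap F k')
  have hm : Function.Injective m := by
    intro x y hxy
    ext γ
    have := congrArg (fun z => AddMonoidAlgebra.coeff z γ) hxy
    simpa [m, AddMonoidAlgebra.coeff_mapRingHom] using this
  have : IsDomain (AddMonoidAlgebra k' Γ) := inferInstance
  let Q := FractionRing (AddMonoidAlgebra k' Γ)
  let q : AddMonoidAlgebra k' Γ →+* Q := algebraMap _ _
  have hq : Function.Injective q := IsFractionRing.injective _ _
  let hQ : Reduction A U →+* Q := q.comp (m.comp h₀)
  have hhQ : Function.Injective hQ := hq.comp (hm.comp hh₀)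
  let e : k' →+* Q := q.comp AddMonoidAlgebra.singleZeroRingHom
  let H : Reduction A Ag →+* Q := IsFractionRing.lift (A := Reduction A U) hhQ
  have hH : ∀ x, H (algebraMap (Reduction A U) (Reduction A Ag) x) = hQ x :=
    fun x => IsFractionRing.lift_algebraMap hhQ x
  have hmk : ∀ x : U, algebraMap (Reduction A U) (Reduction A Ag) (Ideal.Quotient.mk _ x) =
      Ideal.Quotient.mk _ (f x) := fun x => rfl
  refine ⟨Field.toIsField _, Q, inferInstance, e.toAlgebra, H, ?_, ?_, ?_⟩
  · intro a
    have h1 : algebraMap A (Reduction A Ag) a =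
        algebraMap (Reduction A U) (Reduction A Ag) (Ideal.Quotient.mk _ (algebraMap A U a)) := by
      rw [hmk, f.commutes]; rfl
    rw [h1, hH]
    change q (m (ψ (φ (algebraMap A U a)))) = q _
    rw [φ.commutes, hψa]
    simp [m, IsScalarTower.algebraMap_apply (ResidueField A) F k']
  · intro β c hβ
    obtain ⟨x, y, hy, rfl⟩ := IsFractionRing.div_surjective (Reduction A U) β
    have hy0 : y ≠ 0 := nonZeroDivisors.ne_zero hy
    have hy1 : hQ y ≠ 0 := fun h => hy0 (hhQ (by rw [h, map_zero]))
    rw [map_div₀, hH, hH, div_eq_iff hy1] at hβ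
    -- With β = x/y this reads x = c y between polynomials over F, so c is a quotient of two
    -- coefficients.
    have h2 : m (h₀ x) = .single 0 c * m (h₀ y) := hq (by rw [map_mul]; exact hβ)
    have h3 : h₀ y ≠ 0 := fun h => hy0 (hh₀ (by rw [h, map_zero]))
    obtain ⟨γ, hγ⟩ : ∃ γ, (h₀ y).coeff γ ≠ 0 := by
      by_contra! h
      exact h3 (by ext γ; simpa using h γ)
    have h4 := congrArg (fun z => AddMonoidAlgebra.coeff z γ) h2
    simp only [m, AddMonoidAlgebra.coeff_mapRingHom, AddMonoidAlgebra.coeff_single_zero_mul] at h4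
    refine ⟨(h₀ x).coeff γ / (h₀ y).coeff γ, ?_⟩
    rw [map_div₀, h4, mul_div_cancel_right₀]
    simpa using hγ
  · intro a ha y c hy d hd
    let i : B := ⟨a, hB ha⟩
    obtain ⟨t, z, htz, hz⟩ := hψz i
    have h1 : algebraMap A U (s a) = χ t ^ p + algebraMap A U ϖ * χ z := by
      have := congrArg χ htz
      simpa using this
    have h2 : algebraMap A Ag (s a) = f (χ t) ^ p + algebraMap A Ag ϖ * f (χ z) := by
      have := congrArg f h1
      simpa using this
    -- The decompositions in C coming from `htz` and from the retraction have the same digit modulo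
    -- π. So φ (χ z) also reduces to the indeterminate (i, 0).
    have h3 : algebraMap A C (s a) = φ (χ t) ^ p + algebraMap A C ϖ * φ (χ z) := by
      have := congrArg φ h1
      simpa using this
    have h4 := hG.dvd_sub_of_pow_add hϖ (hy.symm.trans h2)
    have h5 := hC.dvd_sub_of_pow_add hϖ (htz.symm.trans h3)
    rw [← mem_extendedIdeal_iff hϖ, ← Ideal.Quotient.mk_eq_mk_iff_sub_mem] at h4
    rw [← hψ0, map_sub, sub_eq_zero, hz] at h5
    rw [h4, ← hmk, hH] at hd
    change q (m (ψ (φ (χ z)))) = q (AddMonoidAlgebra.single 0 d) at hd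
    have h6 := hq hd
    rw [← h5] at h6
    have h7 := congrArg (fun w => AddMonoidAlgebra.coeff w (.single (i, 0) 1)) h6
    have h8 : (0 : Γ) ≠ .single (i, 0) 1 := by
      refine (Finsupp.single_ne_zero.2 fun h => ?_).symm
      have := congrArg Subtype.val h
      rw [pRat.coe_one] at this
      exact one_ne_zero this
    simp [m, h8] at h7

end Generic

theorem mem_range_algebraMap_of_isAlgClosed {k Q : Type*} [Field k] [Field Q] [IsAlgClosed k]
    [Algebra k Q] {x : Q} (hx : IsAlgebraic k x) : x ∈ (algebraMap k Q).range :=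
  minpoly.mem_range_of_degree_eq_one k x (IsAlgClosed.degree_eq_one_of_irreducible k
    (minpoly.irreducible hx.isIntegral))

section Consequences

open Polynomial

variable {p : ℕ} [Fact p.Prime] {A : Type u} [CommRing A] [IsDomain A] [IsDiscreteValuationRing A]
  [CharP (ResidueField A) p] {ϖ : A} (hϖ : Irreducible ϖ) {Ag : Type u} [CommRing Ag]
  [Algebra A Ag] (hAg : IsGenericResidualPerfection p A Ag)

theorem aeval_map_of_compatible {R T Q k k' : Type*} [CommRing R] [CommRing T] [Algebra R T]
    [CommRing Q] [CommRing k] [CommRing k'] [Algebra k' Q] (H : T →+* Q) (r : R →+* k)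
    (i : k →+* k') (hH : ∀ a, H (algebraMap R T a) = algebraMap k' Q (i (r a))) (β : T)
    (g : R[X]) : H (aeval β g) = aeval (H β) ((g.map r).map i) := by
  rw [aeval_def, hom_eval₂, Polynomial.map_map, aeval_def, eval₂_map]
  congr 1
  ext a
  exact hH a

theorem perfectClosure_bijective_pow (k : Type*) [Field k] [CharP k p] :
    Function.Bijective fun x : perfectClosure k (AlgebraicClosure k) => x ^ p := by
  have : CharP (AlgebraicClosure k) p := charP_of_injective_algebraMap (algebraMap k _).injective p
  have : ExpChar (AlgebraicClosure k) p := ExpChar.prime Fact.out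
  exact (perfectClosure.perfectRing k (AlgebraicClosure k) p).bijective_frobenius

include hϖ hAg in
theorem IsGenericResidualPerfection.isField : IsField (Reduction A Ag) :=
  (hAg.exists_residue_embedding hϖ (k' := AlgebraicClosure (ResidueField A))
    (perfectClosure_bijective_pow (ResidueField A)) (pIndependent_empty _)
    (Function.surjInv residue_surjective) (Function.surjInv_eq _)).1

include hϖ hAg in
-- The image of β in Q is algebraic over an algebraically closed field of constants, hence constant,
-- hence in the perfect closure of the residue field of A.
theorem IsGenericResidualPerfection.exists_pow_eq {β : Reduction A Ag} {g : A[X]}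
    (hg : g.map (residue A) ≠ 0) (hβ : aeval β g = 0) :
    ∃ (n : ℕ) (a : A), β ^ p ^ n = algebraMap A (Reduction A Ag) a := by
  obtain ⟨hfld, Q, _, _, H, h1, h2, -⟩ :=
    hAg.exists_residue_embedding hϖ (k' := AlgebraicClosure (ResidueField A))
      (perfectClosure_bijective_pow (ResidueField A)) (pIndependent_empty _)
      (Function.surjInv residue_surjective) (Function.surjInv_eq _)
  let _ := hfld.toField
  have h3 : IsAlgebraic (AlgebraicClosure (ResidueField A)) (H β) := by
    refine ⟨(g.map (residue A)).map (algebraMap _ (AlgebraicClosure (ResidueField A))),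
      ?_, ?_⟩
    · rwa [Ne, Polynomial.map_eq_zero]
    · rw [← aeval_map_of_compatible H (residue A) _ h1, hβ, map_zero]
  obtain ⟨c, hc⟩ := mem_range_algebraMap_of_isAlgClosed h3
  obtain ⟨c, rfl⟩ := h2 β _ hc.symm
  have : ExpChar (ResidueField A) p := ExpChar.prime Fact.out
  obtain ⟨n, a, ha⟩ := (mem_perfectClosure_iff_pow_mem p).1 c.2
  obtain ⟨a, rfl⟩ := residue_surjective a
  refine ⟨n, a, H.injective ?_⟩
  rw [h1, map_pow, ← hc, ← map_pow, ha]
  rfl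

include hϖ hAg in
-- A residue that is not a p-th power forms a p-independent set. Taking it in the p-basis makes c a
-- nonconstant indeterminate in Q, which is transcendental over the constants.
theorem IsGenericResidualPerfection.aeval_ne_zero {a : A} (ha : ∀ b, residue A a ≠ b ^ p)
    {y c : Ag} (h : algebraMap A Ag a = y ^ p + algebraMap A Ag ϖ * c) {g : A[X]}
    (hg : g.map (residue A) ≠ 0) : aeval (Ideal.Quotient.mk (extendedIdeal A Ag) c) g ≠ 0 := by
  classical
  intro hc
  have hF := perfectClosure_bijective_pow (p := p) (ResidueField A)
  have : ExpChar (ResidueField A) p := ExpChar.prime Fact.out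
  have hB : PIndependent hF (insert (residue A a) ∅) := by
    refine PIndependent.insert hF (pIndependent_empty hF) fun y hy hy' => ?_
    have hbot : monomialField (k := ResidueField A) hF ∅ = ⊥ := by
      rw [eq_bot_iff, monomialField, IntermediateField.adjoin_le_iff]
      rintro _ ⟨q, hq, rfl⟩
      have hq0 : q = 0 := by simpa using hq
      rw [hq0, ofAdd_zero, map_one]
      exact one_mem _
    rw [hbot, IntermediateField.mem_bot] at hy'
    obtain ⟨b, rfl⟩ := hy'
    refine ha b ((algebraMap (ResidueField A)
      (perfectClosure (ResidueField A) (AlgebraicClosure (ResidueField A)))).injective ?_)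
    rw [← hy, map_pow]
  -- The section is altered at one point so that the residue of a lifts to a itself.
  have hs : ∀ x, residue A (Function.update (Function.surjInv residue_surjective)
      (residue A a) a x) = x := by
    intro x
    by_cases hx : x = residue A a
    · subst hx; simp
    · rw [Function.update_of_ne hx]
      exact Function.surjInv_eq _ _
  obtain ⟨hfld, Q, _, _, H, h1, -, h2⟩ :=
    hAg.exists_residue_embedding hϖ (k' := AlgebraicClosure (ResidueField A)) hF hB _ hs
  have h3 : IsAlgebraic (AlgebraicClosure (ResidueField A)) (H (Ideal.Quotient.mk _ c)) := by
    refine ⟨(g.map (residue A)).map (algebraMap _ (AlgebraicClosure (ResidueField A))),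
      ?_, ?_⟩
    · rwa [Ne, Polynomial.map_eq_zero]
    · rw [← aeval_map_of_compatible H (residue A) _ h1, hc, map_zero]
  obtain ⟨d, hd⟩ := mem_range_algebraMap_of_isAlgClosed h3
  exact h2 _ (Set.mem_insert _ _) y c (by simpa using h) d hd.symm

end Consequences

/-! ### Complete rings and their finite extensions. -/

section Complete

variable {T : Type*} [CommRing T] [IsDomain T] {π : T}

omit [IsDomain T] in
theorem isUnit_of_isUnit_mk [IsAdicComplete (Ideal.span {π}) T] {x y : T}
    (h : π ∣ x * y - 1) : IsUnit x := by
  have h1 := IsAdicComplete.le_jacobson_bot (Ideal.span {π}) (Ideal.mem_span_singleton.2 h)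
  have := Ideal.mem_jacobson_bot.1 h1 1
  rw [mul_one, sub_add_cancel] at this
  exact isUnit_of_mul_isUnit_left this

/-- A complete domain whose reduction modulo a nonzero element `π` is a field is a discrete
valuation ring with uniformizer `π`. -/
theorem isDiscreteValuationRing_of_isField [IsAdicComplete (Ideal.span {π}) T] (hπ : π ≠ 0)
    (hf : IsField (T ⧸ Ideal.span {π})) : IsDiscreteValuationRing T ∧ Irreducible π := by
  have hu : ∀ x, ¬π ∣ x → IsUnit x := by
    intro x hx
    have hx0 : Ideal.Quotient.mk (Ideal.span {π}) x ≠ 0 := fun h =>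
      hx (Ideal.mem_span_singleton.1 (Ideal.Quotient.eq_zero_iff_mem.1 h))
    obtain ⟨y, hy⟩ := hf.mul_inv_cancel hx0
    obtain ⟨y, rfl⟩ := Ideal.Quotient.mk_surjective y
    refine isUnit_of_isUnit_mk (π := π) (y := y) ?_
    rw [← Ideal.mem_span_singleton, ← Ideal.Quotient.mk_eq_mk_iff_sub_mem]
    simpa using hy
  have hn : ¬IsUnit π := by
    intro h
    have hf' := hf.nontrivial
    exact Ideal.Quotient.nontrivial_iff.1 hf' (Ideal.span_singleton_eq_top.2 h)
  have hirr : Irreducible π := by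
    refine ⟨hn, fun a b hab => ?_⟩
    by_contra! h
    obtain ⟨c, rfl⟩ := not_imp_comm.1 (hu a) h.1
    obtain ⟨d, rfl⟩ := not_imp_comm.1 (hu b) h.2
    refine hn (IsUnit.of_mul_eq_one (c * d) (mul_left_cancel₀ hπ ?_))
    linear_combination -hab
  refine ⟨IsDiscreteValuationRing.ofHasUnitMulPowIrreducibleFactorization ⟨π, hirr, ?_⟩, hirr⟩
  intro x hx
  have h1 : ∃ n, ¬π ^ n ∣ x := by
    by_contra! h
    exact hx (eq_zero_of_forall_pow_dvd h)
  classical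
  obtain ⟨n, hn1⟩ : ∃ n, Nat.find h1 = n + 1 := by
    refine Nat.exists_eq_succ_of_ne_zero fun h => ?_
    have := Nat.find_spec h1
    rw [h] at this
    simp at this
  have h2 : π ^ n ∣ x := not_not.1 (Nat.find_min h1 (m := n) (by omega))
  have h3 : ¬π ^ (n + 1) ∣ x := hn1 ▸ Nat.find_spec h1
  obtain ⟨c, rfl⟩ := h2
  have hc : IsUnit c := hu c fun ⟨d, hd⟩ => h3 ⟨d, by rw [hd]; ring⟩
  exact ⟨n, associated_mul_unit_right _ _ hc⟩

/-- The powers of x stabilize modulo π: x^n ≡ x^(n+1) y for some n and y, so e = x^n y^n is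
idempotent modulo π. Hensel's lemma lifts e to an idempotent of a domain, that is to 0 or 1. In the
first case x is nilpotent modulo π, in the second it is a unit. -/
theorem isUnit_or_dvd_pow_of_isArtinianRing [IsAdicComplete (Ideal.span {π}) T]
    [IsArtinianRing (T ⧸ Ideal.span {π})] (x : T) : IsUnit x ∨ ∃ n, π ∣ x ^ n := by
  obtain ⟨n, y, hy⟩ := IsArtinian.exists_pow_succ_smul_dvd
    (Ideal.Quotient.mk (Ideal.span {π}) x) (1 : T ⧸ Ideal.span {π})
  obtain ⟨y, rfl⟩ := Ideal.Quotient.mk_surjective y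
  simp only [smul_eq_mul, mul_one] at hy
  have hm : ∀ m, Ideal.Quotient.mk (Ideal.span {π}) (x ^ (n + m) * y ^ m) =
      Ideal.Quotient.mk (Ideal.span {π}) (x ^ n) := by
    intro m
    induction m with
    | zero => simp
    | succ m ih =>
      rw [← ih]
      simp only [map_mul, map_pow] at hy ⊢
      rw [Nat.succ_eq_add_one, pow_succ] at hy
      linear_combination (Ideal.Quotient.mk (Ideal.span {π}) x ^ m) *
        (Ideal.Quotient.mk (Ideal.span {π}) y ^ m) * hy
  set e : T := x ^ n * y ^ n with he
  have he2 : π ∣ e ^ 2 - e := by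
    rw [← Ideal.mem_span_singleton, ← Ideal.Quotient.mk_eq_mk_iff_sub_mem]
    have := hm n
    rw [show e ^ 2 = (x ^ (n + n) * y ^ n) * y ^ n by rw [he]; ring, map_mul, this, ← map_mul]
  obtain ⟨a, ha, hae⟩ := (IsAdicComplete.henselianRing T (Ideal.span {π})).is_henselian
    (Polynomial.X ^ 2 - Polynomial.X : Polynomial T)
    (Polynomial.monic_X_pow_sub (by simp)) e
    (by simpa [Ideal.mem_span_singleton] using he2)
    (by
      -- The derivative 2e - 1 is its own inverse modulo π, since (2e - 1)² = 1 + 4(e² - e).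
      refine IsUnit.of_mul_eq_one (Ideal.Quotient.mk (Ideal.span {π}) (2 * e - 1)) ?_
      rw [← map_mul, ← map_one (Ideal.Quotient.mk (Ideal.span {π})),
        Ideal.Quotient.mk_eq_mk_iff_sub_mem, Ideal.mem_span_singleton]
      obtain ⟨d, hd⟩ := he2
      refine ⟨4 * d, ?_⟩
      simp
      linear_combination 4 * hd)
  rw [Ideal.mem_span_singleton] at hae
  have ha' : a * (a - 1) = 0 := by
    have : a ^ 2 - a = 0 := by simpa [Polynomial.IsRoot] using ha
    linear_combination this
  obtain h0 | h1 := mul_eq_zero.1 ha'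
  · right
    refine ⟨n, ?_⟩
    have h2 : π ∣ e := by rw [h0, zero_sub] at hae; exact (dvd_neg).1 hae
    have h3 := hm n
    rw [Ideal.Quotient.mk_eq_mk_iff_sub_mem, Ideal.mem_span_singleton] at h3
    have h4 : π ∣ x ^ (n + n) * y ^ n := by
      rw [show x ^ (n + n) * y ^ n = e * x ^ n by rw [he]; ring]
      exact h2.mul_right _
    exact (dvd_sub_right h4).1 h3
  · left
    have h2 : π ∣ e - 1 := by
      rw [sub_eq_zero.1 h1] at hae
      rw [← neg_sub]; exact (dvd_neg).2 hae
    have h3 := hm 1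
    rw [Ideal.Quotient.mk_eq_mk_iff_sub_mem, Ideal.mem_span_singleton] at h3
    refine isUnit_of_isUnit_mk (π := π) (y := x ^ n * y ^ (n + 1)) ?_
    have : x * (x ^ n * y ^ (n + 1)) - 1 =
      (x ^ (n + 1) * y ^ 1 - x ^ n) * y ^ n + (e - 1) := by rw [he]; ring
    rw [this]
    exact dvd_add (h3.mul_right _) h2

end Complete

section Finite

variable {R : Type*} [CommRing R] [IsDomain R] [IsDiscreteValuationRing R]
  [IsAdicComplete (maximalIdeal R) R] {π : R} (hπ : Irreducible π)

include hπ in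
-- Separatedness is Krull's intersection theorem in a Noetherian domain. For limits, the increments
-- of a Cauchy sequence are lifted along a surjection R^k → S and summed coordinatewise.
theorem isAdicComplete_span_of_finite {S : Type*} [CommRing S] [IsDomain S] [Algebra R S]
    [Module.Finite R S] [FaithfulSMul R S] :
    IsAdicComplete (Ideal.span {algebraMap R S π}) S := by
  have hR : IsAdicComplete (Ideal.span {π}) R := by
    rw [← hπ.maximalIdeal_eq]; infer_instance
  have : IsNoetherian R S := isNoetherian_of_isNoetherianRing_of_finite R S
  have : IsNoetherianRing S := isNoetherian_of_tower R this
  have htop : Ideal.span {algebraMap R S π} ≠ ⊤ := by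
    rw [Ne, Ideal.span_singleton_eq_top]
    exact fun h => hπ.not_isUnit (isUnit_of_map_unit (algebraMap R S) π h)
  have hH : IsHausdorff (Ideal.span {algebraMap R S π}) S := IsHausdorff.of_isDomain _ htop
  refine { toIsHausdorff := hH, prec' := ?_ }
  intro f hf
  have hf' : ∀ m n, m ≤ n → algebraMap R S π ^ m ∣ f m - f n := by
    intro m n hmn
    have := hf hmn
    rwa [SModEq.sub_mem, smul_eq_mul, Ideal.mul_top, Ideal.span_singleton_pow,
      Ideal.mem_span_singleton] at this
  obtain ⟨k, g, hg⟩ := Module.Finite.exists_fin' R S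
  have h1 : ∀ n, ∃ c : Fin k → R, f (n + 1) - f n = algebraMap R S π ^ n * g c := by
    intro n
    obtain ⟨d, hd⟩ := hf' n (n + 1) (Nat.le_succ n)
    obtain ⟨c, hc⟩ := hg (-d)
    exact ⟨c, by rw [hc]; linear_combination -hd⟩
  choose c hc using h1
  have h2 : ∀ j, ∃ s : R, ∀ n, π ^ n ∣ s - ∑ i ∈ Finset.range n, π ^ i * c i j := fun j =>
    exists_adic_limit _ fun n => by
      rw [Finset.sum_range_succ, add_sub_cancel_left]; exact dvd_mul_right _ _
  choose s hs using h2
  have h3 : ∀ n, f n = f 0 + g (∑ i ∈ Finset.range n, π ^ i • c i) := by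
    intro n
    induction n with
    | zero => simp
    | succ n ih =>
      rw [Finset.sum_range_succ, map_add, ← add_assoc, ← ih, map_smul, Algebra.smul_def, map_pow]
      linear_combination hc n
  refine ⟨f 0 + g s, fun n => ?_⟩
  rw [SModEq.sub_mem, smul_eq_mul, Ideal.mul_top, Ideal.span_singleton_pow,
    Ideal.mem_span_singleton]
  choose d hd using fun j => hs j n
  refine ⟨g (-d), ?_⟩
  rw [h3 n, add_sub_add_left_eq_sub, ← map_sub, ← map_pow, ← Algebra.smul_def, ← map_smul]
  congr 1
  ext j
  have := hd j
  simp only [Pi.sub_apply, Finset.sum_apply, Pi.smul_apply, smul_eq_mul, Pi.neg_apply]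
  linear_combination -this

include hπ in
theorem isUnit_or_dvd_pow_of_finite {S : Type*} [CommRing S] [IsDomain S] [Algebra R S]
    [Module.Finite R S] [FaithfulSMul R S] (x : S) :
    IsUnit x ∨ ∃ n, algebraMap R S π ∣ x ^ n := by
  have := isAdicComplete_span_of_finite hπ (S := S)
  let k := R ⧸ Ideal.span {π}
  have hm : (Ideal.span {π}).IsMaximal := hπ.maximalIdeal_eq ▸ maximalIdeal.isMaximal R
  let _ : Field k := Ideal.Quotient.field _
  have hle : Ideal.span {π} ≤ (Ideal.span {algebraMap R S π}).comap (algebraMap R S) := by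
    rw [Ideal.span_singleton_le_iff_mem]
    exact Ideal.mem_span_singleton_self _
  let _ : Algebra k (S ⧸ Ideal.span {algebraMap R S π}) :=
    (Ideal.quotientMap _ (algebraMap R S) hle).toAlgebra
  have : IsScalarTower R k (S ⧸ Ideal.span {algebraMap R S π}) :=
    IsScalarTower.of_algebraMap_eq fun x => rfl
  have : Module.Finite k (S ⧸ Ideal.span {algebraMap R S π}) :=
    Module.Finite.of_restrictScalars_finite R _ _
  have : IsArtinianRing (S ⧸ Ideal.span {algebraMap R S π}) := IsArtinianRing.of_finite k _
  exact isUnit_or_dvd_pow_of_isArtinianRing x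

end Finite

/-! ### The integral closure as a local ring, and the valuation dichotomy. -/

section IntegralClosure

variable {R : Type*} [CommRing R] [IsDomain R] [IsDiscreteValuationRing R]
  [IsAdicComplete (maximalIdeal R) R] {π : R} (hπ : Irreducible π)
  {E : Type*} [Field E] [Algebra R E] [FaithfulSMul R E]

instance : FaithfulSMul R (integralClosure R E) := by
  rw [faithfulSMul_iff_algebraMap_injective]
  intro x y h
  exact FaithfulSMul.algebraMap_injective R E (congrArg Subtype.val h)

include hπ in
theorem isUnit_or_dvd_pow (x : integralClosure R E) :
    IsUnit x ∨ ∃ n, algebraMap R (integralClosure R E) π ∣ x ^ n := by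
  have hx : IsIntegral R (x : E) := x.2
  let S := Algebra.adjoin R {(x : E)}
  have : Module.Finite R S := Algebra.finite_adjoin_simple_of_isIntegral hx
  have : FaithfulSMul R S := by
    rw [faithfulSMul_iff_algebraMap_injective]
    intro x y h
    exact FaithfulSMul.algebraMap_injective R E (congrArg Subtype.val h)
  have hle : S ≤ integralClosure R E := Algebra.adjoin_singleton_le hx
  let i : S →ₐ[R] integralClosure R E := Subalgebra.inclusion hle
  let x' : S := ⟨x, Algebra.self_mem_adjoin_singleton R _⟩
  obtain h | ⟨n, y, hy⟩ := isUnit_or_dvd_pow_of_finite hπ x'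
  · exact Or.inl (h.map i)
  · refine Or.inr ⟨n, i y, ?_⟩
    have := congrArg i hy
    rw [map_pow, map_mul, i.commutes] at this
    exact this

/-- If neither x nor 1 - x is a unit, π divides a power of each. These powers are coprime, so π
would become a unit in an integral extension. -/
instance : IsLocalRing (integralClosure R E) := by
  obtain ⟨π, hπ⟩ := IsDiscreteValuationRing.exists_irreducible R
  refine .of_isUnit_or_isUnit_one_sub_self fun x => ?_
  obtain h | ⟨n, hn⟩ := isUnit_or_dvd_pow hπ x
  · exact Or.inl h
  obtain h | ⟨m, hm⟩ := isUnit_or_dvd_pow hπ (1 - x)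
  · exact Or.inr h
  exfalso
  have h1 : IsUnit (algebraMap R (integralClosure R E) π) := by
    have : IsCoprime (x ^ n) ((1 - x) ^ m) := IsCoprime.pow ⟨1, 1, by ring⟩
    obtain ⟨a, b, hab⟩ := this
    exact isUnit_of_dvd_one (hab ▸ dvd_add (hn.mul_left _) (hm.mul_left _))
  exact hπ.not_isUnit (isUnit_of_map_unit (algebraMap R _) _ h1)

theorem integralMaximalIdeal_eq :
    integralMaximalIdeal R E = maximalIdeal (integralClosure R E) :=
  jacobson_eq_maximalIdeal _ bot_ne_top

/-- Membership in the maximal ideal of the integral closure, for elements of the field. -/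
def IsSmall (R : Type*) {E : Type*} [CommRing R] [Field E] [Algebra R E] (x : E) : Prop :=
  ∃ y ∈ integralMaximalIdeal R E, (y : E) = x

omit [IsDomain R] [IsDiscreteValuationRing R] [IsAdicComplete (maximalIdeal R) R]
  [FaithfulSMul R E] in
theorem isSmall_coe {x : integralClosure R E} :
    IsSmall R (x : E) ↔ x ∈ integralMaximalIdeal R E :=
  ⟨fun ⟨_, hy, h⟩ => Subtype.ext h ▸ hy, fun h => ⟨x, h, rfl⟩⟩

section
omit [IsDomain R] [IsDiscreteValuationRing R] [IsAdicComplete (maximalIdeal R) R]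
  [FaithfulSMul R E]
variable {x y : E}

theorem IsSmall.isIntegral (hx : IsSmall R x) : IsIntegral R x := by
  obtain ⟨z, -, rfl⟩ := hx
  exact z.2

theorem isSmall_zero : IsSmall R (0 : E) := ⟨0, zero_mem _, rfl⟩

theorem IsSmall.add (hx : IsSmall R x) (hy : IsSmall R y) : IsSmall R (x + y) := by
  obtain ⟨x, hx, rfl⟩ := hx
  obtain ⟨y, hy, rfl⟩ := hy
  exact ⟨_, add_mem hx hy, rfl⟩

theorem IsSmall.neg (hx : IsSmall R x) : IsSmall R (-x) := by
  obtain ⟨x, hx, rfl⟩ := hx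
  exact ⟨_, neg_mem hx, rfl⟩

theorem IsSmall.sub (hx : IsSmall R x) (hy : IsSmall R y) : IsSmall R (x - y) := by
  rw [sub_eq_add_neg]
  exact hx.add hy.neg

theorem IsSmall.mul_left (hx : IsSmall R x) (hy : IsIntegral R y) : IsSmall R (y * x) := by
  obtain ⟨x, hx, rfl⟩ := hx
  exact ⟨⟨y, hy⟩ * x, Ideal.mul_mem_left _ _ hx, rfl⟩

theorem IsSmall.mul_right (hx : IsSmall R x) (hy : IsIntegral R y) : IsSmall R (x * y) :=
  mul_comm y x ▸ hx.mul_left hy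

theorem isSmall_sum {ι : Type*} {s : Finset ι} {f : ι → E} (h : ∀ i ∈ s, IsSmall R (f i)) :
    IsSmall R (∑ i ∈ s, f i) :=
  Finset.sum_induction f (IsSmall R) (fun _ _ => IsSmall.add) isSmall_zero h

theorem mem_inertiaGroup_iff {F : Type*} [Field F] [Algebra R F] [Algebra F E]
    [IsScalarTower R F E] {σ : E ≃ₐ[F] E} :
    σ ∈ inertiaGroup R F E ↔ ∀ x, IsIntegral R x → IsSmall R (σ x - x) := by
  refine ⟨fun h x hx => ⟨_, h ⟨x, hx⟩, rfl⟩, fun h x => ?_⟩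
  exact isSmall_coe.1 (h x x.2)

theorem mem_wildInertiaGroup_iff {F : Type*} [Field F] [Algebra R F] [Algebra F E]
    [IsScalarTower R F E] {σ : E ≃ₐ[F] E} :
    σ ∈ wildInertiaGroup R F E ↔ ∀ x, x ≠ 0 → IsSmall R (σ x / x - 1) := by
  refine forall₂_congr fun x hx => exists_congr fun y => and_congr_right fun _ => ?_
  rw [eq_comm, eq_sub_iff_add_eq', eq_comm]

end

theorem not_isSmall_one : ¬IsSmall R (1 : E) := by
  intro h
  have : (1 : integralClosure R E) ∈ integralMaximalIdeal R E := isSmall_coe.1 h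
  rw [integralMaximalIdeal_eq, mem_maximalIdeal] at this
  exact this isUnit_one

theorem isSmall_or_isIntegral_inv {x : E} (hx : IsIntegral R x) :
    IsSmall R x ∨ x ≠ 0 ∧ IsIntegral R x⁻¹ := by
  by_cases h : IsUnit (⟨x, hx⟩ : integralClosure R E)
  · right
    obtain ⟨y, hy⟩ := h.exists_right_inv
    have hy' : x * y = 1 := congrArg Subtype.val hy
    refine ⟨left_ne_zero_of_mul_eq_one hy', ?_⟩
    rw [inv_eq_of_mul_eq_one_right hy']
    exact y.2
  · left
    refine ⟨⟨x, hx⟩, ?_, rfl⟩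
    rwa [integralMaximalIdeal_eq, mem_maximalIdeal]

include hπ in
-- This criterion refers only to integrality and π, so smallness can be transported along field
-- embeddings and from A to A^g.
theorem isSmall_iff {x : E} : IsSmall R x ↔
    ∃ n z, IsIntegral R z ∧ x ^ n = algebraMap R E π * z := by
  constructor
  · rintro ⟨y, hy, rfl⟩
    rw [integralMaximalIdeal_eq, mem_maximalIdeal] at hy
    obtain ⟨n, z, hz⟩ := (isUnit_or_dvd_pow hπ y).resolve_left hy
    exact ⟨n, z, z.2, congrArg Subtype.val hz⟩
  · rintro ⟨n, z, hz, h⟩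
    have h1 : ¬IsUnit (algebraMap R (integralClosure R E) π) := fun h =>
      hπ.not_isUnit (isUnit_of_map_unit (algebraMap R _) _ h)
    -- The exponent 0 excludes itself: 1 = πz would make π a unit.
    have hn : 0 < n := by
      refine Nat.pos_of_ne_zero fun hn => h1 ?_
      refine IsUnit.of_mul_eq_one ⟨z, hz⟩ (Subtype.ext ?_)
      rw [hn, pow_zero] at h
      exact h.symm
    have hx : IsIntegral R x := by
      refine IsIntegral.of_pow hn ?_
      rw [h]
      exact isIntegral_algebraMap.mul hz
    refine ⟨⟨x, hx⟩, ?_, rfl⟩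
    rw [integralMaximalIdeal_eq, mem_maximalIdeal]
    intro hu
    have h2 : IsUnit (algebraMap R (integralClosure R E) π * ⟨z, hz⟩) := by
      have : algebraMap R (integralClosure R E) π * ⟨z, hz⟩ = ⟨x, hx⟩ ^ n := Subtype.ext h.symm
      rw [this]
      exact hu.pow n
    exact h1 (isUnit_of_mul_isUnit_left h2)

include hπ in
theorem isSmall_uniformizer_mul {z : E} (hz : IsIntegral R z) :
    IsSmall R (algebraMap R E π * z) := (isSmall_iff hπ).2 ⟨1, z, hz, pow_one _⟩

theorem IsSmall.of_mul {x y : E} (hx : IsIntegral R x)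
    (h : IsSmall R (x * y)) : IsSmall R x ∨ IsSmall R y := by
  refine or_iff_not_imp_left.2 fun hx' => ?_
  obtain ⟨hx0, hi⟩ := (isSmall_or_isIntegral_inv hx).resolve_left hx'
  have := h.mul_left hi
  rwa [inv_mul_cancel_left₀ hx0] at this

theorem IsSmall.algebraMap_iff {a : R} : IsSmall R (algebraMap R E a) ↔ a ∈ maximalIdeal R := by
  rw [show algebraMap R E a = (algebraMap R (integralClosure R E) a : E) from rfl, isSmall_coe,
    integralMaximalIdeal_eq, mem_maximalIdeal, mem_maximalIdeal, mem_nonunits_iff,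
    mem_nonunits_iff, isUnit_map_iff]

theorem IsSmall.natCast {p : ℕ} [CharP (ResidueField R) p] : IsSmall R (p : E) := by
  rw [← map_natCast (algebraMap R E), IsSmall.algebraMap_iff, ← residue_eq_zero_iff, map_natCast,
    CharP.cast_eq_zero]

end IntegralClosure

section Valuation

variable (R F : Type*) [CommRing R] [IsDomain R] [IsDiscreteValuationRing R]
  [IsAdicComplete (maximalIdeal R) R] [Field F] [Algebra R F] [IsFractionRing R F]
  {E : Type*} [Field E] [Algebra R E] [Algebra F E] [IsScalarTower R F E]

omit [IsDomain R] [IsDiscreteValuationRing R] [IsAdicComplete (maximalIdeal R) R] in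
include F in
theorem faithfulSMul_of_isFractionRing : FaithfulSMul R E := by
  rw [faithfulSMul_iff_algebraMap_injective, IsScalarTower.algebraMap_eq R F E]
  exact (algebraMap F E).injective.comp (IsFractionRing.injective R F)

/-- In the finite separable extension F(x), the integral closure of R is Dedekind and local, hence a
valuation ring. -/
theorem isIntegral_or_isIntegral_inv [Algebra.IsSeparable F E] (x : E) :
    IsIntegral R x ∨ IsIntegral R x⁻¹ := by
  let E' := IntermediateField.adjoin F {x}
  have : FiniteDimensional F E' :=
    IntermediateField.adjoin.finiteDimensional (Algebra.IsIntegral.isIntegral x)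
  have : FaithfulSMul R E' := faithfulSMul_of_isFractionRing R F
  have : IsDedekindDomain (integralClosure R E') := integralClosure.isDedekindDomain R F E'
  have : IsPrincipalIdealRing (integralClosure R E') := IsDedekindDomain.isPrincipalIdealRing _
  have : ValuationRing (integralClosure R E') :=
    ValuationRing.iff_local_bezout_domain.2 ⟨inferInstance, inferInstance⟩
  have : IsFractionRing (integralClosure R E') E' :=
    integralClosure.isFractionRing_of_finite_extension F E'
  have key : ∀ y : E', IsLocalization.IsInteger (integralClosure R E') y → IsIntegral R (y : E) := by
    rintro _ ⟨z, rfl⟩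
    have hz : IsIntegral R (z : E') := z.2
    exact hz.map (E'.val.restrictScalars R)
  let x' : E' := ⟨x, IntermediateField.mem_adjoin_simple_self F x⟩
  obtain h | h := ValuationRing.isInteger_or_isInteger (integralClosure R E') x'
  · exact Or.inl (key _ h)
  · exact Or.inr (key _ h)

theorem isIntegral_or_isSmall_inv [Algebra.IsSeparable F E] (x : E) :
    IsIntegral R x ∨ IsSmall R x⁻¹ := by
  have : FaithfulSMul R E := faithfulSMul_of_isFractionRing R F
  obtain h | h := isIntegral_or_isIntegral_inv R F x
  · exact Or.inl h
  obtain h' | ⟨-, h'⟩ := isSmall_or_isIntegral_inv h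
  · exact Or.inr h'
  · exact Or.inl (by rwa [inv_inv] at h')

end Valuation

/-! ### Separable residue extensions and lifting of roots. -/

section Separable

open Polynomial

/-- The product of X - t over the distinct conjugates t of x has coefficients invariant under all
automorphisms. By normality such a coefficient has only one conjugate; it is purely inseparable over
k, hence in k. So x is a root of a separable polynomial over k. -/
theorem isSeparable_of_normal {k l : Type*} [Field k] [Field l] [Algebra k l] [Normal k l]
    (h : perfectClosure k l = ⊥) (x : l) : IsSeparable k x := by
  classical
  have hx : IsIntegral k x := Algebra.IsIntegral.isIntegral x
  have hs := Normal.splits (F := k) inferInstance x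
  let T := ((minpoly k x).aroots l).toFinset
  have hT : ∀ t, t ∈ T ↔ aeval t (minpoly k x) = 0 := by
    intro t
    rw [Multiset.mem_toFinset, mem_aroots, and_iff_right (minpoly.ne_zero hx)]
  let q : l[X] := ∏ t ∈ T, (X - C t)
  have hqσ : ∀ σ : l ≃ₐ[k] l, q.map (σ : l →+* l) = q := by
    intro σ
    have hmap : q.map (σ : l →+* l) = ∏ t ∈ T, (X - C (σ t)) := by
      simp [q, Polynomial.map_prod]
    rw [hmap]
    refine Finset.prod_bijective σ σ.bijective (fun t => ?_) fun _ _ => rfl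
    rw [hT, hT, aeval_algEquiv, AlgHom.comp_apply]
    exact (map_eq_zero σ).symm
  have hq : q ∈ lifts (algebraMap k l) := by
    rw [lifts_iff_coeff_lifts]
    intro n
    have hc : ∀ σ : l ≃ₐ[k] l, σ (q.coeff n) = q.coeff n := by
      intro σ
      conv_rhs => rw [← hqσ σ]
      rw [coeff_map]; rfl
    set c := q.coeff n
    have hci : IsIntegral k c := Algebra.IsIntegral.isIntegral c
    have : c ∈ perfectClosure k l := by
      rw [mem_perfectClosure_iff_natSepDegree_eq_one,
        natSepDegree_eq_of_splits _ (Normal.splits (F := k) inferInstance c), Finset.card_eq_one]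
      refine ⟨c, Finset.eq_singleton_iff_unique_mem.2 ⟨?_, fun t ht => ?_⟩⟩
      · rw [Multiset.mem_toFinset, mem_aroots]
        exact ⟨minpoly.ne_zero hci, minpoly.aeval k c⟩
      · rw [Multiset.mem_toFinset, mem_aroots] at ht
        obtain ⟨σ, rfl⟩ := minpoly.exists_algEquiv_of_root' hci.isAlgebraic ht.2
        exact hc σ
    rw [h, IntermediateField.mem_bot] at this
    exact this
  obtain ⟨g, hg⟩ := hq
  have hgs : g.Separable := by
    rw [← separable_map (algebraMap k l), ← coe_mapRingHom, hg]
    exact separable_prod_X_sub_C_iff'.2 fun _ _ _ _ h => h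
  refine hgs.of_dvd (minpoly.dvd k x ?_)
  rw [aeval_def, ← eval_map, ← coe_mapRingHom, hg, eval_prod]
  exact Finset.prod_eq_zero ((hT x).2 (minpoly.aeval k x)) (by simp)

variable {R O : Type*} [CommRing R] [IsLocalRing R] [CommRing O] [IsLocalRing O] [Algebra R O]
  [Algebra.IsIntegral R O]

instance isIntegral_residueField [IsLocalHom (algebraMap R O)] :
    Algebra.IsIntegral (ResidueField R) (ResidueField O) := by
  refine ⟨fun x => ?_⟩
  obtain ⟨x, rfl⟩ := residue_surjective x
  obtain ⟨f, hf, hfx⟩ := Algebra.IsIntegral.isIntegral (R := R) x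
  refine ⟨f.map (residue R), hf.map _, ?_⟩
  rw [eval₂_map]
  have := congrArg (residue O) hfx
  rwa [hom_eval₂, map_zero] at this

omit [Algebra.IsIntegral R O] in
theorem residue_aeval [IsLocalHom (algebraMap R O)] (y : O) (g : R[X]) :
    residue O (aeval y g) = aeval (residue O y) (g.map (residue R)) := by
  rw [aeval_def, hom_eval₂, aeval_def, eval₂_map]
  rfl

theorem exists_monic_lift_of_isSeparable [IsLocalHom (algebraMap R O)] {y : O}
    (hy : IsSeparable (ResidueField R) (residue O y)) :
    ∃ g : R[X], g.Monic ∧ (g.map (residue R)).Separable ∧ aeval y g ∈ maximalIdeal O := by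
  have hm := minpoly.monic (Algebra.IsIntegral.isIntegral (R := ResidueField R) (residue O y))
  obtain ⟨g, hg, -, hgm⟩ := lifts_and_natDegree_eq_and_monic
    ((mem_lifts _).2 (map_surjective _ residue_surjective _)) hm
  refine ⟨g, hgm, hg ▸ hy, ?_⟩
  rw [← residue_eq_zero_iff, residue_aeval, hg, minpoly.aeval]

theorem isSeparable_residue_of_normal {p : ℕ} [ExpChar (ResidueField R) p]
    [IsLocalHom (algebraMap R O)]
    (hn : ∀ y : O, ∃ f : R[X], f.Monic ∧ aeval y f = 0 ∧ (f.map (algebraMap R O)).Splits)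
    (hp : ∀ (y : O) (n : ℕ) (a : R), y ^ p ^ n - algebraMap R O a ∈ maximalIdeal O →
      ∃ b : R, y - algebraMap R O b ∈ maximalIdeal O) (y : O) :
    IsSeparable (ResidueField R) (residue O y) := by
  have : Normal (ResidueField R) (ResidueField O) := by
    refine normal_iff.2 fun x => ⟨Algebra.IsIntegral.isIntegral x, ?_⟩
    obtain ⟨x, rfl⟩ := residue_surjective x
    obtain ⟨f, hf, hfx, hfs⟩ := hn x
    have h1 : ((f.map (residue R)).map (algebraMap (ResidueField R) (ResidueField O))).Splits := by
      have := hfs.map (residue O)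
      rw [Polynomial.map_map] at this ⊢
      exact this
    refine h1.of_dvd ?_ (Polynomial.map_dvd _ (minpoly.dvd _ _ ?_))
    · exact ((hf.map _).map _).ne_zero
    · rw [← residue_aeval, hfx, map_zero]
  refine isSeparable_of_normal (eq_bot_iff.2 fun x hx => ?_) _
  obtain ⟨x, rfl⟩ := residue_surjective x
  obtain ⟨n, a, ha⟩ := (mem_perfectClosure_iff_pow_mem p).1 hx
  obtain ⟨a, rfl⟩ := residue_surjective a
  obtain ⟨b, hb⟩ := hp x n a (by
    rw [← residue_eq_zero_iff, map_sub, map_pow, sub_eq_zero, ← ha]; rfl)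
  rw [← residue_eq_zero_iff, map_sub, sub_eq_zero] at hb
  exact IntermediateField.mem_bot.2 ⟨residue R b, hb.symm⟩

end Separable

section SeparableRoots

open Polynomial

variable {R : Type*} [CommRing R] [IsDomain R] [IsDiscreteValuationRing R]
  [IsAdicComplete (maximalIdeal R) R] {E : Type*} [Field E] [Algebra R E] [FaithfulSMul R E]

omit [IsDomain R] [IsDiscreteValuationRing R] [IsAdicComplete (maximalIdeal R) R]
  [FaithfulSMul R E] in
theorem coe_aeval_integralClosure (y : integralClosure R E) (g : R[X]) :
    ((aeval y g : integralClosure R E) : E) = aeval (y : E) g :=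
  (aeval_algHom_apply (integralClosure R E).val y g).symm

/-- A polynomial vanishing at `s` whose reduction is separable has a unit derivative at `s`. -/
theorem not_isSmall_derivative {g : R[X]} (hs : (g.map (residue R)).Separable) {s : E}
    (hi : IsIntegral R s) (h : IsSmall R (aeval s g)) : ¬IsSmall R (aeval s (derivative g)) := by
  intro h'
  obtain ⟨a, b, hab⟩ := hs
  obtain ⟨a, rfl⟩ := map_surjective _ residue_surjective a
  obtain ⟨b, rfl⟩ := map_surjective _ residue_surjective b
  let O := integralClosure R E
  let y : O := ⟨s, hi⟩
  have hy : ∀ f : R[X], IsSmall R (aeval s f) ↔ residue O (aeval y f) = 0 := by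
    intro f
    rw [show s = (y : E) from rfl, ← coe_aeval_integralClosure, isSmall_coe, integralMaximalIdeal_eq, residue_eq_zero_iff]
  rw [hy, residue_aeval] at h h'
  rw [← derivative_map] at h'
  have := congrArg (aeval (residue O y)) hab
  rw [map_add, map_mul, map_mul, h, h', mul_zero, mul_zero, add_zero, map_one] at this
  exact zero_ne_one this

/-- Distinct roots of a polynomial with separable reduction are distinct modulo `𝔪`. -/
theorem eq_of_isSmall_sub {g : R[X]} (hs : (g.map (residue R)).Separable) {s t : E}
    (hsi : IsIntegral R s) (hti : IsIntegral R t)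
    (h1 : aeval s g = 0) (h2 : aeval t g = 0) (h : IsSmall R (s - t)) : s = t := by
  have h3 := not_isSmall_derivative hs hsi (h1 ▸ isSmall_zero)
  let O := integralClosure R E
  let s' : O := ⟨s, hsi⟩
  let t' : O := ⟨t, hti⟩
  have hy : ∀ (f : R[X]) (y : O), ((aeval y f : O) : E) = aeval (y : E) f := fun f y =>
    coe_aeval_integralClosure y f
  have key := IsLocalRing.eq_of_eval_eq_zero_of_not_isUnit_sub (f := g.map (algebraMap R O))
    (a := s') (b := t') ?_ ?_ ?_ ?_
  · exact congrArg Subtype.val key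
  · rw [eval_map_algebraMap]; exact Subtype.ext ((hy g s').trans h1)
  · rw [eval_map_algebraMap]; exact Subtype.ext ((hy g t').trans h2)
  · have : s' - t' ∈ integralMaximalIdeal R E := isSmall_coe.1 h
    rwa [integralMaximalIdeal_eq, mem_maximalIdeal] at this
  · rw [derivative_map, eval_map_algebraMap]
    by_contra hu
    rw [← mem_nonunits_iff, ← mem_maximalIdeal, ← integralMaximalIdeal_eq, ← isSmall_coe, hy] at hu
    exact h3 hu

theorem separable_map_of_residue (F : Type*) [Field F] [Algebra R F] [IsFractionRing R F] {g : R[X]}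
    (hg : g.Monic) (hs : (g.map (residue R)).Separable) : (g.map (algebraMap R F)).Separable := by
  have : FaithfulSMul R (AlgebraicClosure F) := faithfulSMul_of_isFractionRing R F
  rw [Separable, isCoprime_iff_aeval_ne_zero_of_isAlgClosed F (AlgebraicClosure F)]
  intro a
  by_contra! h
  rw [derivative_map, aeval_map_algebraMap, aeval_map_algebraMap] at h
  exact not_isSmall_derivative hs ⟨g, hg, h.1⟩ (h.1 ▸ isSmall_zero) (h.2 ▸ isSmall_zero)

omit [FaithfulSMul R E] in
theorem splits_of_residue_separable (F : Type*) [Field F] [Algebra R F] [IsFractionRing R F]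
    [Algebra F E] [IsScalarTower R F E] [IsSepClosed E] {g : R[X]}
    (hg : g.Monic) (hs : (g.map (residue R)).Separable) : (g.map (algebraMap R E)).Splits := by
  have := IsSepClosed.splits_codomain (f := algebraMap F E) _ (separable_map_of_residue F hg hs)
  rwa [Polynomial.map_map, ← IsScalarTower.algebraMap_eq] at this

/-- The value g(y) is the product of the differences y - s over the roots s, and the maximal ideal
is prime. -/
theorem exists_root_of_isSmall_aeval {g : R[X]} (hg : g.Monic)
    (hsp : (g.map (algebraMap R E)).Splits) {y : E} (hy : IsIntegral R y)
    (h : IsSmall R (aeval y g)) : ∃ s, aeval s g = 0 ∧ IsSmall R (y - s) := by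
  have hg' := hsp.eq_prod_roots
  rw [(hg.map _).leadingCoeff, C_1, one_mul] at hg'
  have hroot : ∀ s ∈ (g.map (algebraMap R E)).roots, aeval s g = 0 := by
    intro s hs
    have := isRoot_of_mem_roots hs
    rwa [IsRoot, eval_map_algebraMap] at this
  by_contra! hc
  have key : IsIntegral R (aeval y g) ∧ ¬IsSmall R (aeval y g) := by
    rw [← eval_map_algebraMap, hg', eval_multiset_prod, Multiset.map_map]
    refine Multiset.prod_induction (fun z => IsIntegral R z ∧ ¬IsSmall R z) _ ?_ ?_ ?_
    · rintro a b ⟨ha, ha'⟩ ⟨hb, hb'⟩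
      exact ⟨ha.mul hb, fun h => (h.of_mul ha).elim ha' hb'⟩
    · exact ⟨isIntegral_one, not_isSmall_one⟩
    · intro z hz
      obtain ⟨s, hs, rfl⟩ := Multiset.mem_map.1 hz
      simp only [Function.comp_apply, eval_sub, eval_X, eval_C]
      exact ⟨hy.sub ⟨g, hg, hroot s hs⟩, hc s (hroot s hs)⟩
  exact key.2 h

end SeparableRoots

/-! ### Unramified extensions: the uniformizer generates the maximal ideal. -/

section Trace

variable {R : Type*} [CommRing R] [IsDomain R] [IsDiscreteValuationRing R]
  [IsAdicComplete (maximalIdeal R) R] {π : R} (hπ : Irreducible π)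
  {F : Type*} [Field F] [Algebra R F] [IsFractionRing R F]

include hπ in
theorem exists_eq_uniformizer_mul_of_isSmall {x : F} (hx : IsSmall R x) :
    ∃ a : R, x = algebraMap R F (π * a) := by
  have : FaithfulSMul R F := faithfulSMul_of_isFractionRing R F
  obtain ⟨a, rfl⟩ := IsIntegrallyClosed.isIntegral_iff.1 hx.isIntegral
  rw [IsSmall.algebraMap_iff, hπ.maximalIdeal_eq, Ideal.mem_span_singleton] at hx
  obtain ⟨b, rfl⟩ := hx
  exact ⟨b, rfl⟩

variable {R' E E' : Type*} [CommRing R'] [Field E] [Field E'] [Algebra R' E] [Algebra R' E']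

theorem IsSmall.map {R : Type*} [CommRing R] [IsDomain R] [IsDiscreteValuationRing R]
    [IsAdicComplete (maximalIdeal R) R] [Algebra R E] [Algebra R E'] [FaithfulSMul R E]
    [FaithfulSMul R E'] (f : E →ₐ[R] E') {x : E} : IsSmall R (f x) ↔ IsSmall R x := by
  obtain ⟨π, hπ⟩ := IsDiscreteValuationRing.exists_irreducible R
  rw [isSmall_iff hπ, isSmall_iff hπ]
  constructor
  · rintro ⟨n, z, hz, h⟩
    have hπ0 : algebraMap R E π ≠ 0 :=
      (map_ne_zero_iff _ (FaithfulSMul.algebraMap_injective R E)).2 hπ.ne_zero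
    refine ⟨n, x ^ n / algebraMap R E π, ?_, by rw [mul_div_cancel₀ _ hπ0]⟩
    rw [← isIntegral_algHom_iff f f.toRingHom.injective]
    have : f (x ^ n / algebraMap R E π) = z := by
      rw [map_div₀, map_pow, h, f.commutes, mul_div_cancel_left₀]
      exact (map_ne_zero_iff _ (FaithfulSMul.algebraMap_injective R E')).2 hπ.ne_zero
    rwa [this]
  · rintro ⟨n, z, hz, h⟩
    exact ⟨n, f z, hz.map f, by rw [← map_pow, h, map_mul, f.commutes]⟩

include hπ in
/-- If every nontrivial automorphism acts nontrivially on the residue field, then the elements of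
the maximal ideal are divisible by the uniformizer. -/
theorem isIntegral_div_of_isSmall_of_faithful {M : Type*} [Field M] [Algebra R M] [Algebra F M]
    [IsScalarTower R F M] [FiniteDimensional F M] [IsGalois F M]
    (h : ∀ τ : M ≃ₐ[F] M, τ ≠ 1 → ∃ β, IsIntegral R β ∧ ¬IsSmall R (τ β - β)) {x : M}
    (hx : IsSmall R x) : IsIntegral R (x / algebraMap R M π) := by
  classical
  have : FaithfulSMul R M := faithfulSMul_of_isFractionRing R F
  have hFi : FaithfulSMul R F := faithfulSMul_of_isFractionRing R F
  have hτ : ∀ (τ : M ≃ₐ[F] M) {y : M}, IsIntegral R y → IsIntegral R (τ y) :=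
    fun τ y hy => hy.map (τ.toAlgHom.restrictScalars R)
  have h' : ∀ τ : M ≃ₐ[F] M, ∃ β u, IsIntegral R β ∧ IsIntegral R u ∧
      (τ ≠ 1 → u * (β - τ β) = 1) := by
    intro τ
    by_cases hτ1 : τ = 1
    · exact ⟨0, 0, isIntegral_zero, isIntegral_zero, fun h => (h hτ1).elim⟩
    obtain ⟨β, hβ, hβ'⟩ := h τ hτ1
    obtain ⟨h0, hi⟩ := (isSmall_or_isIntegral_inv ((hτ τ hβ).sub hβ)).resolve_left hβ'
    refine ⟨β, -(τ β - β)⁻¹, hβ, hi.neg, fun _ => ?_⟩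
    field_simp
    ring
  choose β u hβ hu huβ using h'
  have hπ0 : algebraMap R M π ≠ 0 :=
    (map_ne_zero_iff _ (FaithfulSMul.algebraMap_injective R M)).2 hπ.ne_zero
  -- For s the set of nontrivial automorphisms and z = 1, the factor σ = τ kills every term with τ ≠
  -- 1, while the product at τ = 1 equals 1: the sum is x itself. Expanding one factor at a time,
  -- with z absorbing β σ, reduces to traces.
  have key : ∀ (s : Finset (M ≃ₐ[F] M)) (z : M), IsIntegral R z →
      IsIntegral R ((∑ τ : M ≃ₐ[F] M, τ (z * x) * ∏ σ ∈ s, u σ * (τ (β σ) - σ (β σ))) /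
        algebraMap R M π) := by
    intro s
    induction s using Finset.induction_on with
    | empty =>
      intro z hz
      simp only [Finset.prod_empty, mul_one]
      rw [← trace_eq_sum_automorphisms]
      -- The trace is a small element of F, so it belongs to πR.
      have hs : IsSmall R (Algebra.trace F M (z * x)) := by
        rw [← IsSmall.map (IsScalarTower.toAlgHom R F M)]
        change IsSmall R (algebraMap F M _)
        rw [trace_eq_sum_automorphisms]
        refine isSmall_sum fun τ _ => ?_
        exact (IsSmall.map (τ.toAlgHom.restrictScalars R)).2 (hx.mul_left hz)
      obtain ⟨a, ha⟩ := exists_eq_uniformizer_mul_of_isSmall hπ hs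
      rw [ha, ← IsScalarTower.algebraMap_apply, map_mul, mul_div_cancel_left₀ _ hπ0]
      exact isIntegral_algebraMap
    | insert σ s hσ ih =>
      intro z hz
      have h1 := ((ih (z * β σ) (hz.mul (hβ σ))).sub ((hτ σ (hβ σ)).mul (ih z hz)))
      have h2 := (hu σ).mul h1
      convert! h2 using 1
      rw [← mul_div_assoc, ← sub_div, ← mul_div_assoc]
      congr 1
      rw [Finset.mul_sum, ← Finset.sum_sub_distrib, Finset.mul_sum]
      refine Finset.sum_congr rfl fun τ _ => ?_
      rw [Finset.prod_insert hσ]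
      simp only [map_mul]
      ring
  have := key (Finset.univ.erase 1) 1 isIntegral_one
  rw [Finset.sum_eq_single 1] at this
  · rw [Finset.prod_eq_one, mul_one, one_mul] at this
    · exact this
    · intro σ hσ
      exact huβ σ (Finset.ne_of_mem_erase hσ)
  · intro τ _ hτ1
    rw [Finset.prod_eq_zero (Finset.mem_erase.2 ⟨hτ1, Finset.mem_univ τ⟩), mul_zero]
    rw [sub_self, mul_zero]
  · intro h
    exact absurd (Finset.mem_univ _) h

end Trace

section Inertia

open Polynomial

variable {R : Type*} [CommRing R] [IsDomain R] [IsDiscreteValuationRing R]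
  [IsAdicComplete (maximalIdeal R) R] {π : R} (hπ : Irreducible π)
  {F E : Type*} [Field F] [Algebra R F] [IsFractionRing R F] [Field E] [Algebra R E] [Algebra F E]
  [IsScalarTower R F E]

omit [IsDomain R] [IsDiscreteValuationRing R] [IsAdicComplete (maximalIdeal R) R]
  [IsFractionRing R F] in
theorem IsIntegral.algEquiv (σ : E ≃ₐ[F] E) {y : E} (hy : IsIntegral R y) : IsIntegral R (σ y) :=
  hy.map (σ.toAlgHom.restrictScalars R)

theorem IsSmall.algEquiv (σ : E ≃ₐ[F] E) {y : E} (hy : IsSmall R y) : IsSmall R (σ y) :=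
  have : FaithfulSMul R E := faithfulSMul_of_isFractionRing R F
  (IsSmall.map (σ.toAlgHom.restrictScalars R)).2 hy

omit [IsDomain R] [IsDiscreteValuationRing R] [IsAdicComplete (maximalIdeal R) R]
  [IsFractionRing R F] in
theorem aeval_algEquiv_eq_zero (σ : E ≃ₐ[F] E) {y : E} {g : R[X]} (h : aeval y g = 0) :
    aeval (σ y) g = 0 := by
  have := aeval_algHom_apply (σ.toAlgHom.restrictScalars R) y g
  rw [h, map_zero] at this
  exact this

theorem inertiaGroup_fixes_root {g : R[X]} (hg : g.Monic) (hs : (g.map (residue R)).Separable)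
    {s : E} (h : aeval s g = 0) {σ : E ≃ₐ[F] E} (hσ : σ ∈ inertiaGroup R F E) : σ s = s := by
  have : FaithfulSMul R E := faithfulSMul_of_isFractionRing R F
  have hsi : IsIntegral R s := ⟨g, hg, h⟩
  exact eq_of_isSmall_sub hs (hsi.algEquiv σ) hsi (aeval_algEquiv_eq_zero σ h) h
    (mem_inertiaGroup_iff.1 hσ s hsi)

variable (R F E) in
/-- The subextension generated by the roots of the monic polynomials with separable reduction. -/
def unramifiedField : IntermediateField F E :=
  IntermediateField.adjoin F
    {s | ∃ g : R[X], g.Monic ∧ (g.map (residue R)).Separable ∧ aeval s g = 0}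

/-- Over a perfect residue field every integral y is congruent to a root s of a monic polynomial
with separable reduction. An automorphism fixing s moves y only within its residue class. -/
theorem fixingSubgroup_unramifiedField_le [PerfectField (ResidueField R)] [IsSepClosure F E] :
    (unramifiedField R F E).fixingSubgroup ≤ inertiaGroup R F E := by
  have : FaithfulSMul R E := faithfulSMul_of_isFractionRing R F
  have : IsSepClosed E := IsSepClosure.sep_closed F
  intro σ hσ
  rw [mem_inertiaGroup_iff]
  intro y hy
  obtain ⟨g, hg, hgs, hgy⟩ := exists_monic_lift_of_isSeparable (R := R)
    (y := (⟨y, hy⟩ : integralClosure R E)) (Algebra.IsSeparable.isSeparable _ _)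
  have hgy' : IsSmall R (aeval y g) := by
    rwa [← integralMaximalIdeal_eq, ← isSmall_coe, coe_aeval_integralClosure] at hgy
  obtain ⟨s, hs, hys⟩ := exists_root_of_isSmall_aeval hg (splits_of_residue_separable F hg hgs)
    hy hgy'
  have hσs : σ s = s := (IntermediateField.mem_fixingSubgroup_iff _ _).1 hσ s
    (IntermediateField.subset_adjoin _ _ ⟨g, hg, hgs, hs⟩)
  have := (hys.algEquiv σ).sub hys
  rwa [map_sub, hσs, sub_sub_sub_cancel_right] at this

include hπ in
-- The element lies in a finite Galois splitting field of polynomials with separable reduction. A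
-- nontrivial automorphism moves one of the roots, and distinct roots stay distinct in the residue
-- field, so `isIntegral_div_of_isSmall_of_faithful` applies.
theorem isIntegral_div_of_mem_unramifiedField [IsSepClosure F E] {x : E}
    (hx : x ∈ unramifiedField R F E) (hxs : IsSmall R x) :
    IsIntegral R (x / algebraMap R E π) := by
  classical
  have : FaithfulSMul R E := faithfulSMul_of_isFractionRing R F
  have : IsSepClosed E := IsSepClosure.sep_closed F
  obtain ⟨T, hT, hxT⟩ := IntermediateField.exists_finset_of_mem_adjoin hx
  have hT' : ∀ t : T, ∃ g : R[X], g.Monic ∧ (g.map (residue R)).Separable ∧ aeval (t : E) g = 0 :=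
    fun t => hT t.2
  choose g hg hgs hgt using hT'
  let G : F[X] := ∏ t : T, (g t).map (algebraMap R F)
  have hG0 : G ≠ 0 := (monic_prod_of_monic _ _ fun t _ => (hg t).map _).ne_zero
  have hGs : (G.map (algebraMap F E)).Splits := by
    rw [Polynomial.map_prod]
    refine Splits.prod fun t _ => ?_
    rw [Polynomial.map_map, ← IsScalarTower.algebraMap_eq]
    exact splits_of_residue_separable F (hg t) (hgs t)
  let M := IntermediateField.adjoin F (G.rootSet E)
  have hGM : IsSplittingField F M G := IntermediateField.adjoin_rootSet_isSplittingField hGs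
  have : FiniteDimensional F M := IsSplittingField.finiteDimensional M G
  have : Normal F M := Normal.of_isSplittingField G
  have : IsGalois F M := ⟨⟩
  have : FaithfulSMul R M := faithfulSMul_of_isFractionRing R F
  have hxM : x ∈ M := by
    refine IntermediateField.adjoin.mono F _ _ (fun t ht => ?_) hxT
    rw [mem_rootSet_of_ne hG0, map_prod]
    refine Finset.prod_eq_zero (Finset.mem_univ (⟨t, ht⟩ : T)) ?_
    rw [aeval_map_algebraMap]
    exact hgt ⟨t, ht⟩
  have key := isIntegral_div_of_isSmall_of_faithful hπ (F := F) (M := M) ?_ (x := ⟨x, hxM⟩)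
    ((IsSmall.map (M.val.restrictScalars R)).1 hxs)
  · exact key.map (M.val.restrictScalars R)
  intro τ hτ
  by_contra! hc
  refine hτ (AlgEquiv.coe_toAlgHom_injective ?_)
  refine AlgHom.ext_of_adjoin_eq_top (IsSplittingField.adjoin_rootSet M G) fun β hβ => ?_
  rw [mem_rootSet_of_ne hG0, map_prod, Finset.prod_eq_zero_iff] at hβ
  obtain ⟨t, -, ht⟩ := hβ
  rw [aeval_map_algebraMap] at ht
  have hβi : IsIntegral R β := ⟨g t, hg t, ht⟩
  exact eq_of_isSmall_sub (hgs t) (hβi.algEquiv τ) hβi (aeval_algEquiv_eq_zero τ ht) ht (hc β hβi)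

include hπ in
/-- When the residue field is perfect, an element of the maximal ideal which is fixed by the
inertia group is divisible by the uniformizer. -/
theorem isIntegral_div_of_fixed [PerfectField (ResidueField R)] [IsSepClosure F E] {x : E} (hx : ∀ σ ∈ inertiaGroup R F E, σ x = x)
    (hxs : IsSmall R x) : IsIntegral R (x / algebraMap R E π) := by
  refine isIntegral_div_of_mem_unramifiedField hπ (F := F) ?_ hxs
  rw [← InfiniteGalois.fixedField_fixingSubgroup (unramifiedField R F E)]
  exact fun σ => hx σ (fixingSubgroup_unramifiedField_le σ.2)

end Inertia

/-! ### Comparison of A with A^g, and residue fields fixed by inertia. -/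

section Comparison

open Polynomial

theorem IsSmall.sub_of_pow_sub {R : Type*} [CommRing R] [IsDomain R] [IsDiscreteValuationRing R]
    [IsAdicComplete (maximalIdeal R) R] {p : ℕ} [Fact p.Prime] [CharP (ResidueField R) p]
    {E : Type*} [Field E] [Algebra R E] [FaithfulSMul R E] {x y : E}
    (hx : IsIntegral R x) (hy : IsIntegral R y) (h : IsSmall R (x ^ p - y ^ p)) :
    IsSmall R (x - y) := by
  let O := integralClosure R E
  have : CharP (ResidueField O) p := by
    rw [CharP.charP_iff_prime_eq_zero Fact.out, ← map_natCast (residue O), residue_eq_zero_iff,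
      ← integralMaximalIdeal_eq, ← isSmall_coe]
    exact IsSmall.natCast
  let x' : O := ⟨x, hx⟩
  let y' : O := ⟨y, hy⟩
  change IsSmall R ((x' - y' : O) : E)
  replace h : IsSmall R ((x' ^ p - y' ^ p : O) : E) := h
  rw [isSmall_coe, integralMaximalIdeal_eq, ← residue_eq_zero_iff] at h ⊢
  rw [map_sub, map_pow, map_pow, ← sub_pow_char] at h
  exact eq_zero_of_pow_eq_zero h

variable {A : Type*} [CommRing A] [IsDomain A] [IsDiscreteValuationRing A]
  [IsAdicComplete (maximalIdeal A) A]
  {Ag : Type*} [CommRing Ag] [IsDomain Ag] [IsDiscreteValuationRing Ag]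
  [IsAdicComplete (maximalIdeal Ag) Ag] [Algebra A Ag]
  {π : A} (hπ : Irreducible π) (hπg : Irreducible (algebraMap A Ag π))
  {K E L : Type*} [Field K] [Algebra A K] [IsFractionRing A K] [Field E] [Field L]
  [Algebra A E] [Algebra K E] [IsScalarTower A K E] [Algebra.IsSeparable K E]
  [Algebra A L] [Algebra Ag L] [IsScalarTower A Ag L] [FaithfulSMul Ag L]
  [Algebra E L] [IsScalarTower A E L]

omit [IsDomain A] [IsDiscreteValuationRing A] [IsAdicComplete (maximalIdeal A) A] [IsDomain Ag]
  [IsDiscreteValuationRing Ag] [IsAdicComplete (maximalIdeal Ag) Ag] [FaithfulSMul Ag L] in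
theorem IsIntegral.algebraMap_tower {x : E} (hx : IsIntegral A x) :
    IsIntegral Ag (algebraMap E L x) :=
  (hx.map (IsScalarTower.toAlgHom A E L)).tower_top

include hπ hπg

theorem IsSmall.algebraMap_tower [FaithfulSMul A E] {x : E} (hx : IsSmall A x) :
    IsSmall Ag (algebraMap E L x) := by
  obtain ⟨n, z, hz, h⟩ := (isSmall_iff hπ).1 hx
  refine (isSmall_iff hπg).2 ⟨n, _, hz.algebraMap_tower, ?_⟩
  rw [← map_pow, h, map_mul, ← IsScalarTower.algebraMap_apply, ← IsScalarTower.algebraMap_apply]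

include K

/-- Otherwise the inverse of x is small in E, hence in L, and multiplying it by the integral image
of x would make 1 small. -/
theorem isIntegral_of_algebraMap_tower {x : E} (hx : IsIntegral Ag (algebraMap E L x)) :
    IsIntegral A x := by
  have : FaithfulSMul A E := faithfulSMul_of_isFractionRing A K
  by_cases hx0 : x = 0
  · exact hx0 ▸ isIntegral_zero
  refine (isIntegral_or_isSmall_inv A K x).resolve_right fun h => ?_
  have h1 := (h.algebraMap_tower hπ hπg (Ag := Ag) (L := L)).mul_right hx
  rw [← map_mul, inv_mul_cancel₀ hx0, map_one] at h1
  exact not_isSmall_one h1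

theorem isSmall_of_algebraMap_tower {x : E} (hx : IsSmall Ag (algebraMap E L x)) :
    IsSmall A x := by
  have : FaithfulSMul A E := faithfulSMul_of_isFractionRing A K
  have hi := isIntegral_of_algebraMap_tower (K := K) hπ hπg hx.isIntegral
  refine (isSmall_or_isIntegral_inv hi).resolve_right fun ⟨hx0, h⟩ => ?_
  have h1 := hx.mul_right (h.algebraMap_tower (Ag := Ag) (L := L))
  rw [← map_mul, mul_inv_cancel₀ hx0, map_one] at h1
  exact not_isSmall_one h1

end Comparison

section ResidueExtension

open Polynomial

theorem aeval_mk_eq_zero {A : Type*} [CommRing A] [IsDomain A] [IsDiscreteValuationRing A]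
    {Ag : Type*} [CommRing Ag] [Algebra A Ag] {π : A} (hπ : Irreducible π) {c : Ag} {g : A[X]}
    (h : algebraMap A Ag π ∣ aeval c g) :
    aeval (Ideal.Quotient.mk (extendedIdeal A Ag) c) g = 0 := by
  rw [← mem_extendedIdeal_iff hπ, ← Ideal.Quotient.eq_zero_iff_mem] at h
  rw [← h]
  exact aeval_algHom_apply (Ideal.Quotient.mkₐ A (extendedIdeal A Ag)) c g

theorem aeval_sub_aeval_dvd {R S : Type*} [CommRing R] [CommRing S] [Algebra R S] (x y : S)
    (g : R[X]) : x - y ∣ aeval x g - aeval y g := by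
  rw [← eval_map_algebraMap, ← eval_map_algebraMap]
  exact sub_dvd_eval_sub _ _ _

variable {p : ℕ} [Fact p.Prime]
  {A : Type u} [CommRing A] [IsDomain A] [IsDiscreteValuationRing A]
  [IsAdicComplete (maximalIdeal A) A] [CharP (ResidueField A) p]
  {Ag : Type u} [CommRing Ag] [IsDomain Ag] [IsDiscreteValuationRing Ag]
  [IsAdicComplete (maximalIdeal Ag) Ag] [Algebra A Ag]
  (hAg : IsGenericResidualPerfection p A Ag) [PerfectField (ResidueField Ag)]
  {π : A} (hπ : Irreducible π) (hπg : Irreducible (algebraMap A Ag π))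
  {K Kg E L : Type*} [Field K] [Algebra A K] [IsFractionRing A K] [Field E] [Field L]
  [Algebra A E] [Algebra K E] [IsScalarTower A K E] [Algebra.IsSeparable K E]
  [Field Kg] [Algebra Ag Kg] [IsFractionRing Ag Kg]
  [Algebra Kg L] [IsSepClosure Kg L]
  [Algebra A L] [Algebra Ag L] [IsScalarTower A Ag L] [IsScalarTower Ag Kg L]
  [Algebra E L] [IsScalarTower A E L]

include hπ hπg K hAg

/-- Let `b` be an element of the valuation ring of `E` fixed by the inertia group over `Ag`. If a
`p`-th power of `b` lies in the residue field of `A`, then so does `b`. -/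
theorem exists_isSmall_sub_of_pow {b : E} (hb : IsIntegral A b)
    (hfix : ∀ σ ∈ inertiaGroup Ag Kg L, σ (algebraMap E L b) = algebraMap E L b) {a : A}
    (h : IsSmall A (b ^ p - algebraMap A E a)) : ∃ a', IsSmall A (b - algebraMap A E a') := by
  have : FaithfulSMul A E := faithfulSMul_of_isFractionRing A K
  have : FaithfulSMul Ag L := faithfulSMul_of_isFractionRing Ag Kg
  by_cases hap : ∃ c, residue A a = c ^ p
  · obtain ⟨c, hc⟩ := hap
    obtain ⟨c, rfl⟩ := residue_surjective c
    refine ⟨c, IsSmall.sub_of_pow_sub (p := p) hb isIntegral_algebraMap ?_⟩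
    have h1 : IsSmall A (algebraMap A E (a - c ^ p)) := by
      rw [IsSmall.algebraMap_iff, ← residue_eq_zero_iff, map_sub, hc, map_pow, sub_self]
    have := h.add h1
    rwa [map_sub, map_pow, sub_add_sub_cancel] at this
  exfalso
  push Not at hap
  set ϖ : Ag := algebraMap A Ag π with hϖ
  have hϖ0 : algebraMap Ag L ϖ ≠ 0 :=
    (map_ne_zero_iff _ (FaithfulSMul.algebraMap_injective Ag L)).2 hπg.ne_zero
  have hpϖ : ϖ ∣ (p : Ag) := (mem_extendedIdeal_iff hπ).1 (natCast_mem_extendedIdeal Ag)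
  have hcharg : CharP (ResidueField Ag) p := by
    rw [CharP.charP_iff_prime_eq_zero Fact.out, ← map_natCast (residue Ag), residue_eq_zero_iff,
      hπg.maximalIdeal_eq, Ideal.mem_span_singleton]
    exact hpϖ
  -- the approximate `p`-th root of `a` in `Ag`
  obtain ⟨b₀, c, hbc⟩ : ∃ b₀ c : Ag, algebraMap A Ag a = b₀ ^ p + ϖ * c := by
    obtain ⟨x, hx⟩ := hAg.1.perfect.2 (algebraMap A _ a)
    obtain ⟨x, rfl⟩ := Ideal.Quotient.mk_surjective x
    have : algebraMap A Ag a - x ^ p ∈ extendedIdeal A Ag := by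
      rw [← Ideal.Quotient.mk_eq_mk_iff_sub_mem, map_pow]
      exact hx.symm
    obtain ⟨c, hc⟩ := (mem_extendedIdeal_iff hπ).1 this
    exact ⟨x, c, by linear_combination hc⟩
  set β : L := algebraMap E L b
  have hβ : IsIntegral Ag β := hb.algebraMap_tower
  set β₀ : L := algebraMap Ag L b₀
  have hβ₀ : IsIntegral Ag β₀ := isIntegral_algebraMap
  have haL : algebraMap A L a = β₀ ^ p + algebraMap Ag L ϖ * algebraMap Ag L c := by
    rw [IsScalarTower.algebraMap_apply A Ag L, hbc]
    simp [β₀]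
  have h1 : IsSmall Ag (β - β₀) := by
    refine IsSmall.sub_of_pow_sub (p := p) hβ hβ₀ ?_
    have h2 := h.algebraMap_tower hπ hπg (Ag := Ag) (L := L)
    rw [map_sub, map_pow, ← IsScalarTower.algebraMap_apply, haL] at h2
    have h3 := h2.add (isSmall_uniformizer_mul hπg (z := algebraMap Ag L c) isIntegral_algebraMap)
    convert! h3 using 1
    ring
  -- Both β and β₀ are fixed by inertia, which upgrades a congruence modulo the maximal ideal of the
  -- integral closure to one modulo ϖ.
  have h2 : IsIntegral Ag ((β - β₀) / algebraMap Ag L ϖ) := by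
    refine isIntegral_div_of_fixed hπg (F := Kg) (fun σ hσ => ?_) h1
    rw [map_sub, hfix σ hσ, show β₀ = algebraMap Kg L (algebraMap Ag Kg b₀) from
      IsScalarTower.algebraMap_apply Ag Kg L b₀, σ.commutes]
  obtain ⟨e, he, hβe⟩ : ∃ e, IsIntegral Ag e ∧ β ^ p - β₀ ^ p = algebraMap Ag L ϖ ^ 2 * e := by
    obtain ⟨e, he⟩ := sq_dvd_pow_sub_pow (p := p) (π := algebraMap Ag (integralClosure Ag L) ϖ)
      (x := ⟨β, hβ⟩) (y := ⟨β₀, hβ₀⟩)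
      (by simpa using map_dvd (algebraMap Ag (integralClosure Ag L)) hpϖ)
      ⟨⟨_, h2⟩, Subtype.ext (mul_div_cancel₀ _ hϖ0).symm⟩
    exact ⟨e, e.2, congrArg Subtype.val he⟩
  -- Since β^p ≡ β₀^p modulo ϖ², this element of E is congruent to c modulo ϖ. It is integral over
  -- A, so c would be algebraic over the residue field of A, against `aeval_ne_zero`.
  let w : E := (algebraMap A E a - b ^ p) / algebraMap A E π
  have hw : algebraMap E L w = algebraMap Ag L c - algebraMap Ag L ϖ * e := by
    have hπL : algebraMap E L (algebraMap A E π) = algebraMap Ag L ϖ := by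
      rw [← IsScalarTower.algebraMap_apply, hϖ, ← IsScalarTower.algebraMap_apply]
    rw [map_div₀, map_sub, map_pow, ← IsScalarTower.algebraMap_apply, hπL, div_eq_iff hϖ0, haL]
    linear_combination -hβe
  have hwi : IsIntegral A w := by
    refine isIntegral_of_algebraMap_tower (K := K) hπ hπg (L := L) (Ag := Ag) ?_
    rw [hw]
    exact isIntegral_algebraMap.sub (isIntegral_algebraMap.mul he)
  obtain ⟨g, hg, hgw⟩ := hwi
  refine hAg.aeval_ne_zero hπ hap hbc (hg.map (residue A)).ne_zero (aeval_mk_eq_zero hπ ?_)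
  rw [← hϖ, ← Ideal.mem_span_singleton, ← hπg.maximalIdeal_eq, ← IsSmall.algebraMap_iff (E := L)]
  have h4 : aeval (algebraMap E L w) g = 0 := by
    rw [aeval_algebraMap_apply]
    exact (congrArg (algebraMap E L) hgw).trans (map_zero _)
  have h5 : algebraMap Ag L (aeval c g) = aeval (algebraMap Ag L c) g :=
    (aeval_algebraMap_apply _ _ _).symm
  rw [h5]
  let c' : integralClosure Ag L := algebraMap Ag _ c
  let w' : integralClosure Ag L := ⟨algebraMap E L w, by
    rw [hw]; exact isIntegral_algebraMap.sub (isIntegral_algebraMap.mul he)⟩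
  obtain ⟨d, hd⟩ := aeval_sub_aeval_dvd c' w' (g.map (algebraMap A Ag))
  have hd' := congrArg Subtype.val hd
  rw [Subalgebra.coe_sub, Subalgebra.coe_mul, coe_aeval_integralClosure,
    coe_aeval_integralClosure, aeval_map_algebraMap, aeval_map_algebraMap, h4, sub_zero] at hd'
  change aeval (algebraMap Ag L c) g = _ at hd'
  rw [hd']
  refine IsSmall.mul_right ?_ d.2
  have : ((c' - w' : integralClosure Ag L) : L) = algebraMap Ag L ϖ * e := by
    change algebraMap Ag L c - algebraMap E L w = _
    rw [hw]; ring
  rw [this]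
  exact isSmall_uniformizer_mul hπg he

theorem exists_isSmall_sub_of_pow_pow {b : E} (hb : IsIntegral A b)
    (hfix : ∀ σ ∈ inertiaGroup Ag Kg L, σ (algebraMap E L b) = algebraMap E L b) {n : ℕ} {a : A}
    (h : IsSmall A (b ^ p ^ n - algebraMap A E a)) : ∃ a', IsSmall A (b - algebraMap A E a') := by
  induction n generalizing a with
  | zero => exact ⟨a, by simpa using h⟩
  | succ n ih =>
    obtain ⟨a', ha'⟩ := exists_isSmall_sub_of_pow hAg hπ hπg (K := K) (Kg := Kg) (L := L)
      (hb.pow (p ^ n)) (fun σ hσ => by rw [map_pow, map_pow, hfix σ hσ])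
      (by rwa [← pow_mul, ← pow_succ])
    exact ih ha'

end ResidueExtension

/-! ### The intersection of K^g with separable extensions of K. -/

section Descent

open Polynomial

variable {p : ℕ} [Fact p.Prime]
  {A : Type u} [CommRing A] [IsDomain A] [IsDiscreteValuationRing A]
  [IsAdicComplete (maximalIdeal A) A] [CharP (ResidueField A) p]
  {Ag : Type u} [CommRing Ag] [IsDomain Ag] [IsDiscreteValuationRing Ag]
  [IsAdicComplete (maximalIdeal Ag) Ag] [Algebra A Ag]
  (hAg : IsGenericResidualPerfection p A Ag) [PerfectField (ResidueField Ag)]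
  {π : A} (hπ : Irreducible π) (hπg : Irreducible (algebraMap A Ag π))
  {K Kg E L : Type*} [Field K] [Algebra A K] [IsFractionRing A K] [Field E] [Field L]
  [Algebra A E] [Algebra K E] [IsScalarTower A K E] [Algebra.IsSeparable K E]
  [Field Kg] [Algebra Ag Kg] [IsFractionRing Ag Kg]
  [Algebra Kg L] [IsSepClosure Kg L]
  [Algebra A L] [Algebra Ag L] [IsScalarTower A Ag L] [IsScalarTower Ag Kg L]
  [Algebra E L] [IsScalarTower A E L]

include hπ hπg K Kg hAg

/-- Coming from E, the element y is integral over A, so its residue is algebraic and thus purely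
inseparable over that of A. Elements of K^g are fixed by inertia, so `exists_isSmall_sub_of_pow_pow`
puts the residue in that of A. After subtracting a lift and dividing by π the hypothesis persists,
which allows iteration. -/
theorem exists_digit_of_algebraMap_eq {x : E} {y : Ag} (h : algebraMap E L x = algebraMap Ag L y) :
    ∃ (a : A) (x' : E) (y' : Ag), y = algebraMap A Ag a + algebraMap A Ag π * y' ∧
      algebraMap E L x' = algebraMap Ag L y' := by
  have : FaithfulSMul A E := faithfulSMul_of_isFractionRing A K
  have : FaithfulSMul Ag L := faithfulSMul_of_isFractionRing Ag Kg
  have hinj := FaithfulSMul.algebraMap_injective Ag L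
  have hx : IsIntegral A x := by
    refine isIntegral_of_algebraMap_tower (K := K) hπ hπg (L := L) (Ag := Ag) ?_
    rw [h]
    exact isIntegral_algebraMap
  obtain ⟨g, hg, hgx⟩ := hx
  have hgy : aeval y g = 0 := by
    apply hinj
    rw [← aeval_algebraMap_apply, ← h, aeval_algebraMap_apply, map_zero]
    exact (congrArg (algebraMap E L) hgx).trans (map_zero _)
  obtain ⟨n, a, ha⟩ := hAg.exists_pow_eq hπ (hg.map (residue A)).ne_zero
    (aeval_mk_eq_zero hπ (c := y) (g := g) (by rw [hgy]; exact dvd_zero _))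
  have ha' : y ^ p ^ n - algebraMap A Ag a ∈ maximalIdeal Ag := by
    rw [hπg.maximalIdeal_eq, Ideal.mem_span_singleton, ← mem_extendedIdeal_iff hπ,
      ← Ideal.Quotient.mk_eq_mk_iff_sub_mem, map_pow]
    exact ha
  rw [← IsSmall.algebraMap_iff (E := L), map_sub, map_pow, ← h,
    ← IsScalarTower.algebraMap_apply, IsScalarTower.algebraMap_apply A E L, ← map_pow,
    ← map_sub] at ha'
  obtain ⟨b, hb⟩ := exists_isSmall_sub_of_pow_pow hAg hπ hπg (K := K) (Kg := Kg) ⟨g, hg, hgx⟩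
    (fun σ _ => by rw [h, IsScalarTower.algebraMap_apply Ag Kg L, σ.commutes])
    (isSmall_of_algebraMap_tower (K := K) hπ hπg ha')
  have hyb := hb.algebraMap_tower hπ hπg (Ag := Ag) (L := L)
  rw [map_sub, h, ← IsScalarTower.algebraMap_apply, IsScalarTower.algebraMap_apply A Ag L,
    ← map_sub, IsSmall.algebraMap_iff, hπg.maximalIdeal_eq, Ideal.mem_span_singleton] at hyb
  obtain ⟨y', hy'⟩ := hyb
  refine ⟨b, (x - algebraMap A E b) / algebraMap A E π, y', by linear_combination hy', ?_⟩
  have hπ0 : algebraMap Ag L (algebraMap A Ag π) ≠ 0 :=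
    (map_ne_zero_iff _ hinj).2 hπg.ne_zero
  rw [map_div₀, map_sub, h, ← IsScalarTower.algebraMap_apply, ← IsScalarTower.algebraMap_apply,
    IsScalarTower.algebraMap_apply A Ag L, IsScalarTower.algebraMap_apply A Ag L, ← map_sub, hy',
    map_mul, mul_div_cancel_left₀ _ hπ0]

theorem mem_range_of_algebraMap_eq {x : E} {y : Ag} (h : algebraMap E L x = algebraMap Ag L y) :
    ∃ a : A, algebraMap A Ag a = y := by
  let Y := {y : Ag // ∃ x : E, algebraMap E L x = algebraMap Ag L y}
  have hstep : ∀ y : Y, ∃ (a : A) (y' : Y), y.1 = algebraMap A Ag a + algebraMap A Ag π * y'.1 := by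
    rintro ⟨y, x, h⟩
    obtain ⟨a, x', y', h1, h2⟩ := exists_digit_of_algebraMap_eq (K := K) (Kg := Kg) hAg hπ hπg h
    exact ⟨a, ⟨y', x', h2⟩, h1⟩
  choose a next hnext using hstep
  let y₀ : Y := ⟨y, x, h⟩
  have hsum : ∀ n, y = algebraMap A Ag (∑ i ∈ Finset.range n, π ^ i * a (next^[i] y₀)) +
      algebraMap A Ag π ^ n * (next^[n] y₀).1 := by
    intro n
    induction n with
    | zero => simp [y₀]
    | succ n ih =>
      rw [Finset.sum_range_succ, Function.iterate_succ_apply', map_add, map_mul, map_pow]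
      have := hnext (next^[n] y₀)
      linear_combination ih + algebraMap A Ag π ^ n * this
  have hA : IsAdicComplete (Ideal.span {π}) A := by
    rw [← hπ.maximalIdeal_eq]; infer_instance
  have hG : IsAdicComplete (Ideal.span {algebraMap A Ag π}) Ag := by
    rw [← hπg.maximalIdeal_eq]; infer_instance
  obtain ⟨s, hs⟩ := exists_adic_limit (π := π)
    (fun n => ∑ i ∈ Finset.range n, π ^ i * a (next^[i] y₀))
    fun n => by rw [Finset.sum_range_succ, add_sub_cancel_left]; exact dvd_mul_right _ _
  refine ⟨s, sub_eq_zero.1 (eq_zero_of_forall_pow_dvd (π := algebraMap A Ag π) fun n => ?_)⟩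
  obtain ⟨d, hd⟩ := hs n
  refine ⟨algebraMap A Ag d - (next^[n] y₀).1, ?_⟩
  have hd' := congrArg (algebraMap A Ag) hd
  rw [map_sub, map_mul, map_pow] at hd'
  linear_combination hd' - hsum n

/-- The intersection of `Kg` with a separable extension of `K` inside `L` is `K`. -/
theorem exists_algebraMap_eq_of_mem_both {x : E} {z : Kg}
    (h : algebraMap E L x = algebraMap Kg L z) : ∃ t : K, algebraMap K E t = x := by
  have : FaithfulSMul A E := faithfulSMul_of_isFractionRing A K
  have : FaithfulSMul Ag L := faithfulSMul_of_isFractionRing Ag Kg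
  obtain ⟨a, b, hb, rfl⟩ := IsFractionRing.div_surjective Ag z
  have hb0 : b ≠ 0 := nonZeroDivisors.ne_zero hb
  obtain ⟨m, u, rfl⟩ := IsDiscreteValuationRing.eq_unit_mul_pow_irreducible hb0 hπg
  have hπ0 : algebraMap A E π ≠ 0 :=
    (map_ne_zero_iff _ (FaithfulSMul.algebraMap_injective A E)).2 hπ.ne_zero
  have hπL : algebraMap E L (algebraMap A E π) = algebraMap Ag L (algebraMap A Ag π) := by
    rw [← IsScalarTower.algebraMap_apply, ← IsScalarTower.algebraMap_apply]
  have h1 : algebraMap E L (x * algebraMap A E π ^ m) = algebraMap Ag L (a * ↑u⁻¹) := by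
    have hu0 : algebraMap Ag L u ≠ 0 := (u.isUnit.map _).ne_zero
    have huu : algebraMap Ag L u * algebraMap Ag L ↑u⁻¹ = 1 := by
      rw [← map_mul, Units.mul_inv, map_one]
    have hbL : algebraMap Ag L (u * algebraMap A Ag π ^ m) ≠ 0 :=
      (map_ne_zero_iff _ (FaithfulSMul.algebraMap_injective Ag L)).2 hb0
    rw [map_div₀, ← IsScalarTower.algebraMap_apply, ← IsScalarTower.algebraMap_apply,
      eq_div_iff hbL] at h
    simp only [map_mul, map_pow, hπL] at h ⊢
    rw [← h]
    linear_combination (-algebraMap E L x * algebraMap Ag L (algebraMap A Ag π) ^ m) * huu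
  obtain ⟨s, hs⟩ := mem_range_of_algebraMap_eq (K := K) (Kg := Kg) hAg hπ hπg h1
  refine ⟨algebraMap A K s / algebraMap A K π ^ m, ?_⟩
  rw [map_div₀, map_pow, ← IsScalarTower.algebraMap_apply, ← IsScalarTower.algebraMap_apply,
    div_eq_iff (pow_ne_zero _ hπ0)]
  apply (algebraMap E L).injective
  rw [h1, ← hs, ← IsScalarTower.algebraMap_apply, ← IsScalarTower.algebraMap_apply]

end Descent

/-! ### Krull topology and surjectivity of the restriction. -/

section Topology

/-- The value σ x depends only on the coset of σ modulo the stabilizer of x, which is open. -/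
theorem isClosed_setOf_apply {F E : Type*} [Field F] [Field E] [Algebra F E]
    [Algebra.IsIntegral F E] (P : E → Prop) (x : E) : IsClosed {σ : E ≃ₐ[F] E | P (σ x)} := by
  rw [← isOpen_compl_iff, isOpen_iff_forall_mem_open]
  intro σ hσ
  refine ⟨(σ * ·) '' (MulAction.stabilizer (E ≃ₐ[F] E) x), ?_,
    isOpenMap_mul_left σ _ (stabilizer_isOpen_of_isIntegral x), 1, one_mem _, mul_one σ⟩
  rintro _ ⟨τ, hτ, rfl⟩
  have hτx : τ x = x := hτ
  change ¬P (σ (τ x))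
  rwa [hτx]

theorem isClosed_inertiaGroup {R F E : Type*} [CommRing R] [Field F] [Field E] [Algebra R F]
    [Algebra R E] [Algebra F E] [IsScalarTower R F E] [Algebra.IsIntegral F E] :
    IsClosed (inertiaGroup R F E : Set (E ≃ₐ[F] E)) := by
  have : (inertiaGroup R F E : Set (E ≃ₐ[F] E)) =
      ⋂ (x : E) (_ : IsIntegral R x), {σ : E ≃ₐ[F] E | IsSmall R (σ x - x)} := by
    ext σ
    simp [mem_inertiaGroup_iff]
  rw [this]
  exact isClosed_iInter fun x => isClosed_iInter fun _ =>
    isClosed_setOf_apply (fun y => IsSmall R (y - x)) x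

variable {K Kg E L : Type*} [Field K] [Field Kg] [Field E] [Field L] [Algebra K E] [Algebra Kg L]
  [Algebra E L] (r : (L ≃ₐ[Kg] L) →* (E ≃ₐ[K] E))
  (hr : ∀ σ x, algebraMap E L (r σ x) = σ (algebraMap E L x))

include hr

theorem continuous_of_restrict [Algebra.IsIntegral Kg L] : Continuous r := by
  refine continuous_of_continuousAt_one r ?_
  rw [ContinuousAt, map_one]
  intro s hs
  obtain ⟨M, hM, hMs⟩ := (krullTopology_mem_nhds_one_iff K E s).1 hs
  obtain ⟨T, rfl⟩ := IntermediateField.essFiniteType_iff.1 (inferInstance : Algebra.EssFiniteType K M)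
  rw [Filter.mem_map]
  refine Filter.mem_of_superset
    ((Filter.biInter_finset_mem T).2 fun t _ =>
      (stabilizer_isOpen_of_isIntegral (K := Kg) (algebraMap E L t)).mem_nhds (one_mem _))
    fun σ hσ => hMs ?_
  rw [SetLike.mem_coe, ← Subgroup.zpowers_le, ← IntermediateField.le_iff_le,
    IntermediateField.adjoin_le_iff]
  intro t ht
  have hσt : σ (algebraMap E L t) = algebraMap E L t := Set.mem_iInter₂.1 hσ t ht
  have h1 : r σ t = t := (algebraMap E L).injective (by rw [hr, hσt])
  rw [SetLike.mem_coe, IntermediateField.mem_fixedField_iff]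
  intro f hf
  have : Subgroup.zpowers (r σ) ≤ MulAction.stabilizer (E ≃ₐ[K] E) t := by
    rw [Subgroup.zpowers_le]
    exact h1
  exact this hf

/-- The restriction is continuous and the Galois groups are compact Hausdorff, so the image of a
closed subgroup is closed and the Galois correspondence applies to it. -/
theorem map_eq_fixingSubgroup_of_isClosed [IsGalois K E] [IsGalois Kg L] {H : Subgroup (L ≃ₐ[Kg] L)}
    (hH : IsClosed (H : Set (L ≃ₐ[Kg] L))) :
    (IntermediateField.fixedField (H.map r)).fixingSubgroup = H.map r := by
  have hc : IsClosed ((H.map r : Subgroup (E ≃ₐ[K] E)) : Set (E ≃ₐ[K] E)) := by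
    rw [Subgroup.coe_map]
    have : T2Space (E ≃ₐ[K] E) := krullTopology_t2
    exact (hH.isCompact.image (continuous_of_restrict r hr)).isClosed
  exact InfiniteGalois.fixingSubgroup_fixedField ⟨H.map r, hc⟩

end Topology

section Surjective

variable {p : ℕ} [Fact p.Prime]
  {A : Type u} [CommRing A] [IsDomain A] [IsDiscreteValuationRing A]
  [IsAdicComplete (maximalIdeal A) A] [CharP (ResidueField A) p]
  {Ag : Type u} [CommRing Ag] [IsDomain Ag] [IsDiscreteValuationRing Ag]
  [IsAdicComplete (maximalIdeal Ag) Ag] [Algebra A Ag]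
  (hAg : IsGenericResidualPerfection p A Ag) [PerfectField (ResidueField Ag)]
  {π : A} (hπ : Irreducible π) (hπg : Irreducible (algebraMap A Ag π))
  {K Kg E L : Type*} [Field K] [Algebra A K] [IsFractionRing A K] [Field E] [Field L]
  [Algebra A E] [Algebra K E] [IsScalarTower A K E] [IsGalois K E]
  [Field Kg] [Algebra Ag Kg] [IsFractionRing Ag Kg]
  [Algebra Kg L] [IsSepClosure Kg L]
  [Algebra A L] [Algebra Ag L] [IsScalarTower A Ag L] [IsScalarTower Ag Kg L]
  [Algebra E L] [IsScalarTower A E L]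
  (r : (L ≃ₐ[Kg] L) →* (E ≃ₐ[K] E))
  (hr : ∀ σ x, algebraMap E L (r σ x) = σ (algebraMap E L x))

include hAg hπ hπg hr in
-- An element of E fixed by the image is fixed by the whole Galois group of L over K^g. It therefore
-- lies in K^g, and by `exists_algebraMap_eq_of_mem_both` in K.
theorem surjective_restrict : Function.Surjective r := by
  have h1 := map_eq_fixingSubgroup_of_isClosed r hr (H := ⊤) isClosed_univ
  have h2 : IntermediateField.fixedField ((⊤ : Subgroup (L ≃ₐ[Kg] L)).map r) = ⊥ := by
    rw [eq_bot_iff]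
    intro x hx
    rw [IntermediateField.mem_fixedField_iff] at hx
    have h3 : ∀ σ : L ≃ₐ[Kg] L, σ (algebraMap E L x) = algebraMap E L x := fun σ => by
      rw [← hr, hx _ ⟨σ, trivial, rfl⟩]
    obtain ⟨z, hz⟩ := (InfiniteGalois.mem_range_algebraMap_iff_fixed (k := Kg) _).2 h3
    obtain ⟨t, rfl⟩ := exists_algebraMap_eq_of_mem_both (K := K) hAg hπ hπg hz.symm
    exact IntermediateField.algebraMap_mem _ t
  rw [h2, IntermediateField.fixingSubgroup_bot, ← MonoidHom.range_eq_map] at h1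
  exact MonoidHom.range_eq_top.1 h1.symm

end Surjective

/-! ### The image of the inertia group. -/

section InertiaImage

open Polynomial

theorem exists_monic_splits_of_normal {A : Type*} (K : Type*) {M : Type*} [CommRing A] [IsDomain A]
    [IsIntegrallyClosed A] [Field K] [Algebra A K] [IsFractionRing A K] [Field M] [Algebra A M]
    [Algebra K M] [IsScalarTower A K M] [Normal K M] (y : integralClosure A M) :
    ∃ f : A[X], f.Monic ∧ aeval y f = 0 ∧ (f.map (algebraMap A (integralClosure A M))).Splits := by
  have hy : IsIntegral A (y : M) := y.2
  set f := minpoly A (y : M)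
  have hf : f.Monic := minpoly.monic hy
  have hfM : (f.map (algebraMap A M)).Splits := by
    rw [IsScalarTower.algebraMap_eq A K M, ← Polynomial.map_map,
      ← minpoly.isIntegrallyClosed_eq_field_fractions K M hy]
    exact Normal.splits inferInstance _
  refine ⟨f, hf, Subtype.ext ?_, ?_⟩
  · rw [coe_aeval_integralClosure]
    exact minpoly.aeval A (y : M)
  have hroots : ∀ s ∈ (f.map (algebraMap A M)).roots, IsIntegral A s := by
    intro s hs
    refine ⟨f, hf, ?_⟩
    have := isRoot_of_mem_roots hs
    rwa [IsRoot, eval_map] at this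
  have hprod := hfM.eq_prod_roots
  rw [(hf.map _).leadingCoeff, C_1, one_mul] at hprod
  obtain ⟨m, hm⟩ : ∃ m : Multiset (integralClosure A M),
      m.map (algebraMap (integralClosure A M) M) = (f.map (algebraMap A M)).roots :=
    ⟨(f.map (algebraMap A M)).roots.attach.map fun s => ⟨s.1, hroots s.1 s.2⟩, by
      rw [Multiset.map_map]
      exact Multiset.attach_map_val _⟩
  refine splits_iff_exists_multiset.2 ⟨m, ?_⟩
  rw [(hf.map _).leadingCoeff, C_1, one_mul]
  refine map_injective (algebraMap (integralClosure A M) M) Subtype.val_injective ?_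
  rw [Polynomial.map_map, ← IsScalarTower.algebraMap_eq, hprod, ← hm, Polynomial.map_multiset_prod,
    Multiset.map_map, Multiset.map_map]
  congr 2
  ext1 x
  simp

instance normal_inertiaGroup {R F E : Type*} [CommRing R] [Field F] [Field E] [Algebra R F]
    [Algebra R E] [Algebra F E] [IsScalarTower R F E] : (inertiaGroup R F E).Normal := by
  refine ⟨fun σ hσ τ => ?_⟩
  intro x
  have := smul_mem_integralMaximalIdeal R F E τ (hσ (τ⁻¹ • x))
  have h2 : τ • (σ • τ⁻¹ • x - τ⁻¹ • x) = (τ * σ * τ⁻¹) • x - x := by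
    rw [smul_sub, smul_smul, smul_smul, smul_inv_smul, mul_assoc]
  exact h2 ▸ this

variable {p : ℕ} [Fact p.Prime]
  {A : Type u} [CommRing A] [IsDomain A] [IsDiscreteValuationRing A]
  [IsAdicComplete (maximalIdeal A) A] [CharP (ResidueField A) p]
  {Ag : Type u} [CommRing Ag] [IsDomain Ag] [IsDiscreteValuationRing Ag]
  [IsAdicComplete (maximalIdeal Ag) Ag] [Algebra A Ag]
  (hAg : IsGenericResidualPerfection p A Ag) [PerfectField (ResidueField Ag)]
  {π : A} (hπ : Irreducible π) (hπg : Irreducible (algebraMap A Ag π))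
  {K Kg E L : Type*} [Field K] [Algebra A K] [IsFractionRing A K] [Field E] [Field L]
  [Algebra A E] [Algebra K E] [IsScalarTower A K E] [IsSepClosure K E]
  [Field Kg] [Algebra Ag Kg] [IsFractionRing Ag Kg]
  [Algebra Kg L] [IsSepClosure Kg L]
  [Algebra A L] [Algebra Ag L] [IsScalarTower A Ag L] [IsScalarTower Ag Kg L]
  [Algebra E L] [IsScalarTower A E L]
  (r : (L ≃ₐ[Kg] L) →* (E ≃ₐ[K] E))
  (hr : ∀ σ x, algebraMap E L (r σ x) = σ (algebraMap E L x))

omit [IsAdicComplete (maximalIdeal A) A] in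
include hπ in
theorem exists_isIntegral_pow_mul (K : Type*) [Field K] [Algebra A K] [IsFractionRing A K]
    [Algebra K E] [IsScalarTower A K E] [Algebra.IsAlgebraic K E] (x : E) :
    ∃ n, IsIntegral A (algebraMap A E π ^ n * x) := by
  obtain ⟨a, ha, h⟩ := ((IsFractionRing.isAlgebraic_iff A K E).2
    (Algebra.IsAlgebraic.isAlgebraic x)).exists_integral_multiple
  obtain ⟨n, u, rfl⟩ := IsDiscreteValuationRing.eq_unit_mul_pow_irreducible ha hπ
  refine ⟨n, ?_⟩
  have := h.smul (R := A) (u⁻¹ : Aˣ).1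
  rw [smul_smul, ← mul_assoc, Units.inv_mul, one_mul, Algebra.smul_def, map_pow] at this
  exact this

include hπ in
theorem eq_zero_of_forall_isIntegral_div (K : Type*) [Field K] [Algebra A K] [IsFractionRing A K]
    [Algebra K E] [IsScalarTower A K E] [Algebra.IsAlgebraic K E] {z : E}
    (h : ∀ n, IsIntegral A (z / algebraMap A E π ^ n)) : z = 0 := by
  have : FaithfulSMul A E := faithfulSMul_of_isFractionRing A K
  by_contra hz
  obtain ⟨n, hn⟩ := exists_isIntegral_pow_mul hπ K z⁻¹
  have hπ0 : algebraMap A E π ≠ 0 :=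
    (map_ne_zero_iff _ (FaithfulSMul.algebraMap_injective A E)).2 hπ.ne_zero
  have h1 := isSmall_uniformizer_mul hπ ((h (n + 1)).mul hn)
  refine not_isSmall_one (R := A) (E := E) ?_
  convert! h1 using 1
  field_simp
  ring

omit [PerfectField (ResidueField Ag)] [IsSepClosure Kg L] in
include hπ hπg hr in
theorem map_inertiaGroup_le : (inertiaGroup Ag Kg L).map r ≤ inertiaGroup A K E := by
  rintro _ ⟨σ, hσ, rfl⟩
  refine mem_inertiaGroup_iff.2 fun x hx => ?_
  have : FaithfulSMul Ag L := faithfulSMul_of_isFractionRing Ag Kg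
  refine isSmall_of_algebraMap_tower (K := K) hπ hπg (L := L) (Ag := Ag) ?_
  rw [map_sub, hr]
  exact mem_inertiaGroup_iff.1 hσ _ hx.algebraMap_tower

include hAg hπ hπg hr in
-- Surjectivity makes the image of inertia normal, so its fixed field M is Galois over K and its
-- residue extension is normal. By `exists_isSmall_sub_of_pow_pow` that extension has no purely
-- inseparable part, so it is separable. Then x is congruent to a root y of a monic polynomial with
-- separable reduction, and inertia groups fix such roots.
theorem exists_digit_of_mem_fixedField {x : E}
    (hx : x ∈ IntermediateField.fixedField ((inertiaGroup Ag Kg L).map r)) (hxi : IsIntegral A x) :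
    ∃ y x', (∀ σ ∈ inertiaGroup A K E, σ y = y) ∧
      x' ∈ IntermediateField.fixedField ((inertiaGroup Ag Kg L).map r) ∧ IsIntegral A x' ∧
      x = y + algebraMap A E π * x' := by
  have : FaithfulSMul A E := faithfulSMul_of_isFractionRing A K
  have : FaithfulSMul Ag L := faithfulSMul_of_isFractionRing Ag Kg
  have : IsSepClosed E := IsSepClosure.sep_closed K
  have hn : ((inertiaGroup Ag Kg L).map r).Normal :=
    normal_inertiaGroup.map r (surjective_restrict hAg hπ hπg r hr)
  set M := IntermediateField.fixedField ((inertiaGroup Ag Kg L).map r) with hM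
  have hgal : IsGalois K M := IsGalois.of_fixedField_normal_subgroup _
  have : FaithfulSMul A M := faithfulSMul_of_isFractionRing A K
  have : ExpChar (ResidueField A) p := ExpChar.prime Fact.out
  have hmem : ∀ z : E, z ∈ M ↔
      ∀ σ ∈ inertiaGroup Ag Kg L, σ (algebraMap E L z) = algebraMap E L z := by
    intro z
    rw [hM, IntermediateField.mem_fixedField_iff]
    constructor
    · intro h σ hσ
      rw [← hr, h _ ⟨σ, hσ, rfl⟩]
    · rintro h _ ⟨σ, hσ, rfl⟩
      exact (algebraMap E L).injective (by rw [hr, h σ hσ])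
  let i : M →ₐ[A] E := M.val.restrictScalars A
  have hsm : ∀ z : integralClosure A M,
      z ∈ maximalIdeal (integralClosure A M) ↔ IsSmall A ((z : M) : E) := by
    intro z
    rw [← integralMaximalIdeal_eq, ← isSmall_coe]
    exact (IsSmall.map i).symm
  have hxM : IsIntegral A (⟨x, hx⟩ : M) :=
    (isIntegral_algHom_iff i i.toRingHom.injective).1 hxi
  have hsep := isSeparable_residue_of_normal (R := A) (p := p)
    (fun y : integralClosure A M => exists_monic_splits_of_normal K y)
    (fun y n a hya => by
      rw [hsm] at hya
      have hyi : IsIntegral A (y : M) := y.2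
      obtain ⟨b, hb⟩ := exists_isSmall_sub_of_pow_pow hAg hπ hπg (K := K) (Kg := Kg) (L := L)
        (b := ((y : M) : E)) (hyi.map i) ((hmem _).1 (y : M).2) hya
      exact ⟨b, (hsm _).2 hb⟩) ⟨⟨x, hx⟩, hxM⟩
  obtain ⟨g, hg, hgs, hgx⟩ := exists_monic_lift_of_isSeparable hsep
  have hgx' : IsSmall A (aeval x g) := by
    rw [hsm, coe_aeval_integralClosure] at hgx
    have : ((aeval (⟨x, hx⟩ : M) g : M) : E) = aeval x g :=
      (aeval_algHom_apply i (⟨x, hx⟩ : M) g).symm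
    rwa [← this]
  obtain ⟨y, hy, hxy⟩ := exists_root_of_isSmall_aeval hg (splits_of_residue_separable K hg hgs)
    hxi hgx'
  have hπ0 : algebraMap A E π ≠ 0 :=
    (map_ne_zero_iff _ (FaithfulSMul.algebraMap_injective A E)).2 hπ.ne_zero
  have hloc : IsLocalHom (algebraMap A Ag) := by
    refine ((IsLocalRing.local_hom_TFAE (algebraMap A Ag)).out 0 2).2 ?_
    rw [hπ.maximalIdeal_eq, Ideal.map_span, Set.image_singleton, hπg.maximalIdeal_eq]
  -- The reduction of g stays separable over the residue field of A^g, so the inertia group of K^g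
  -- fixes y too. Hence x - y is fixed by it, and being small is divisible by π.
  have hyM : y ∈ M := by
    rw [hmem]
    intro σ hσ
    refine inertiaGroup_fixes_root (hg.map (algebraMap A Ag)) ?_ ?_ hσ
    · have : (g.map (algebraMap A Ag)).map (residue Ag) =
          (g.map (residue A)).map (ResidueField.map (algebraMap A Ag)) := by
        rw [Polynomial.map_map, Polynomial.map_map]
        rfl
      rw [this]
      exact hgs.map
    · rw [aeval_map_algebraMap, aeval_algebraMap_apply, hy, map_zero]
  have hπM : algebraMap A E π ∈ M := M.algebraMap_mem (algebraMap A K π) |> fun h => by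
    rwa [← IsScalarTower.algebraMap_apply] at h
  refine ⟨y, (x - y) / algebraMap A E π, fun σ hσ => inertiaGroup_fixes_root hg hgs hy hσ,
    div_mem (sub_mem hx hyM) hπM, ?_, by rw [mul_div_cancel₀ _ hπ0, add_sub_cancel]⟩
  refine isIntegral_of_algebraMap_tower (K := K) hπ hπg (L := L) (Ag := Ag) ?_
  rw [map_div₀, ← IsScalarTower.algebraMap_apply, IsScalarTower.algebraMap_apply A Ag L]
  exact isIntegral_div_of_fixed hπg (F := Kg) ((hmem _).1 (sub_mem hx hyM))
    (hxy.algebraMap_tower hπ hπg)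

include hAg hπ hπg hr in
-- The image is closed, so it is enough that an inertia element σ of K fixes M. As σ fixes each
-- digit, σ x - x is divisible by every power of π for x integral in M, hence is zero.
theorem map_inertiaGroup : (inertiaGroup Ag Kg L).map r = inertiaGroup A K E := by
  refine le_antisymm (map_inertiaGroup_le hπ hπg r hr) fun σ hσ => ?_
  have : FaithfulSMul A E := faithfulSMul_of_isFractionRing A K
  have hπ0 : algebraMap A E π ≠ 0 :=
    (map_ne_zero_iff _ (FaithfulSMul.algebraMap_injective A E)).2 hπ.ne_zero
  rw [← map_eq_fixingSubgroup_of_isClosed r hr isClosed_inertiaGroup]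
  set M := IntermediateField.fixedField ((inertiaGroup Ag Kg L).map r) with hM
  have hσπ : σ (algebraMap A E π) = algebraMap A E π := by
    rw [IsScalarTower.algebraMap_apply A K E, σ.commutes]
  have key : ∀ n, ∀ x ∈ M, IsIntegral A x → IsIntegral A ((σ x - x) / algebraMap A E π ^ n) := by
    intro n
    induction n with
    | zero =>
      intro x _ hx
      rw [pow_zero, div_one]
      exact (hx.algEquiv σ).sub hx
    | succ n ih =>
      intro x hxM hx
      obtain ⟨y, x', hy, hx'M, hx', rfl⟩ :=
        exists_digit_of_mem_fixedField hAg hπ hπg r hr hxM hx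
      have h1 := ih x' hx'M hx'
      rw [map_add, map_mul, hy σ hσ, hσπ, add_sub_add_left_eq_sub, ← mul_sub, pow_succ',
        mul_div_mul_left _ _ hπ0]
      exact h1
  rw [IntermediateField.mem_fixingSubgroup_iff]
  intro x hx
  obtain ⟨n, hn⟩ := exists_isIntegral_pow_mul hπ K x
  have hπM : algebraMap A E π ∈ M := by
    rw [IsScalarTower.algebraMap_apply A K E]
    exact M.algebraMap_mem _
  have h1 := eq_zero_of_forall_isIntegral_div hπ K
    fun m => key m _ (mul_mem (pow_mem hπM n) hx) hn
  rw [map_mul, map_pow, hσπ, ← mul_sub] at h1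
  exact sub_eq_zero.1 ((mul_eq_zero.1 h1).resolve_left (pow_ne_zero _ hπ0))

end InertiaImage

/-! ### Wild inertia. -/

section Wild

theorem exists_pow_apply_eq {F E : Type*} [Field F] [Field E] [Algebra F E]
    [Algebra.IsAlgebraic F E] (s : E ≃ₐ[F] E) (x : E) : ∃ n, 0 < n ∧ (s ^ n) x = x := by
  have hx : IsIntegral F x := Algebra.IsIntegral.isIntegral x
  have hmem : ∀ i : ℕ, (s ^ i) x ∈ (minpoly F x).rootSet E := by
    intro i
    rw [Polynomial.mem_rootSet_of_ne (minpoly.ne_zero hx), Polynomial.aeval_algEquiv,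
      AlgHom.comp_apply, minpoly.aeval, map_zero]
  obtain ⟨i, -, j, -, hij, h⟩ := Set.infinite_univ.exists_ne_map_eq_of_mapsTo
    (f := fun i : ℕ => (s ^ i) x) (fun i _ => hmem i) (Polynomial.rootSet_finite _ _)
  wlog hlt : i < j generalizing i j
  · exact this j i hij.symm h.symm (by omega)
  refine ⟨j - i, by omega, (s ^ i).injective ?_⟩
  rw [← AlgEquiv.mul_apply, ← pow_add, Nat.add_sub_cancel' hlt.le]
  exact h.symm

theorem exists_pow_mul_coprime {p n : ℕ} (hp : p.Prime) (hn : 0 < n) :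
    ∃ a m, n = p ^ a * m ∧ m.Coprime p := by
  obtain ⟨a, m, hm, rfl⟩ := Nat.exists_eq_pow_mul_and_not_dvd hn.ne' p hp.ne_one
  exact ⟨a, m, rfl, ((Nat.Prime.coprime_iff_not_dvd hp).2 hm).symm⟩

section

variable {R F E : Type*} [CommRing R] [Field F] [Field E] [Algebra R F]
  [Algebra R E] [Algebra F E] [IsScalarTower R F E]

theorem wildInertiaGroup_le_inertiaGroup : wildInertiaGroup R F E ≤ inertiaGroup R F E := by
  intro σ hσ
  rw [mem_inertiaGroup_iff]
  intro y hy
  by_cases hy0 : y = 0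
  · rw [hy0, map_zero, sub_zero]; exact isSmall_zero
  have := (mem_wildInertiaGroup_iff.1 hσ y hy0).mul_right hy
  rwa [sub_mul, div_mul_cancel₀ _ hy0, one_mul] at this

variable [IsDomain R] [IsDiscreteValuationRing R] [IsAdicComplete (maximalIdeal R) R]
  [IsFractionRing R F] [Algebra.IsSeparable F E] {s : E ≃ₐ[F] E}

/-- Otherwise x / s x is small. Multiplying its conjugates, x / s^n x is small for all n ≥ 1; but
orbits are finite, so this quotient equals 1 for some n. -/
theorem isIntegral_apply_div (s : E ≃ₐ[F] E) (x : E) :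
    IsIntegral R (s x / x) := by
  have : FaithfulSMul R E := faithfulSMul_of_isFractionRing R F
  by_cases hx : x = 0
  · rw [hx, div_zero]; exact isIntegral_zero
  refine (isIntegral_or_isSmall_inv R F _).resolve_right fun h => ?_
  rw [inv_div] at h
  have key : ∀ n, IsSmall R (x / (s ^ (n + 1)) x) := by
    intro n
    induction n with
    | zero => simpa using h
    | succ n ih =>
      have h1 := (ih.algEquiv s).mul_right h.isIntegral
      rw [map_div₀, ← AlgEquiv.mul_apply, ← pow_succ', mul_comm,
        div_mul_div_cancel₀ (by simpa using hx)] at h1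
      exact h1
  obtain ⟨n, hn, hnx⟩ := exists_pow_apply_eq s x
  have := key (n - 1)
  rw [Nat.sub_add_cancel hn, hnx, div_self hx] at this
  exact not_isSmall_one this

/-- The quotients s^m x / x form a cocycle. Inertia acts trivially on residues, so modulo the
maximal ideal the cocycle is multiplicative in m. -/
theorem isSmall_pow_apply_div (hs : s ∈ inertiaGroup R F E) {x : E} (hx : x ≠ 0) (m : ℕ) :
    IsSmall R ((s ^ m) x / x - (s x / x) ^ m) := by
  have : FaithfulSMul R E := faithfulSMul_of_isFractionRing R F
  induction m with
  | zero => simpa [hx] using isSmall_zero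
  | succ m ih =>
    have h1 := mem_inertiaGroup_iff.1 hs _ (isIntegral_apply_div (R := R) (s ^ m) x)
    have h2 := (h1.add ih).mul_right (isIntegral_apply_div (R := R) s x)
    convert! h2 using 1
    have hsx : s x ≠ 0 := by simpa using hx
    rw [pow_succ', AlgEquiv.mul_apply, map_div₀, sub_add_sub_cancel, sub_mul,
      div_mul_div_cancel₀ hsx, pow_succ]

theorem IsSmall.sub_one_of_pow {p : ℕ} [Fact p.Prime] [CharP (ResidueField R) p]
    [FaithfulSMul R E] {u : E} (hu : IsIntegral R u) {a : ℕ} (h : IsSmall R (u ^ p ^ a - 1)) :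
    IsSmall R (u - 1) := by
  induction a with
  | zero => simpa using h
  | succ a ih =>
    refine ih (IsSmall.sub_of_pow_sub (p := p) (hu.pow _) isIntegral_one ?_)
    rwa [one_pow, ← pow_mul, ← pow_succ]

/-- Powers of an inertia element with exponent divisible by the prime-to-`p` part of its order
act trivially on `x` modulo `𝔪`. -/
theorem exists_coprime_isSmall {p : ℕ} [Fact p.Prime] [CharP (ResidueField R) p]
    (hs : s ∈ inertiaGroup R F E) {x : E} (hx : x ≠ 0) :
    ∃ n : ℕ, n.Coprime p ∧ ∀ m, n ∣ m → IsSmall R ((s ^ m) x / x - 1) := by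
  have : FaithfulSMul R E := faithfulSMul_of_isFractionRing R F
  obtain ⟨N, hN, hNx⟩ := exists_pow_apply_eq s x
  obtain ⟨a, n, rfl, hn⟩ := exists_pow_mul_coprime (p := p) Fact.out hN
  have hu : IsIntegral R (s x / x) := isIntegral_apply_div (R := R) s x
  -- The (p^a n)-th power of s x / x is congruent to 1, and Frobenius is injective on the residue
  -- field.
  have h1 : IsSmall R ((s x / x) ^ n - 1) := by
    refine IsSmall.sub_one_of_pow (p := p) (hu.pow n) (a := a) ?_
    have := (isSmall_pow_apply_div hs hx (p ^ a * n)).neg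
    rwa [hNx, div_self hx, neg_sub, mul_comm, pow_mul] at this
  refine ⟨n, hn, ?_⟩
  rintro _ ⟨m, rfl⟩
  have h2 : IsSmall R ((s x / x) ^ (n * m) - 1) := by
    rw [pow_mul, ← mul_geom_sum]
    exact h1.mul_right (IsIntegral.sum _ fun i _ => (hu.pow n).pow i)
  have := (isSmall_pow_apply_div hs hx (n * m)).add h2
  rwa [sub_add_sub_cancel] at this

/-- The orbits of a wild inertia element have `p`-power length. -/
theorem exists_pow_pow_apply_eq {p : ℕ} [Fact p.Prime] [CharP (ResidueField R) p]
    (hs : s ∈ wildInertiaGroup R F E) (x : E) : ∃ b, (s ^ p ^ b) x = x := by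
  have : FaithfulSMul R E := faithfulSMul_of_isFractionRing R F
  obtain ⟨N, hN, hNx⟩ := exists_pow_apply_eq s x
  obtain ⟨b, n, rfl, hn⟩ := exists_pow_mul_coprime (p := p) Fact.out hN
  refine ⟨b, ?_⟩
  set τ := s ^ p ^ b with hτdef
  have hτ : ∀ i : ℕ, τ ^ i ∈ wildInertiaGroup R F E := fun i => pow_mem (pow_mem hs _) i
  rw [pow_mul] at hNx
  let y := ∑ i ∈ Finset.range n, (τ ^ i) x
  have hy : τ y = y := by
    have h1 := Finset.sum_range_succ (fun i => (τ ^ i) x) n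
    rw [Finset.sum_range_succ', hNx, pow_zero, AlgEquiv.one_apply] at h1
    rw [map_sum]
    refine Eq.trans (Finset.sum_congr rfl fun i _ => ?_) (add_right_cancel h1)
    rw [pow_succ', AlgEquiv.mul_apply]
  have hyi : ∀ i : ℕ, (τ ^ i) y = y := by
    intro i
    induction i with
    | zero => rfl
    | succ i ih => rw [pow_succ, AlgEquiv.mul_apply, hy, ih]
  have hns : ¬IsSmall R (n : E) := by
    rw [← map_natCast (algebraMap R E), IsSmall.algebraMap_iff, ← residue_eq_zero_iff, map_natCast,
      CharP.cast_eq_zero_iff _ p]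
    intro h
    have := Nat.Coprime.eq_one_of_dvd hn.symm h
    exact (Fact.out : p.Prime).ne_one this
  have hn0 : (n : E) ≠ 0 := fun h => hns (h ▸ isSmall_zero)
  -- Here y is the sum of the x-orbit under τ, so z has orbit sum zero. If z ≠ 0, dividing this sum
  -- by z gives n ≡ 0 modulo the maximal ideal, since each τ^i z / z ≡ 1; but n is prime to p. Hence
  -- n x = y is fixed by τ.
  let z := n * x - y
  have hz : ∑ i ∈ Finset.range n, (τ ^ i) z = 0 := by
    simp only [z, map_sub, map_mul, map_natCast, hyi, Finset.sum_sub_distrib, ← Finset.mul_sum,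
      Finset.sum_const, Finset.card_range, nsmul_eq_mul]
    exact sub_self _
  have hz0 : z = 0 := by
    by_contra hz0
    refine hns ?_
    have h1 : IsSmall R (∑ i ∈ Finset.range n, ((τ ^ i) z / z - 1)) :=
      isSmall_sum fun i _ => mem_wildInertiaGroup_iff.1 (hτ i) z hz0
    rw [Finset.sum_sub_distrib, ← Finset.sum_div, hz, zero_div, Finset.sum_const,
      Finset.card_range, nsmul_eq_mul, mul_one, zero_sub] at h1
    simpa using h1.neg
  have hxy : n * x = y := sub_eq_zero.1 hz0
  have := congrArg τ hxy
  rw [map_mul, map_natCast, hy, ← hxy] at this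
  exact mul_left_cancel₀ hn0 this

end

variable {p : ℕ} [Fact p.Prime]
  {A : Type u} [CommRing A] [IsDomain A] [IsDiscreteValuationRing A]
  [IsAdicComplete (maximalIdeal A) A] [CharP (ResidueField A) p]
  {Ag : Type u} [CommRing Ag] [IsDomain Ag] [IsDiscreteValuationRing Ag]
  [IsAdicComplete (maximalIdeal Ag) Ag] [Algebra A Ag] [CharP (ResidueField Ag) p]
  {K Kg E L : Type*} [Field K] [Algebra A K] [IsFractionRing A K] [Field E] [Field L]
  [Algebra A E] [Algebra K E] [IsScalarTower A K E] [IsSepClosure K E]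
  [Field Kg] [Algebra Ag Kg] [IsFractionRing Ag Kg]
  [Algebra Kg L] [IsSepClosure Kg L]
  [Algebra A L] [Algebra Ag L] [IsScalarTower A Ag L] [IsScalarTower Ag Kg L]
  [Algebra E L] [IsScalarTower A E L]
  (r : (L ≃ₐ[Kg] L) →* (E ≃ₐ[K] E))
  (hr : ∀ σ x, algebraMap E L (r σ x) = σ (algebraMap E L x))

include hr

omit [Fact p.Prime] [CharP (ResidueField A) p] [CharP (ResidueField Ag) p] [IsSepClosure Kg L] in
theorem map_wildInertiaGroup_le {π : A} (hπ : Irreducible π)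
    (hπg : Irreducible (algebraMap A Ag π)) :
    (wildInertiaGroup Ag Kg L).map r ≤ wildInertiaGroup A K E := by
  rintro _ ⟨σ, hσ, rfl⟩
  refine mem_wildInertiaGroup_iff.2 fun x hx => ?_
  have : FaithfulSMul Ag L := faithfulSMul_of_isFractionRing Ag Kg
  refine isSmall_of_algebraMap_tower (K := K) hπ hπg (L := L) (Ag := Ag) ?_
  rw [map_sub, map_div₀, hr, map_one]
  exact mem_wildInertiaGroup_iff.1 hσ _ (by simpa using hx)

include p

omit [Algebra A Ag] [Algebra A L] [IsScalarTower A Ag L] [IsScalarTower A E L] in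
-- Let s be an inertia lift of σ. A power s^m acts wildly on a given x if m is divisible by a
-- suitable integer prime to p. It restricts to σ on a given element of E if m ≡ 1 modulo a suitable
-- power of p, since σ has orbits of p-power length. Finitely many such conditions are compatible,
-- and compactness yields one automorphism meeting all of them.
theorem le_map_wildInertiaGroup
    (hI : (inertiaGroup Ag Kg L).map r = inertiaGroup A K E) :
    wildInertiaGroup A K E ≤ (wildInertiaGroup Ag Kg L).map r := by
  intro σ hσ
  have hσI : σ ∈ (inertiaGroup Ag Kg L).map r := by
    rw [hI]
    exact wildInertiaGroup_le_inertiaGroup hσ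
  obtain ⟨s, hs, hsσ⟩ := hσI
  let P : L → L → Prop := fun x y =>
    (x ≠ 0 → IsSmall Ag (y / x - 1)) ∧ ∀ e : E, algebraMap E L e = x → y = algebraMap E L (σ e)
  have hP : ∀ x, ∃ n b : ℕ, n.Coprime p ∧ ∀ m k, n ∣ m → m = 1 + p ^ b * k → P x ((s ^ m) x) := by
    intro x
    obtain ⟨n, hn, hn'⟩ : ∃ n : ℕ, n.Coprime p ∧
        ∀ m, n ∣ m → x ≠ 0 → IsSmall Ag ((s ^ m) x / x - 1) := by
      by_cases hx : x = 0
      · exact ⟨1, Nat.coprime_one_left p, fun _ _ h => (h hx).elim⟩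
      · obtain ⟨n, hn, h⟩ := exists_coprime_isSmall (p := p) hs hx
        exact ⟨n, hn, fun m hm _ => h m hm⟩
    obtain ⟨b, hb⟩ : ∃ b : ℕ, ∀ e : E, algebraMap E L e = x → (σ ^ p ^ b) e = e := by
      by_cases hx : ∃ e : E, algebraMap E L e = x
      · obtain ⟨e, rfl⟩ := hx
        obtain ⟨b, hb⟩ := exists_pow_pow_apply_eq (p := p) hσ e
        exact ⟨b, fun e' he' => (algebraMap E L).injective he' ▸ hb⟩
      · exact ⟨0, fun e he => (hx ⟨e, he⟩).elim⟩
    refine ⟨n, b, hn, fun m k hm hk => ⟨hn' m hm, fun e he => ?_⟩⟩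
    have h1 : ∀ k : ℕ, ((σ ^ p ^ b) ^ k) e = e := by
      intro k
      induction k with
      | zero => rfl
      | succ k ih => rw [pow_succ, AlgEquiv.mul_apply, hb e he, ih]
    rw [← he, ← hr, map_pow, hsσ, hk, pow_add, pow_one, pow_mul, AlgEquiv.mul_apply, h1]
  choose n b hn hnb using hP
  obtain ⟨t, ht⟩ := CompactSpace.iInter_nonempty
    (t := fun x : L => {τ : L ≃ₐ[Kg] L | P x (τ x)}) (fun x => isClosed_setOf_apply (P x) x) (by
      intro T
      let N := ∏ x ∈ T, n x
      let B := ∑ x ∈ T, b x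
      have hN : N.Coprime (p ^ B) :=
        (Nat.Coprime.prod_left fun x _ => hn x).pow_right B
      have hφ : 0 < Nat.totient (p ^ B) :=
        Nat.totient_pos.2 (pow_pos (Fact.out : p.Prime).pos B)
      have hmod := Nat.ModEq.pow_totient hN
      have hN1 : 1 ≤ N ^ Nat.totient (p ^ B) := by
        refine Nat.one_le_pow _ _ (Finset.prod_pos fun x _ => Nat.pos_of_ne_zero fun h0 => ?_)
        have := hn x
        rw [h0, Nat.coprime_zero_left] at this
        exact (Fact.out : p.Prime).ne_one this
      obtain ⟨k, hk⟩ := (Nat.modEq_iff_dvd' hN1).1 hmod.symm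
      -- By Euler's theorem N^φ(p^B) is 1 modulo p^B, and it is divisible by N because φ(p^B) > 0.
      refine ⟨s ^ N ^ Nat.totient (p ^ B), Set.mem_iInter₂.2 fun x hx => ?_⟩
      refine hnb x _ (p ^ (B - b x) * k) ?_ ?_
      · exact (Finset.dvd_prod_of_mem n hx).trans (dvd_pow_self _ hφ.ne')
      · have hB : b x ≤ B := Finset.single_le_sum (fun _ _ => Nat.zero_le _) hx
        rw [← mul_assoc, ← pow_add, Nat.add_sub_cancel' hB, ← hk]
        omega)
  rw [Set.mem_iInter] at ht
  refine ⟨t, mem_wildInertiaGroup_iff.2 fun x hx => (ht x).1 hx, ?_⟩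
  ext e
  exact (algebraMap E L).injective (by rw [hr]; exact (ht _).2 e rfl)

end Wild

/-! ### Structure of A^g and assembly of the theorem. -/

theorem IsGenericResidualPerfection.isDiscreteValuationRing {p : ℕ} [Fact p.Prime] {A : Type u}
    [CommRing A] [IsDomain A] [IsDiscreteValuationRing A] [CharP (ResidueField A) p]
    {Ag : Type u} [CommRing Ag] [IsDomain Ag] [Algebra A Ag]
    (hAg : IsGenericResidualPerfection p A Ag) {π : A} (hπ : Irreducible π) :
    IsDiscreteValuationRing Ag ∧ Irreducible (algebraMap A Ag π) := by
  have hspan := extendedIdeal_eq_span hπ Ag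
  have := hAg.1.flat
  have : IsAdicComplete (Ideal.span {algebraMap A Ag π}) Ag := hspan ▸ hAg.1.complete
  refine isDiscreteValuationRing_of_isField (fun h0 => ?_) ?_
  · exact one_ne_zero (uniformizer_mul_eq_zero hπ (B := Ag) (x := 1) (by rw [h0, zero_mul]))
  · have := hAg.isField hπ
    change IsField (Ag ⧸ extendedIdeal A Ag) at this
    rwa [hspan] at this

theorem IsGenericResidualPerfection.perfectField {p : ℕ} [Fact p.Prime] {A : Type u}
    [CommRing A] [IsDomain A] [IsDiscreteValuationRing A] [CharP (ResidueField A) p]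
    {Ag : Type u} [CommRing Ag] [IsLocalRing Ag] [Algebra A Ag]
    (hAg : IsGenericResidualPerfection p A Ag)
    (hm : maximalIdeal Ag = extendedIdeal A Ag) :
    CharP (ResidueField Ag) p ∧ PerfectField (ResidueField Ag) := by
  have hc : CharP (ResidueField Ag) p := by
    rw [CharP.charP_iff_prime_eq_zero Fact.out, ← map_natCast (residue Ag), residue_eq_zero_iff, hm]
    exact natCast_mem_extendedIdeal Ag
  refine ⟨hc, ?_⟩
  have h1 : Function.Bijective fun x : Ag ⧸ maximalIdeal Ag => x ^ p := hm ▸ hAg.1.perfect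
  have : ExpChar (ResidueField Ag) p := ExpChar.prime Fact.out
  have : PerfectRing (ResidueField Ag) p := ⟨h1⟩
  exact PerfectRing.toPerfectField (ResidueField Ag) p

theorem algebraMap_absoluteGaloisRestrict (K K' L : Type*) [Field K] [Field K'] [Field L]
    [Algebra K K'] [Algebra K' L] [Algebra K L] [IsScalarTower K K' L] [IsSepClosure K' L]
    (σ : L ≃ₐ[K'] L) (x : separableClosure K L) :
    algebraMap (separableClosure K L) L (absoluteGaloisRestrict K K' L σ x) =
      σ (algebraMap (separableClosure K L) L x) :=
  have : IsSepClosed L := IsSepClosure.sep_closed K'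
  AlgEquiv.restrictNormal_commutes (AlgEquiv.restrictScalars K σ) (separableClosure K L) x

theorem mainTheorem5 (p : ℕ) [Fact p.Prime]
    -- a complete discrete valuation ring `A` of residue characteristic `p`
    (A : Type u) [CommRing A] [IsDomain A] [IsDiscreteValuationRing A]
    [IsAdicComplete (maximalIdeal A) A] [CharP (ResidueField A) p]
    -- its generic residual perfection `Ag`
    (Ag : Type u) [CommRing Ag] [Algebra A Ag] (hAg : IsGenericResidualPerfection p A Ag)
    -- the fraction fields of `A` and `Ag`, and a separable closure `L` of the second
    (K Kg L : Type*) [Field K] [Field Kg] [Field L]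
    [Algebra A K] [IsFractionRing A K] [Algebra Ag Kg] [IsFractionRing Ag Kg]
    [Algebra Kg L] [IsSepClosure Kg L]
    -- the remaining structure maps, all of them compatible
    [Algebra A Kg] [IsScalarTower A Ag Kg] [Algebra K Kg] [IsScalarTower A K Kg]
    [Algebra K L] [IsScalarTower K Kg L] [Algebra A L] [IsScalarTower A K L]
    [Algebra Ag L] [IsScalarTower Ag Kg L] :
    Function.Surjective (absoluteGaloisRestrict K Kg L) ∧
    (inertiaGroup Ag Kg L).map (absoluteGaloisRestrict K Kg L) =
      inertiaGroup A K (separableClosure K L) ∧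
    (wildInertiaGroup Ag Kg L).map (absoluteGaloisRestrict K Kg L) =
      wildInertiaGroup A K (separableClosure K L) := by
  have : IsDomain Ag := (IsFractionRing.injective Ag Kg).isDomain (algebraMap Ag Kg)
  have : IsSepClosed L := IsSepClosure.sep_closed Kg
  obtain ⟨π, hπ⟩ := IsDiscreteValuationRing.exists_irreducible A
  obtain ⟨_, hπg⟩ := hAg.isDiscreteValuationRing hπ
  have hm : maximalIdeal Ag = extendedIdeal A Ag := by
    rw [hπg.maximalIdeal_eq, extendedIdeal_eq_span hπ]
  have : IsAdicComplete (maximalIdeal Ag) Ag := hm ▸ hAg.1.complete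
  obtain ⟨_, _⟩ := hAg.perfectField hm
  have : IsScalarTower A Ag L := IsScalarTower.of_algebraMap_eq fun x => by
    rw [IsScalarTower.algebraMap_apply A K L, IsScalarTower.algebraMap_apply K Kg L,
      ← IsScalarTower.algebraMap_apply A K Kg, IsScalarTower.algebraMap_apply A Ag Kg,
      ← IsScalarTower.algebraMap_apply Ag Kg L]
  have : IsScalarTower A (separableClosure K L) L := IsScalarTower.of_algebraMap_eq fun x => by
    rw [IsScalarTower.algebraMap_apply A K L,
      IsScalarTower.algebraMap_apply A K (separableClosure K L)]
    rfl
  have hr := algebraMap_absoluteGaloisRestrict K Kg L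
  have hI := map_inertiaGroup (A := A) hAg hπ hπg (absoluteGaloisRestrict K Kg L) hr
  exact ⟨surjective_restrict hAg hπ hπg _ hr, hI,
    le_antisymm (map_wildInertiaGroup_le _ hr hπ hπg) (le_map_wildInertiaGroup (p := p) _ hr hI)⟩
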